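/- Let $U\colon\mathbb R^d\to\mathbb R$ be of class $C^1$ and such that its set of global minimizers is non-empty and compact. Assume that there are $\alpha,R>0$ with $U(x)\ge\alpha|x|^2$ for all $|x|>R$, and that there are $\alpha',R'>0$ with $\langle\nabla U(x),x\rangle\ge\alpha'|x|^2$ for all $|x|>R'$. Let $0<T<\infty$ and let $\beta\colon[0,T)\to[1,\infty)$ be differentiable (one-sidedly at $0$). For $t\in[0,T)$ put $$\pi_t(x)=\frac{e^{-\beta(t)U(x)}}{\int_{\mathbb R^d}e^{-\beta(t)U(y)}\,dy},\qquad \mu_t(dx)=\pi_t(x)\,dx .$$ Let $H^1(\mu_t)$ be the completion of $C_c^\infty(\mathbb R^d)$ in the norm $\left(\int f^2\,d\mu_t+\int|\nabla f|^2\,d\mu_t\right)^{1/2}$, i.e. the closure of the pairs $(f,\nabla f)$, $f\in C_c^\infty(\mathbb R^d)$, in $L^2(\mu_t)\oplus L^2(\mu_t;\mathbb R^d)$; its elements are written $(h,\nabla h)$. Let $\dot H^1_t$ be the set of its elements with $\int h\,d\mu_t=0$. Then for every $t\in[0,T)$: 1. For every $x$, the function $s\mapsto\pi_s(x)$ is differentiable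 at $t$, and there is exactly one $h_t\in\dot H^1_t$ such that $v=v_t:=\nabla h_t\in L^2(\mu_t;\mathbb R^d)$ satisfies the weak continuity equation $$\int\langle v(x),\nabla f(x)\rangle\,\pi_t(x)\,dx=\int f(x)\,\partial_t\pi_t(x)\,dx\qquad\text{for all } f\in C_c^\infty(\mathbb R^d).\tag{$*$}$$ Moreover, $\nabla h_t$ is the weak gradient of $h_t$ on $\mathbb R^d$. 2. Among all $v\in L^2(\mu_t;\mathbb R^d)$ that satisfy $(*)$, the field $v_t$ has the smallest $L^2(\mu_t)$-norm, and it is the only one with this norm. If in addition $\int_0^T|\beta'(t)|\,dt<\infty$ (so that $\beta(T^-)$ is finite; this holds for instance when $\beta$ is non-decreasing with a finite limit at $T$, or when $\beta'$ is bounded), then: 3. $t\mapsto\|v_t\|_{L^2(\mu_t)}$ is integrable on $[0,T)$, and $t\mapsto\mu_t$ is an absolutely continuous curve from $[0,T)$ to $(\mathcal P_2(\mathbb R^d),W_2)$: every $\mu_t$ is a probability measure with finite second moment, the metric derivative $|\mu'|(t)=\lim_{h\to0}W_2(\mu_t,\mu_{t+h})/|h|$ exists for almost every $t\in[0,T)$,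 belongs to $L^1(0,T)$, and $W_2(\mu_s,\mu_t)\le\int_s^t|\mu'|(r)\,dr$ for all $0\le s\le t<T$. -/

import Mathlib

open Set Filter Topology MeasureTheory
open scoped ENNReal ContDiff Gradient

noncomputable section

/-- Euclidean space `ℝ^d`. -/
abbrev Rd (d : ℕ) : Type := EuclideanSpace ℝ (Fin d)

variable {d : ℕ}

/-- `f ∈ C_c^∞(ℝ^d)`. -/
def IsTestFunction (f : Rd d → ℝ) : Prop :=
  ContDiff ℝ ∞ f ∧ HasCompactSupport f

/-! ### The weighted Sobolev space -/

/-- The Hilbert space `L²(μ; ℝ) ⊕ L²(μ; ℝ^d)`, with `‖(h, v)‖² = ‖h‖² + ‖v‖²`. -/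
abbrev L2Pair (μ : Measure (Rd d)) : Type :=
  WithLp 2 (Lp ℝ 2 μ × Lp (Rd d) 2 μ)

/-- The pairs `(f, ∇f)` with `f ∈ C_c^∞(ℝ^d)`. The norm that such a pair inherits from `L2Pair μ` is
the one of the inner product `∫ f g dμ + ∫ ⟨∇f, ∇g⟩ dμ` on `C_c^∞(ℝ^d)`. -/
def testGraph (μ : Measure (Rd d)) : Submodule ℝ (L2Pair μ) where
  carrier := {p | ∃ f : Rd d → ℝ, IsTestFunction f ∧ p.fst =ᵐ[μ] f ∧ p.snd =ᵐ[μ] ∇ f}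
  zero_mem' := by
    refine ⟨fun _ => 0, ⟨contDiff_const, HasCompactSupport.zero⟩, Lp.coeFn_zero _ _ _, ?_⟩
    filter_upwards [Lp.coeFn_zero (Rd d) 2 μ] with x hx
    simpa [gradient_fun_const] using hx
  add_mem' := by
    rintro p q ⟨f, ⟨hf, hf'⟩, hpf, hpf'⟩ ⟨g, ⟨hg, hg'⟩, hqg, hqg'⟩
    refine ⟨f + g, ⟨hf.add hg, hf'.add hg'⟩, ?_, ?_⟩
    · filter_upwards [Lp.coeFn_add p.fst q.fst, hpf, hqg] with x h1 h2 h3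
      simp only [WithLp.add_fst, h1, Pi.add_apply, h2, h3]
    · filter_upwards [Lp.coeFn_add p.snd q.snd, hpf', hqg'] with x h1 h2 h3
      have e : ∇ (f + g) x = ∇ f x + ∇ g x := by
        simp only [gradient]
        rw [fderiv_add (hf.differentiable (by simp) x) (hg.differentiable (by simp) x), map_add]
      simp only [WithLp.add_snd, h1, Pi.add_apply, h2, h3, e]
  smul_mem' := by
    rintro c p ⟨f, ⟨hf, hf'⟩, hpf, hpf'⟩
    refine ⟨c • f, ⟨contDiff_const.smul hf, hf'.smul_left (f := fun _ => c)⟩, ?_, ?_⟩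
    · filter_upwards [Lp.coeFn_smul c p.fst, hpf] with x h1 h2
      simp only [WithLp.smul_fst, h1, Pi.smul_apply, h2]
    · filter_upwards [Lp.coeFn_smul c p.snd, hpf'] with x h1 h2
      have e : ∇ (c • f) x = c • ∇ f x := by
        simp only [gradient]
        rw [fderiv_const_smul (hf.differentiable (by simp) x)]
        simp
      simp only [WithLp.smul_snd, h1, Pi.smul_apply, h2, e]

/-- `H¹(μ)`: the completion of `C_c^∞(ℝ^d)` for the norm `(∫ f² dμ + ∫ |∇f|² dμ)^(1/2)`, realised as
the closure of the pairs `(f, ∇f)` in `L²(μ) ⊕ L²(μ; ℝ^d)`. An element is a pair `p` whose first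
component `p.fst` is the function `h` and whose second component `p.snd` is its gradient `∇h`. -/
def sobolevH1 (μ : Measure (Rd d)) : Submodule ℝ (L2Pair μ) :=
  (testGraph μ).topologicalClosure

/-- The zero-mean elements of `H¹(μ)`. -/
def sobolevH1ZeroMean (μ : Measure (Rd d)) : Set (L2Pair μ) :=
  {p | p ∈ sobolevH1 μ ∧ ∫ x, p.fst x ∂μ = 0}

/-- `v` is the weak gradient of `h` on `ℝ^d`. -/
def HasWeakGradient (h : Rd d → ℝ) (v : Rd d → Rd d) : Prop :=
  LocallyIntegrable h ∧ LocallyIntegrable v ∧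
    ∀ φ : Rd d → ℝ, IsTestFunction φ → ∫ x, h x • ∇ φ x = - ∫ x, φ x • v x

/-! ### The Gibbs curve and the continuity equation -/

/-- The Gibbs density `exp (-b U) / ∫ exp (-b U)` at inverse temperature `b`. -/
def gibbsDensity (U : Rd d → ℝ) (b : ℝ) (x : Rd d) : ℝ :=
  Real.exp (-b * U x) / ∫ y, Real.exp (-b * U y)

/-- The measure with Lebesgue density `gibbsDensity U b`. -/
def gibbsMeasure (U : Rd d → ℝ) (b : ℝ) : Measure (Rd d) :=
  volume.withDensity fun x => ENNReal.ofReal (gibbsDensity U b x)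

/-- The time derivative at `t` of the density of the Gibbs curve `s ↦ gibbsMeasure U (β s)`,
`s ∈ [0, T)` (one-sided at `t = 0`). -/
def gibbsDensityDeriv (U : Rd d → ℝ) (β : ℝ → ℝ) (T t : ℝ) (x : Rd d) : ℝ :=
  derivWithin (fun s => gibbsDensity U (β s) x) (Ico 0 T) t

/-- `v` solves `-∇ · (v μ_t) = ∂_t μ_t` weakly, for the Gibbs curve `μ` at the time `t`. -/
def SolvesContinuityEq (U : Rd d → ℝ) (β : ℝ → ℝ) (T t : ℝ) (v : Rd d → Rd d) : Prop :=
  ∀ f : Rd d → ℝ, IsTestFunction f →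
    ∫ x, inner ℝ (v x) (∇ f x) * gibbsDensity U (β t) x =
      ∫ x, f x * gibbsDensityDeriv U β T t x

/-! ### Wasserstein distance and absolutely continuous curves -/

/-- The couplings of `μ` and `ν`. -/
def couplings (μ ν : Measure (Rd d)) : Set (Measure (Rd d × Rd d)) :=
  {γ | γ.fst = μ ∧ γ.snd = ν}

/-- The 2-Wasserstein distance. -/
def W2 (μ ν : Measure (Rd d)) : ℝ≥0∞ :=
  (⨅ γ ∈ couplings μ ν, ∫⁻ z, edist z.1 z.2 ^ 2 ∂γ) ^ (1 / 2 : ℝ)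

/-- `μ ∈ P_2(ℝ^d)`. -/
def IsP2 (μ : Measure (Rd d)) : Prop :=
  IsProbabilityMeasure μ ∧ MemLp id 2 μ

/-- `t ↦ μ t` is an absolutely continuous curve from the interval `I` to `(P_2(ℝ^d), W_2)`: the metric
derivative `m t = lim_{h → 0} W_2(μ_t, μ_{t+h}) / |h|` exists for almost every `t ∈ I`, is integrable
on `I`, and bounds the distance, `W_2(μ_s, μ_t) ≤ ∫_s^t m` for all `s ≤ t` in `I` (which makes the
curve continuous). -/
def IsACCurveW2 (I : Set ℝ) (μ : ℝ → Measure (Rd d)) : Prop :=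
  (∀ t ∈ I, IsP2 (μ t)) ∧
  ∃ m : ℝ → ℝ, IntegrableOn m I ∧
    (∀ᵐ t ∂volume.restrict I,
      Tendsto (fun h : ℝ => (W2 (μ t) (μ (t + h))).toReal / |h|) (𝓝[≠] 0) (𝓝 (m t))) ∧
    ∀ s ∈ I, ∀ t ∈ I, s ≤ t → W2 (μ s) (μ t) ≤ ENNReal.ofReal (∫ r in s..t, m r)

end

open Set Filter Topology MeasureTheory
open scoped ENNReal ContDiff Gradient

noncomputable section

variable {d : ℕ}

/-! Adding a constant to `U` changes no Gibbs density, so `U` may be replaced by a potential `V`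
with `V x ≥ α ‖x‖ ^ 2` everywhere (`exists_isConfining_add_const`, `gibbsDensity_add_const`).
Differentiating the normalized exponential gives `∂_t π_t = -β'(t) (V - mean) π_t`. Hence (*) is a
weak Poisson equation for the centered potential, multiplied by the scalar `β'(t)`. It suffices to
solve it at unit speed in the inverse temperature (`gibbsPotential`) and to put `h_t = β'(t) p`.

Solvability and uniqueness follow from the Lax–Milgram theorem on the zero-mean part of `H¹`, whose
coercivity is the Poincaré inequality `IsConfining.poincare`. That inequality comes from a Lyapunov
argument: the divergence theorem for a radial field controls the mass of `g²` far out by the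
Dirichlet form and by the mass of `g²` on a ball. On the ball the Gibbs density is comparable to
Lebesgue measure, and a Poincaré inequality is obtained by integrating along segments. All constants
are uniform for inverse temperatures in `[1, b₁]`, which bounds the gradient of the unit-speed
potential by some `K` there. Minimality of `v_t` is Pythagoras: two solutions of (*) differ by a
field orthogonal to every gradient of an `H¹` function.

For absolute continuity the main estimate is `W2_gibbsMeasure_le`: `W2 (μ_b, μ_b') ≤ K |b' - b|`. By
Kantorovich duality (`exists_coupling_of_dual_le`) one bounds `∫ Q_1 g dμ_b' - ∫ g dμ_b`, where `Q`
is the Hopf–Lax semigroup. Moving `b` to `b'` linearly while `Q_s` acts, the upper right derivative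
is at most `-¼ ∫ |∇u|² + K |b' - b| (∫ |∇u|²)^(1/2)` with `u = Q_s g`, hence at most `K² (b' - b)²`.
Consequently the distances along the curve are bounded by integrals of `K |β'|`, and a general fact
on curves in metric spaces (`exists_metricDeriv`) yields the metric derivative. The triangle
inequality for `W2` that this fact uses is again proved by duality and `Q`, without gluing
couplings. -/

/-- Bounded Lipschitz functions. -/
def IsBddLip (f : Rd d → ℝ) : Prop :=
  (∃ K, LipschitzWith K f) ∧ ∃ M, ∀ x, |f x| ≤ M

namespace IsBddLip

variable {f g : Rd d → ℝ}

lemma continuous (hf : IsBddLip f) : Continuous f := hf.1.choose_spec.continuous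

lemma integrable (hf : IsBddLip f) (μ : Measure (Rd d)) [IsFiniteMeasure μ] : Integrable f μ := by
  obtain ⟨M, hM⟩ := hf.2
  exact Integrable.of_bound hf.continuous.aestronglyMeasurable M (ae_of_all _ fun x => by
    simpa using hM x)

lemma const (c : ℝ) : IsBddLip (fun _ : Rd d => c) :=
  ⟨⟨0, LipschitzWith.const c⟩, |c|, fun _ => le_rfl⟩

lemma add (hf : IsBddLip f) (hg : IsBddLip g) : IsBddLip (fun x => f x + g x) := by
  obtain ⟨⟨K, hK⟩, M, hM⟩ := hf
  obtain ⟨⟨K', hK'⟩, M', hM'⟩ := hg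
  exact ⟨⟨K + K', hK.add hK'⟩, M + M', fun x =>
    (abs_add_le _ _).trans (add_le_add (hM x) (hM' x))⟩

lemma const_mul (c : ℝ) (hf : IsBddLip f) : IsBddLip (fun x => c * f x) := by
  obtain ⟨⟨K, hK⟩, M, hM⟩ := hf
  exact ⟨⟨_, (lipschitzWith_smul c).comp hK⟩, |c| * M, fun x => by
    rw [abs_mul]; exact mul_le_mul_of_nonneg_left (hM x) (abs_nonneg c)⟩

lemma neg (hf : IsBddLip f) : IsBddLip (fun x => -f x) := by
  simpa using hf.const_mul (-1)

end IsBddLip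

/-! ### Kantorovich duality for the quadratic cost. -/

/-- Values of the dual transport problem, with the cost allowed at the price `K`, over all
`φ(x) + ψ(y) + a ‖x - y‖²` that dominate `f`. -/
def dualValues (μ ν : Measure (Rd d)) (K : ℝ) (f : BoundedContinuousFunction (Rd d × Rd d) ℝ) :
    Set ℝ :=
  {r | ∃ φ ψ : Rd d → ℝ, ∃ a : ℝ, IsBddLip φ ∧ IsBddLip ψ ∧ 0 ≤ a ∧
    (∀ x y, f (x, y) ≤ φ x + ψ y + a * ‖x - y‖ ^ 2) ∧ r = ∫ x, φ x ∂μ + ∫ y, ψ y ∂ν + a * K}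

section Duality

variable {μ ν : Measure (Rd d)} [IsProbabilityMeasure μ] [IsProbabilityMeasure ν] {K : ℝ}

/-- For `a > 0`, dividing by `-a` produces a pair admissible in `h`. For `a = 0` no such scaling
exists, but integrating the pointwise inequality in one variable and then in the other is enough. -/
lemma dualValues_nonneg
    (h : ∀ φ ψ : Rd d → ℝ, IsBddLip φ → IsBddLip ψ → (∀ x y, φ x + ψ y ≤ ‖x - y‖ ^ 2) →
      ∫ x, φ x ∂μ + ∫ y, ψ y ∂ν ≤ K)
    {φ ψ : Rd d → ℝ} (hφ : IsBddLip φ) (hψ : IsBddLip ψ) {a : ℝ} (ha : 0 ≤ a)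
    (hle : ∀ x y, 0 ≤ φ x + ψ y + a * ‖x - y‖ ^ 2) :
    0 ≤ ∫ x, φ x ∂μ + ∫ y, ψ y ∂ν + a * K := by
  rcases ha.eq_or_lt with rfl | ha
  · have h1 : ∀ y, -ψ y ≤ ∫ x, φ x ∂μ := fun y => by
      have : ∫ _, (-ψ y) ∂μ ≤ ∫ x, φ x ∂μ :=
        integral_mono (integrable_const _) (hφ.integrable μ) fun x => by
          have := hle x y; simp at this ⊢; linarith
      simpa using this
    have h2 : ∫ y, -ψ y ∂ν ≤ ∫ _, (∫ x, φ x ∂μ) ∂ν :=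
      integral_mono (hψ.neg.integrable ν) (integrable_const _) h1
    simp [integral_neg] at h2 ⊢
    linarith
  · have := h (fun x => -a⁻¹ * φ x) (fun x => -a⁻¹ * ψ x) (hφ.const_mul _) (hψ.const_mul _)
      (fun x y => by
        have h1 := hle x y
        have h2 : 0 ≤ a⁻¹ * (φ x + ψ y + a * ‖x - y‖ ^ 2) := by positivity
        have h3 : a⁻¹ * (φ x + ψ y + a * ‖x - y‖ ^ 2) =
          a⁻¹ * φ x + a⁻¹ * ψ y + ‖x - y‖ ^ 2 := by field_simp
        linarith)
    rw [integral_const_mul, integral_const_mul] at this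
    have h4 := mul_le_mul_of_nonneg_left this ha.le
    have h5 : a * (-a⁻¹ * ∫ x, φ x ∂μ + -a⁻¹ * ∫ x, ψ x ∂ν) =
      -(∫ x, φ x ∂μ + ∫ x, ψ x ∂ν) := by field_simp; ring
    linarith

/-- Shifting `φ` by `‖f‖` reduces to the target `0`. The bound makes the infimum of the dual values
finite, hence usable as a sublinear functional. -/
lemma dualValues_lower
    (h : ∀ φ ψ : Rd d → ℝ, IsBddLip φ → IsBddLip ψ → (∀ x y, φ x + ψ y ≤ ‖x - y‖ ^ 2) →
      ∫ x, φ x ∂μ + ∫ y, ψ y ∂ν ≤ K)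
    (f : BoundedContinuousFunction (Rd d × Rd d) ℝ) {r : ℝ} (hr : r ∈ dualValues μ ν K f) :
    -‖f‖ ≤ r := by
  obtain ⟨φ, ψ, a, hφ, hψ, ha, hle, rfl⟩ := hr
  have := dualValues_nonneg h (hφ.add (IsBddLip.const ‖f‖)) hψ ha (fun x y => by
    have h1 := hle x y
    have h2 := f.norm_coe_le_norm (x, y)
    rw [Real.norm_eq_abs] at h2
    have h3 := neg_abs_le (f (x, y))
    linarith)
  rw [integral_add (hφ.integrable μ) (integrable_const _)] at this
  simp at this
  linarith

omit [IsProbabilityMeasure μ] [IsProbabilityMeasure ν] in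
lemma dualValues_nonempty (f : BoundedContinuousFunction (Rd d × Rd d) ℝ) :
    (dualValues μ ν K f).Nonempty :=
  ⟨_, fun _ => ‖f‖, fun _ => 0, 0, IsBddLip.const _, IsBddLip.const _, le_rfl, fun x y => by
    simpa using (le_abs_self _).trans (f.norm_coe_le_norm (x, y)), rfl⟩

omit [IsProbabilityMeasure μ] [IsProbabilityMeasure ν] in
lemma dualValues_smul {f : BoundedContinuousFunction (Rd d × Rd d) ℝ} {c : ℝ} (hc : 0 < c) {r : ℝ}
    (hr : r ∈ dualValues μ ν K f) : c * r ∈ dualValues μ ν K (c • f) := by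
  obtain ⟨φ, ψ, a, hφ, hψ, ha, hle, rfl⟩ := hr
  refine ⟨_, _, c * a, hφ.const_mul c, hψ.const_mul c, by positivity, fun x y => ?_, ?_⟩
  · have := mul_le_mul_of_nonneg_left (hle x y) hc.le
    simp only [BoundedContinuousFunction.coe_smul, smul_eq_mul]
    linarith
  · rw [integral_const_mul, integral_const_mul]; ring

/-- A linear functional on bounded continuous functions that is dominated by the dual problem. -/
lemma exists_dual_functional
    (h : ∀ φ ψ : Rd d → ℝ, IsBddLip φ → IsBddLip ψ → (∀ x y, φ x + ψ y ≤ ‖x - y‖ ^ 2) →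
      ∫ x, φ x ∂μ + ∫ y, ψ y ∂ν ≤ K) :
    ∃ F : BoundedContinuousFunction (Rd d × Rd d) ℝ →ₗ[ℝ] ℝ,
      ∀ f, ∀ r ∈ dualValues μ ν K f, F f ≤ r := by
  have hbdd : ∀ f, BddBelow (dualValues μ ν K f) := fun f => ⟨-‖f‖, fun r hr =>
    dualValues_lower h f hr⟩
  obtain ⟨F, -, hF⟩ : ∃ F : BoundedContinuousFunction (Rd d × Rd d) ℝ →ₗ[ℝ] ℝ,
      (∀ x : (⊥ : Submodule ℝ (BoundedContinuousFunction (Rd d × Rd d) ℝ)), F x = 0) ∧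
        ∀ f, F f ≤ sInf (dualValues μ ν K f) := by
    -- Hahn–Banach, extending the zero functional on `⊥`; the infimum of the dual values is the
    -- dominating sublinear functional.
    refine exists_extension_of_le_sublinear
      (E := BoundedContinuousFunction (Rd d × Rd d) ℝ) ⟨⊥, 0⟩
      (fun f => sInf (dualValues μ ν K f)) ?_ ?_ ?_
    · have key : ∀ c : ℝ, 0 < c → ∀ f, sInf (dualValues μ ν K (c • f)) ≤
          c * sInf (dualValues μ ν K f) := by
        intro c hc f
        rw [← div_le_iff₀' hc]
        refine le_csInf (dualValues_nonempty f) fun r hr => ?_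
        rw [div_le_iff₀' hc]
        exact csInf_le (hbdd _) (dualValues_smul hc hr)
      intro c hc f
      refine le_antisymm (key c hc f) ?_
      have := key c⁻¹ (inv_pos.2 hc) (c • f)
      rw [smul_smul, inv_mul_cancel₀ hc.ne', one_smul] at this
      rwa [inv_mul_eq_div, le_div_iff₀' hc] at this
    · intro f g
      rw [← sub_le_iff_le_add']
      refine le_csInf (dualValues_nonempty g) fun r hr => ?_
      rw [sub_le_iff_le_add', ← sub_le_iff_le_add]
      refine le_csInf (dualValues_nonempty f) fun s hs => ?_
      rw [sub_le_iff_le_add]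
      refine csInf_le (hbdd _) ?_
      obtain ⟨φ, ψ, a, hφ, hψ, ha, hle, rfl⟩ := hr
      obtain ⟨φ', ψ', a', hφ', hψ', ha', hle', rfl⟩ := hs
      refine ⟨_, _, a' + a, hφ'.add hφ, hψ'.add hψ, by positivity, fun x y => ?_, ?_⟩
      · have h1 := hle x y
        have h2 := hle' x y
        simp only [BoundedContinuousFunction.coe_add, Pi.add_apply]
        linarith
      · rw [integral_add (hφ'.integrable μ) (hφ.integrable μ),
          integral_add (hψ'.integrable ν) (hψ.integrable ν)]
        ring
    · rintro ⟨f, hf⟩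
      obtain rfl : f = 0 := by simpa using hf
      refine le_csInf (dualValues_nonempty _) fun r hr => ?_
      simpa using dualValues_lower h _ hr
  exact ⟨F, fun f r hr => (hF f).trans (csInf_le (hbdd f) hr)⟩

end Duality

/-- A continuous cutoff function, equal to `1` on the ball of radius `n` and to `0` outside the ball
of radius `n + 1`. -/
def radialCutoff {E : Type*} [Norm E] (n : ℕ) (z : E) : ℝ := 1 - min 1 (max 0 (‖z‖ - n))

section radialCutoff

variable {E : Type*} [NormedAddCommGroup E]

lemma radialCutoff_nonneg (n : ℕ) (z : E) : 0 ≤ radialCutoff n z := by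
  simp [radialCutoff]

lemma radialCutoff_le_one (n : ℕ) (z : E) : radialCutoff n z ≤ 1 := by
  simp [radialCutoff]

lemma continuous_radialCutoff (n : ℕ) : Continuous (radialCutoff n : E → ℝ) := by
  unfold radialCutoff; fun_prop

lemma radialCutoff_eq_one {n : ℕ} {z : E} (h : ‖z‖ ≤ n) : radialCutoff n z = 1 := by
  simp [radialCutoff, h]

lemma tendsto_radialCutoff (z : E) : Tendsto (fun n => radialCutoff n z) atTop (𝓝 1) := by
  refine tendsto_const_nhds.congr' ?_
  obtain ⟨N, hN⟩ := exists_nat_ge ‖z‖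
  filter_upwards [eventually_ge_atTop N] with n hn
  exact (radialCutoff_eq_one (hN.trans (by exact_mod_cast hn))).symm

lemma radialCutoff_eq_zero {n : ℕ} {z : E} (h : n + 1 ≤ ‖z‖) : radialCutoff n z = 0 := by
  have : 1 ≤ max 0 (‖z‖ - n) := le_max_of_le_right (by linarith)
  simp [radialCutoff, min_eq_left this]

lemma hasCompactSupport_radialCutoff [ProperSpace E] (n : ℕ) :
    HasCompactSupport (radialCutoff n : E → ℝ) := by
  refine HasCompactSupport.intro (isCompact_closedBall (0 : E) (n + 1)) fun z hz => ?_
  refine radialCutoff_eq_zero ?_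
  simpa using (not_le.1 (by simpa using hz)).le

lemma monotone_radialCutoff (z : E) : Monotone fun n => radialCutoff n z := by
  intro m n hmn
  have : (m : ℝ) ≤ n := by exact_mod_cast hmn
  simp only [radialCutoff]
  gcongr

lemma lipschitzWith_radialCutoff (n : ℕ) : LipschitzWith 1 (radialCutoff n : E → ℝ) := by
  have h : LipschitzWith 1 (fun z : E => ‖z‖ - n) := by
    simpa using lipschitzWith_one_norm.sub (LipschitzWith.const (n : ℝ))
  change LipschitzWith 1 fun z : E => 1 - min 1 (max 0 (‖z‖ - n))
  simpa using (LipschitzWith.const (1 : ℝ)).sub ((h.const_max 0).const_min 1)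

end radialCutoff

lemma isBddLip_radialCutoff (n : ℕ) : IsBddLip (radialCutoff n : Rd d → ℝ) :=
  ⟨⟨1, lipschitzWith_radialCutoff n⟩, 1, fun x => by
    rw [abs_of_nonneg (radialCutoff_nonneg n x)]; exact radialCutoff_le_one n x⟩

/-- The norm of a pair is the larger of the two norms, so mass far out in the product is controlled
by the tails of the marginals. This is the source of tightness below. -/
lemma one_sub_radialCutoff_prod_le (n : ℕ) (x y : Rd d) :
    1 - radialCutoff n (x, y) ≤ (1 - radialCutoff n x) + (1 - radialCutoff n y) := by
  rcases max_choice ‖x‖ ‖y‖ with h | h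
  · have : radialCutoff n (x, y) = radialCutoff n x := by simp [radialCutoff, Prod.norm_def, h]
    linarith [radialCutoff_le_one n y]
  · have : radialCutoff n (x, y) = radialCutoff n y := by simp [radialCutoff, Prod.norm_def, h]
    linarith [radialCutoff_le_one n x]

/-- Two finite measures on `ℝ^d` with the same integrals of bounded Lipschitz functions agree. -/
lemma measure_ext_of_isBddLip {μ ν : Measure (Rd d)} [IsFiniteMeasure μ] [IsFiniteMeasure ν]
    (h : ∀ φ : Rd d → ℝ, IsBddLip φ → ∫ x, φ x ∂μ = ∫ x, φ x ∂ν) : μ = ν := by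
  refine ext_of_generate_finite _ (BorelSpace.measurable_eq.trans
    borel_eq_generateFrom_isClosed) isPiSystem_isClosed ?_ ?_
  · intro s hs
    have hδ : ∀ n : ℕ, (0 : ℝ) < 1 / (n + 1) := fun n => by positivity
    have h0 := tendsto_one_div_add_atTop_nhds_zero_nat (𝕜 := ℝ)
    have h1 := tendsto_integral_thickenedIndicator_of_isClosed μ hs hδ h0
    have h2 := tendsto_integral_thickenedIndicator_of_isClosed ν hs hδ h0
    have h3 : ∀ n, ∫ x, (thickenedIndicator (hδ n) s x : ℝ) ∂μ =
        ∫ x, (thickenedIndicator (hδ n) s x : ℝ) ∂ν := fun n => h _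
      ⟨⟨_, (LipschitzWith.subtype_val _).comp (lipschitzWith_thickenedIndicator (hδ n) s)⟩, 1,
        fun x => by simpa using thickenedIndicator_le_one (hδ n) s x⟩
    simp_rw [h3] at h1
    have := tendsto_nhds_unique h1 h2
    exact (measureReal_eq_measureReal_iff).1 this
  · have := h (fun _ => 1) (IsBddLip.const 1)
    simp at this
    exact (measureReal_eq_measureReal_iff).1 this

section Duality

variable {μ ν : Measure (Rd d)} [IsProbabilityMeasure μ] [IsProbabilityMeasure ν] {K : ℝ}

lemma tendsto_integral_one_sub_radialCutoff (μ : Measure (Rd d)) [IsProbabilityMeasure μ] :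
    Tendsto (fun n => ∫ x, (1 - radialCutoff n x) ∂μ) atTop (𝓝 0) := by
  have : Tendsto (fun n => ∫ x, (1 - radialCutoff n x) ∂μ) atTop (𝓝 (∫ _, (1 - 1 : ℝ) ∂μ)) := by
    refine tendsto_integral_of_dominated_convergence (fun _ => 1)
      (fun n => (continuous_const.sub (continuous_radialCutoff n)).aestronglyMeasurable)
      (integrable_const _) (fun n => ae_of_all _ fun x => ?_)
      (ae_of_all _ fun x => tendsto_const_nhds.sub (tendsto_radialCutoff x))
    rw [Real.norm_eq_abs, abs_le]
    constructor <;> linarith [radialCutoff_nonneg n x, radialCutoff_le_one n x]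
  simpa using this

/-- The functional on compactly supported functions that a functional on bounded continuous
functions induces. -/
def compactlySupportedToBounded {X : Type*} [TopologicalSpace X] :
    CompactlySupportedContinuousMap X ℝ →ₗ[ℝ] BoundedContinuousFunction X ℝ where
  toFun f := f
  map_add' _ _ := rfl
  map_smul' _ _ := rfl

/-- The functional of `exists_dual_functional` is positive, so Riesz represents it by a measure on
compactly supported functions. Domination by `φ(x) + ψ(y)`, used for both signs, fixes the marginals
and prevents loss of mass at infinity; domination by `‖x - y‖²` at the price `K` bounds the cost. -/
lemma exists_coupling_of_dual_le
    (h : ∀ φ ψ : Rd d → ℝ, IsBddLip φ → IsBddLip ψ → (∀ x y, φ x + ψ y ≤ ‖x - y‖ ^ 2) →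
      ∫ x, φ x ∂μ + ∫ y, ψ y ∂ν ≤ K) :
    ∃ γ ∈ couplings μ ν, ∫⁻ z, edist z.1 z.2 ^ 2 ∂γ ≤ ENNReal.ofReal K := by
  obtain ⟨F, hF⟩ := exists_dual_functional h
  -- If `f ≥ 0`, then `-f` is dominated by the zero potentials, so `F (-f) ≤ 0`.
  have hpos : ∀ f : BoundedContinuousFunction (Rd d × Rd d) ℝ, (∀ z, 0 ≤ f z) → 0 ≤ F f := by
    intro f hf
    have := hF (-f) _ ⟨fun _ => 0, fun _ => 0, 0, IsBddLip.const _, IsBddLip.const _, le_rfl,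
      fun x y => by simpa using hf (x, y), rfl⟩
    simpa using this
  let Λ : CompactlySupportedContinuousMap (Rd d × Rd d) ℝ →ₚ[ℝ] ℝ :=
    PositiveLinearMap.mk₀ (F ∘ₗ compactlySupportedToBounded) fun f hf => hpos _ hf
  let γ := RealRMK.rieszMeasure Λ
  have hγ : ∀ f : BoundedContinuousFunction (Rd d × Rd d) ℝ, HasCompactSupport f →
      ∫ z, f z ∂γ = F f := fun f hf =>
    RealRMK.integral_rieszMeasure Λ ⟨f.toContinuousMap, hf⟩
  let χ : ℕ → BoundedContinuousFunction (Rd d × Rd d) ℝ := fun n =>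
    BoundedContinuousFunction.ofNormedAddCommGroup (radialCutoff n) (continuous_radialCutoff n) 1
      fun z => by
        rw [Real.norm_eq_abs, abs_of_nonneg (radialCutoff_nonneg n z)]
        exact radialCutoff_le_one n z
  have hχ : ∀ n z, χ n z = radialCutoff n z := fun n z => rfl
  have hχs : ∀ n, HasCompactSupport (χ n) := fun n => hasCompactSupport_radialCutoff n
  -- the measure is finite
  have hfin : IsFiniteMeasure γ := by
    have h1 : ∀ n, ∫⁻ z, ENNReal.ofReal (radialCutoff n z) ∂γ ≤ 1 := by
      intro n
      rw [← ofReal_integral_eq_lintegral_ofReal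
        ((continuous_radialCutoff n).integrable_of_hasCompactSupport (hχs n))
        (ae_of_all _ fun z => radialCutoff_nonneg n z)]
      rw [ENNReal.ofReal_le_one]
      refine (hγ (χ n) (hχs n)).trans_le ?_
      have := hF (χ n) _ ⟨fun _ => 1, fun _ => 0, 0, IsBddLip.const _, IsBddLip.const _, le_rfl,
        fun x y => by simpa [hχ] using radialCutoff_le_one n (x, y), rfl⟩
      simpa using this
    have h2 := lintegral_tendsto_of_tendsto_of_monotone (μ := γ) (F := fun _ => 1)
      (f := fun n z => ENNReal.ofReal (radialCutoff n z))
      (fun n => (continuous_radialCutoff n).measurable.ennreal_ofReal.aemeasurable)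
      (ae_of_all _ fun z m n hmn => ENNReal.ofReal_le_ofReal (monotone_radialCutoff z hmn))
      (ae_of_all _ fun z => by
        simpa using ENNReal.tendsto_ofReal (tendsto_radialCutoff z))
    have h3 := le_of_tendsto' h2 h1
    exact ⟨by simpa using h3.trans_lt ENNReal.one_lt_top⟩
  -- the functional is the integral
  have hint : ∀ f : BoundedContinuousFunction (Rd d × Rd d) ℝ, ∫ z, f z ∂γ = F f := by
    intro f
    have h1 : Tendsto (fun n => ∫ z, (f * χ n) z ∂γ) atTop (𝓝 (∫ z, f z ∂γ)) := by
      refine tendsto_integral_of_dominated_convergence (fun _ => ‖f‖)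
        (fun n => (f * χ n).continuous.aestronglyMeasurable)
        (integrable_const _) (fun n => ae_of_all _ fun z => ?_) (ae_of_all _ fun z => ?_)
      · rw [BoundedContinuousFunction.mul_apply, norm_mul, hχ, Real.norm_eq_abs (radialCutoff _ _),
          abs_of_nonneg (radialCutoff_nonneg n z)]
        exact (mul_le_of_le_one_right (norm_nonneg _) (radialCutoff_le_one n z)).trans
          (f.norm_coe_le_norm z)
      · simpa [hχ] using (tendsto_radialCutoff z).const_mul (f z)
    have h2 : ∀ n, ∫ z, (f * χ n) z ∂γ = F (f * χ n) := fun n =>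
      hγ _ ((hχs n).mul_left)
    -- No mass escapes: what the cutoff removes is dominated by a function of `x` plus a function of
    -- `y`, whose `μ`- and `ν`-integrals tend to `0`.
    have h3 : ∀ n, ∀ g : BoundedContinuousFunction (Rd d × Rd d) ℝ,
        (∀ z, g z ≤ ‖f‖ * (1 - radialCutoff n z)) →
        F g ≤ ‖f‖ * (∫ x, (1 - radialCutoff n x) ∂μ + ∫ x, (1 - radialCutoff n x) ∂ν) := by
      intro n g hg
      have hL : IsBddLip (fun x : Rd d => ‖f‖ * (1 + -radialCutoff n x)) :=
        ((IsBddLip.const 1).add (isBddLip_radialCutoff n).neg).const_mul ‖f‖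
      have := hF g _ ⟨_, _, 0, hL, hL, le_rfl, fun x y => ?_, rfl⟩
      · simpa [integral_const_mul, mul_add, ← sub_eq_add_neg] using this
      · have h4 := mul_le_mul_of_nonneg_left (one_sub_radialCutoff_prod_le n x y) (norm_nonneg f)
        have h5 := hg (x, y)
        linarith
    have h4 : Tendsto (fun n => F (f * χ n)) atTop (𝓝 (F f)) := by
      rw [tendsto_iff_norm_sub_tendsto_zero]
      have h5 : Tendsto (fun n => ‖f‖ * (∫ x, (1 - radialCutoff n x) ∂μ +
          ∫ x, (1 - radialCutoff n x) ∂ν)) atTop (𝓝 0) := by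
        simpa using ((tendsto_integral_one_sub_radialCutoff μ).add
          (tendsto_integral_one_sub_radialCutoff ν)).const_mul ‖f‖
      refine squeeze_zero (fun n => norm_nonneg _) (fun n => ?_) h5
      have hb : ∀ z, |f z * (1 - radialCutoff n z)| ≤ ‖f‖ * (1 - radialCutoff n z) := fun z => by
        have h6 : 0 ≤ 1 - radialCutoff n z := by linarith [radialCutoff_le_one n z]
        rw [abs_mul, abs_of_nonneg h6]
        exact mul_le_mul_of_nonneg_right (f.norm_coe_le_norm z) h6
      rw [Real.norm_eq_abs, abs_le', ← map_sub, ← map_neg]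
      constructor
      · refine h3 n _ fun z => ?_
        have := (abs_le.1 (hb z)).1
        simp [hχ]; linarith
      · refine h3 n _ fun z => ?_
        have := (abs_le.1 (hb z)).2
        simp [hχ]; linarith
    simp_rw [h2] at h1
    exact tendsto_nhds_unique h1 h4
  refine ⟨γ, ⟨?_, ?_⟩, ?_⟩
  · have : IsFiniteMeasure γ.fst := inferInstance
    refine measure_ext_of_isBddLip fun φ hφ => ?_
    obtain ⟨M, hM⟩ := hφ.2
    let f : BoundedContinuousFunction (Rd d × Rd d) ℝ :=
      BoundedContinuousFunction.ofNormedAddCommGroup (fun z => φ z.1)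
        (hφ.continuous.comp continuous_fst) M fun z => hM _
    have h1 := hint f
    -- A function of `x` alone is its own dual potential, and so is its negative. The two upper
    -- bounds together give equality of the integrals.
    have h2 := hF f _ ⟨φ, fun _ => 0, 0, hφ, IsBddLip.const _, le_rfl, fun x y => by simp [f], rfl⟩
    have h3 := hF (-f) _ ⟨_, fun _ => 0, 0, hφ.neg, IsBddLip.const _, le_rfl,
      fun x y => by simp [f], rfl⟩
    rw [Measure.fst, integral_map measurable_fst.aemeasurable
      hφ.continuous.aestronglyMeasurable]
    simp [integral_neg] at h2 h3
    exact h1.trans (le_antisymm h2 h3)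
  · have : IsFiniteMeasure γ.snd := inferInstance
    refine measure_ext_of_isBddLip fun φ hφ => ?_
    obtain ⟨M, hM⟩ := hφ.2
    let f : BoundedContinuousFunction (Rd d × Rd d) ℝ :=
      BoundedContinuousFunction.ofNormedAddCommGroup (fun z => φ z.2)
        (hφ.continuous.comp continuous_snd) M fun z => hM _
    have h1 := hint f
    have h2 := hF f _ ⟨fun _ => 0, φ, 0, IsBddLip.const _, hφ, le_rfl, fun x y => by simp [f], rfl⟩
    have h3 := hF (-f) _ ⟨fun _ => 0, _, 0, IsBddLip.const _, hφ.neg, le_rfl,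
      fun x y => by simp [f], rfl⟩
    rw [Measure.snd, integral_map measurable_snd.aemeasurable
      hφ.continuous.aestronglyMeasurable]
    simp [integral_neg] at h2 h3
    exact h1.trans (le_antisymm h2 h3)
  · have hc : Continuous fun z : Rd d × Rd d => ‖z.1 - z.2‖ ^ 2 := by fun_prop
    -- The cost is unbounded, so it is truncated at `n`; the potential `a = 1` bounds every
    -- truncation by `K`, and monotone convergence removes the truncation.
    have h1 : ∀ n : ℕ, ∫⁻ z, ENNReal.ofReal (min (‖z.1 - z.2‖ ^ 2) n) ∂γ ≤ ENNReal.ofReal K := by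
      intro n
      let f : BoundedContinuousFunction (Rd d × Rd d) ℝ :=
        BoundedContinuousFunction.ofNormedAddCommGroup
          (fun z : Rd d × Rd d => min (‖z.1 - z.2‖ ^ 2) (n : ℝ))
          (hc.min continuous_const) n fun z => by
            rw [Real.norm_eq_abs, abs_of_nonneg (by positivity)]; exact min_le_right _ _
      have h2 := hF f _ ⟨fun _ => 0, fun _ => 0, 1, IsBddLip.const _, IsBddLip.const _, zero_le_one,
        fun x y => by simp [f], rfl⟩
      rw [← hint f] at h2
      refine (ofReal_integral_eq_lintegral_ofReal (f.integrable γ)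
        (ae_of_all _ fun z => le_min (sq_nonneg _) n.cast_nonneg)).symm.trans_le ?_
      exact ENNReal.ofReal_le_ofReal (by simpa using h2)
    refine le_of_tendsto' (lintegral_tendsto_of_tendsto_of_monotone
      (fun n => (hc.min continuous_const).measurable.ennreal_ofReal.aemeasurable)
      (ae_of_all _ fun z m n hmn => ?_) (ae_of_all _ fun z => ?_)) h1
    · dsimp only
      gcongr
    · have h3 : edist z.1 z.2 ^ 2 = ENNReal.ofReal (‖z.1 - z.2‖ ^ 2) := by
        rw [edist_dist, dist_eq_norm, ENNReal.ofReal_pow (norm_nonneg _)]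
      rw [h3]
      refine tendsto_const_nhds.congr' ?_
      obtain ⟨N, hN⟩ := exists_nat_ge (‖z.1 - z.2‖ ^ 2)
      filter_upwards [eventually_ge_atTop N] with n hn
      rw [min_eq_left (hN.trans (by exact_mod_cast hn))]

end Duality

/-! ### Confining potentials and their Gibbs measures. -/

/-- Continuous potentials that are bounded below by a multiple of `|x|²`. -/
def IsConfining (V : Rd d → ℝ) : Prop :=
  Continuous V ∧ ∃ α > 0, ∀ x, α * ‖x‖ ^ 2 ≤ V x

namespace IsConfining

variable {V : Rd d → ℝ} {b : ℝ}

lemma nonneg (hV : IsConfining V) (x : Rd d) : 0 ≤ V x := by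
  obtain ⟨-, α, hα, h⟩ := hV
  exact (by positivity : 0 ≤ α * ‖x‖ ^ 2).trans (h x)

lemma continuous_pow_mul_exp (hV : IsConfining V) (b : ℝ) (k : ℕ) :
    Continuous fun x => V x ^ k * Real.exp (-b * V x) := by
  have := hV.1
  fun_prop

lemma integrable_exp (hV : IsConfining V) (hb : 0 < b) :
    Integrable fun x => Real.exp (-b * V x) := by
  obtain ⟨hc, α, hα, h⟩ := hV
  have h1 := (GaussianFourier.integrable_cexp_neg_mul_sq_norm_add (V := Rd d) (b := (b * α : ℝ))
    (by simpa using mul_pos hb hα) 0 0).norm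
  refine h1.mono' (by fun_prop) (ae_of_all _ fun x => ?_)
  rw [Real.norm_eq_abs, Real.abs_exp, Complex.norm_exp]
  refine Real.exp_le_exp.2 ?_
  have := mul_le_mul_of_nonneg_left (h x) hb.le
  simp [← Complex.ofReal_pow, ← Complex.ofReal_mul]
  linarith

/-- Half of the exponential absorbs the power, by `(b V / 2) ^ k / k! ≤ exp (b V / 2)`. -/
lemma pow_mul_exp_le (hV : IsConfining V) (hb : 0 < b) (k : ℕ) (x : Rd d) :
    V x ^ k * Real.exp (-b * V x) ≤
      (k.factorial * (2 / b) ^ k) * Real.exp (-(b / 2) * V x) := by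
  have h1 := Real.pow_div_factorial_le_exp (b / 2 * V x)
    (mul_nonneg (by positivity) (hV.nonneg x)) k
  have h2 : V x ^ k ≤ (k.factorial * (2 / b) ^ k) * Real.exp (b / 2 * V x) := by
    have : V x ^ k = (k.factorial * (2 / b) ^ k) * ((b / 2 * V x) ^ k / k.factorial) := by
      rw [mul_pow, div_pow, div_pow]
      field_simp
    rw [this]
    gcongr
  calc V x ^ k * Real.exp (-b * V x)
      ≤ (k.factorial * (2 / b) ^ k) * Real.exp (b / 2 * V x) * Real.exp (-b * V x) := by gcongr
    _ = _ := by rw [mul_assoc, ← Real.exp_add]; ring_nf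

lemma integrable_pow_mul_exp (hV : IsConfining V) (hb : 0 < b) (k : ℕ) :
    Integrable fun x => V x ^ k * Real.exp (-b * V x) := by
  refine ((hV.integrable_exp (half_pos hb)).const_mul (k.factorial * (2 / b) ^ k)).mono'
    (hV.continuous_pow_mul_exp b k).aestronglyMeasurable (ae_of_all _ fun x => ?_)
  rw [Real.norm_eq_abs, abs_of_nonneg (mul_nonneg (pow_nonneg (hV.nonneg x) k) (by positivity))]
  exact hV.pow_mul_exp_le hb k x

lemma exp_le_exp_of_le (hV : IsConfining V) {a b : ℝ} (hab : a ≤ b) (x : Rd d) :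
    Real.exp (-b * V x) ≤ Real.exp (-a * V x) := by
  refine Real.exp_le_exp.2 ?_
  have := mul_le_mul_of_nonneg_right hab (hV.nonneg x)
  linarith

lemma integrable_mul_pow_mul_exp (hV : IsConfining V) (hb : 0 < b) (k : ℕ) {f : Rd d → ℝ} {M : ℝ}
    (hf : AEStronglyMeasurable f) (hM : ∀ x, |f x| ≤ M) :
    Integrable fun x => f x * (V x ^ k * Real.exp (-b * V x)) :=
  (hV.integrable_pow_mul_exp hb k).bdd_mul hf (ae_of_all _ hM)

/-- The `k`-th moment of `V`, weighted by `f`, of the unnormalized Gibbs measure is differentiable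
in the inverse temperature. -/
lemma hasDerivAt_integral_mul_pow_mul_exp (hV : IsConfining V) (hb : 0 < b) (k : ℕ)
    {f : Rd d → ℝ} {M : ℝ} (hf : AEStronglyMeasurable f) (hM : ∀ x, |f x| ≤ M) :
    HasDerivAt (fun b => ∫ x, f x * (V x ^ k * Real.exp (-b * V x)))
      (-∫ x, f x * (V x ^ (k + 1) * Real.exp (-b * V x))) b := by
  rw [← integral_neg]
  -- For inverse temperatures above `b / 2` the weights are dominated by the integrable one at `b /
  -- 2`.
  have hs : Ioi (b / 2) ∈ 𝓝 b := Ioi_mem_nhds (by linarith)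
  refine (hasDerivAt_integral_of_dominated_loc_of_deriv_le (𝕜 := ℝ)
    (F := fun b x => f x * (V x ^ k * Real.exp (-b * V x)))
    (F' := fun b x => -(f x * (V x ^ (k + 1) * Real.exp (-b * V x))))
    (bound := fun x => M * (V x ^ (k + 1) * Real.exp (-(b / 2) * V x))) hs
    (Eventually.of_forall fun c => hf.mul (hV.continuous_pow_mul_exp c k).aestronglyMeasurable)
    (hV.integrable_mul_pow_mul_exp hb k hf hM)
    (hf.mul (hV.continuous_pow_mul_exp b (k + 1)).aestronglyMeasurable).neg
    (ae_of_all _ fun x c hc => ?_)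
    ((hV.integrable_pow_mul_exp (half_pos hb) (k + 1)).const_mul M)
    (ae_of_all _ fun x c _ => ?_)).2
  · have h0 : 0 ≤ V x ^ (k + 1) := pow_nonneg (hV.nonneg x) _
    rw [norm_neg, norm_mul, Real.norm_eq_abs, Real.norm_eq_abs,
      abs_of_nonneg (a := V x ^ (k + 1) * _) (by positivity)]
    exact mul_le_mul (hM x) (mul_le_mul_of_nonneg_left (hV.exp_le_exp_of_le (mem_Ioi.1 hc).le x) h0)
      (by positivity) ((abs_nonneg _).trans (hM x))
  · have h1 : HasDerivAt (fun c : ℝ => Real.exp (-c * V x)) (Real.exp (-c * V x) * (-1 * V x)) c :=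
      ((hasDerivAt_neg c).mul_const (V x)).exp
    exact ((h1.const_mul (V x ^ k)).const_mul (f x)).congr_deriv (by ring)

lemma partition_pos (hV : IsConfining V) (hb : 0 < b) : 0 < ∫ x, Real.exp (-b * V x) :=
  integral_exp_pos (hV.integrable_exp hb)

lemma gibbsDensity_pos (hV : IsConfining V) (hb : 0 < b) (x : Rd d) : 0 < gibbsDensity V b x :=
  div_pos (Real.exp_pos _) (hV.partition_pos hb)

lemma continuous_gibbsDensity (hV : IsConfining V) (b : ℝ) : Continuous (gibbsDensity V b) := by
  have := hV.1
  unfold gibbsDensity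
  fun_prop

lemma integral_gibbs (hV : IsConfining V) (hb : 0 < b) {E : Type*} [NormedAddCommGroup E]
    [NormedSpace ℝ E] (f : Rd d → E) :
    ∫ x, f x ∂gibbsMeasure V b = ∫ x, gibbsDensity V b x • f x := by
  rw [gibbsMeasure, integral_withDensity_eq_integral_toReal_smul
    (hV.continuous_gibbsDensity b).measurable.ennreal_ofReal (ae_of_all _ fun x => by simp)]
  simp_rw [ENNReal.toReal_ofReal (hV.gibbsDensity_pos hb _).le]

lemma integral_gibbs_eq_div (hV : IsConfining V) (hb : 0 < b) (f : Rd d → ℝ) :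
    ∫ x, f x ∂gibbsMeasure V b =
      (∫ x, f x * Real.exp (-b * V x)) / ∫ x, Real.exp (-b * V x) := by
  rw [hV.integral_gibbs hb, ← integral_div]
  congr 1 with x
  simp only [gibbsDensity, smul_eq_mul]
  ring

lemma integrable_gibbs_iff (hV : IsConfining V) (hb : 0 < b) {E : Type*} [NormedAddCommGroup E]
    [NormedSpace ℝ E] {f : Rd d → E} :
    Integrable f (gibbsMeasure V b) ↔ Integrable fun x => gibbsDensity V b x • f x := by
  rw [gibbsMeasure, integrable_withDensity_iff_integrable_smul'
    (hV.continuous_gibbsDensity b).measurable.ennreal_ofReal (ae_of_all _ fun x => by simp)]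
  simp_rw [ENNReal.toReal_ofReal (hV.gibbsDensity_pos hb _).le]

lemma isProbabilityMeasure (hV : IsConfining V) (hb : 0 < b) :
    IsProbabilityMeasure (gibbsMeasure V b) := by
  constructor
  have h : Integrable (gibbsDensity V b) := (hV.integrable_exp hb).div_const _
  have h1 := ofReal_integral_eq_lintegral_ofReal h
    (ae_of_all _ fun x => (hV.gibbsDensity_pos hb x).le)
  rw [gibbsMeasure, withDensity_apply _ MeasurableSet.univ, Measure.restrict_univ, ← h1]
  simp only [gibbsDensity, integral_div, div_self (hV.partition_pos hb).ne', ENNReal.ofReal_one]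

lemma gibbs_absolutelyContinuous (V : Rd d → ℝ) (b : ℝ) : gibbsMeasure V b ≪ volume :=
  withDensity_absolutelyContinuous _ _

lemma integrable_pow_gibbs (hV : IsConfining V) (hb : 0 < b) (k : ℕ) :
    Integrable (fun x => V x ^ k) (gibbsMeasure V b) := by
  rw [hV.integrable_gibbs_iff hb]
  refine ((hV.integrable_pow_mul_exp hb k).div_const (∫ x, Real.exp (-b * V x))).congr
    (ae_of_all _ fun x => ?_)
  simp only [gibbsDensity, smul_eq_mul]
  ring

lemma memLp_gibbs (hV : IsConfining V) (hb : 0 < b) : MemLp V 2 (gibbsMeasure V b) :=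
  (memLp_two_iff_integrable_sq hV.1.aestronglyMeasurable).2 (hV.integrable_pow_gibbs hb 2)

lemma isP2_gibbs (hV : IsConfining V) (hb : 0 < b) : IsP2 (gibbsMeasure V b) := by
  refine ⟨hV.isProbabilityMeasure hb, ?_⟩
  obtain ⟨-, α, hα, h⟩ := id hV
  rw [memLp_two_iff_integrable_sq_norm aestronglyMeasurable_id]
  refine ((hV.integrable_pow_gibbs hb 1).const_mul α⁻¹).mono' (by fun_prop)
    (ae_of_all _ fun x => ?_)
  rw [Real.norm_eq_abs, abs_of_nonneg (by positivity), pow_one, le_inv_mul_iff₀ hα]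
  exact h x

end IsConfining

/-- The mean of `V` under its Gibbs measure. -/
def gibbsMean (V : Rd d → ℝ) (b : ℝ) : ℝ := ∫ x, V x ∂gibbsMeasure V b

namespace IsConfining

variable {V : Rd d → ℝ} {b : ℝ}

lemma hasDerivAt_gibbsDensity (hV : IsConfining V) (hb : 0 < b) (x : Rd d) :
    HasDerivAt (fun b => gibbsDensity V b x) (-(V x - gibbsMean V b) * gibbsDensity V b x) b := by
  have h1 : HasDerivAt (fun c : ℝ => Real.exp (-c * V x)) (Real.exp (-b * V x) * (-1 * V x)) b :=
    ((hasDerivAt_neg b).mul_const (V x)).exp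
  have h2 := hV.hasDerivAt_integral_mul_pow_mul_exp hb 0 (f := fun _ => 1) (M := 1)
    aestronglyMeasurable_const (by simp)
  simp only [pow_zero, one_mul, zero_add, pow_one] at h2
  have hZ := (hV.partition_pos hb).ne'
  refine HasDerivAt.congr_deriv (f' := _) (h1.div h2 hZ) ?_
  have h3 : gibbsMean V b = (∫ x, V x * Real.exp (-b * V x)) / ∫ x, Real.exp (-b * V x) :=
    hV.integral_gibbs_eq_div hb V
  rw [h3, gibbsDensity]
  generalize (∫ x, Real.exp (-b * V x)) = Z at *
  field_simp
  ring

/-- The quotient rule for `(∫ f e^{-bV}) / (∫ e^{-bV})`; the result is minus the covariance of `f`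
and `V`. -/
lemma hasDerivAt_integral_gibbs (hV : IsConfining V) (hb : 0 < b) {f : Rd d → ℝ} {M : ℝ}
    (hf : AEStronglyMeasurable f) (hM : ∀ x, |f x| ≤ M) :
    HasDerivAt (fun b => ∫ x, f x ∂gibbsMeasure V b)
      (-∫ x, f x * (V x - gibbsMean V b) ∂gibbsMeasure V b) b := by
  have h1 := hV.hasDerivAt_integral_mul_pow_mul_exp hb 0 hf hM
  have h2 := hV.hasDerivAt_integral_mul_pow_mul_exp hb 0 (f := fun _ => 1) (M := 1)
    aestronglyMeasurable_const (by simp)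
  simp only [pow_zero, one_mul, zero_add, pow_one] at h1 h2
  have hZ := (hV.partition_pos hb).ne'
  refine ((h1.div h2 hZ).congr_of_eventuallyEq ?_).congr_deriv ?_
  · filter_upwards [Ioi_mem_nhds hb] with c hc
    exact hV.integral_gibbs_eq_div hc f
  · have h3 := hV.integrable_mul_pow_mul_exp hb 1 hf hM
    have h4 := hV.integrable_mul_pow_mul_exp hb 0 hf hM
    simp only [pow_zero, one_mul, pow_one] at h3 h4
    have h5 : ∫ x, f x * (V x - gibbsMean V b) * Real.exp (-b * V x) =
        (∫ x, f x * (V x * Real.exp (-b * V x))) -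
          gibbsMean V b * ∫ x, f x * Real.exp (-b * V x) := by
      rw [← integral_const_mul, ← integral_sub h3 (h4.const_mul (gibbsMean V b))]
      congr 1 with x
      ring
    have h6 : gibbsMean V b = (∫ x, V x * Real.exp (-b * V x)) / ∫ x, Real.exp (-b * V x) :=
      hV.integral_gibbs_eq_div hb V
    rw [hV.integral_gibbs_eq_div hb, h5, h6]
    generalize (∫ x, Real.exp (-b * V x)) = Z at *
    generalize (∫ x, V x * Real.exp (-b * V x)) = A at *
    generalize (∫ x, f x * Real.exp (-b * V x)) = A₁ at *
    generalize (∫ x, f x * (V x * Real.exp (-b * V x))) = A₂ at *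
    field_simp
    ring

end IsConfining

/-! ### Gradients, test functions and weighted `L²` spaces. -/

lemma norm_gradient (f : Rd d → ℝ) (x : Rd d) : ‖∇ f x‖ = ‖fderiv ℝ f x‖ := by
  simp [gradient]

lemma gradient_mul {f g : Rd d → ℝ} {x : Rd d} (hf : DifferentiableAt ℝ f x)
    (hg : DifferentiableAt ℝ g x) :
    ∇ (fun x => f x * g x) x = f x • ∇ g x + g x • ∇ f x := by
  simp only [gradient]
  rw [fderiv_fun_mul hf hg]
  simp

lemma measurable_gradient (f : Rd d → ℝ) : Measurable (∇ f) :=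
  (InnerProductSpace.toDual ℝ (Rd d)).symm.continuous.measurable.comp (measurable_fderiv ℝ f)

lemma continuous_gradient {f : Rd d → ℝ} (hf : ContDiff ℝ 1 f) : Continuous (∇ f) :=
  (InnerProductSpace.toDual ℝ (Rd d)).symm.continuous.comp (hf.continuous_fderiv (by simp))

namespace IsTestFunction

variable {f : Rd d → ℝ}

lemma contDiff_one (hf : IsTestFunction f) : ContDiff ℝ 1 f := hf.1.of_le (by simp)

lemma differentiable (hf : IsTestFunction f) : Differentiable ℝ f :=
  hf.1.differentiable (by simp)

lemma continuous_gradient (hf : IsTestFunction f) : Continuous (∇ f) :=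
  _root_.continuous_gradient hf.contDiff_one

lemma hasCompactSupport_gradient (hf : IsTestFunction f) : HasCompactSupport (∇ f) := by
  refine (hf.2.fderiv (𝕜 := ℝ)).comp_left (g := (InnerProductSpace.toDual ℝ (Rd d)).symm) ?_
  simp

lemma exists_bound (hf : IsTestFunction f) : ∃ M, ∀ x, ‖f x‖ ≤ M ∧ ‖∇ f x‖ ≤ M := by
  obtain ⟨M, hM⟩ := hf.2.exists_bound_of_continuous hf.1.continuous
  obtain ⟨M', hM'⟩ := hf.hasCompactSupport_gradient.exists_bound_of_continuous hf.continuous_gradient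
  exact ⟨max M M', fun x => ⟨(hM x).trans (le_max_left _ _), (hM' x).trans (le_max_right _ _)⟩⟩

lemma isBddLip (hf : IsTestFunction f) : IsBddLip f := by
  obtain ⟨M, hM⟩ := hf.exists_bound
  refine ⟨⟨M.toNNReal, lipschitzWith_of_nnnorm_fderiv_le hf.differentiable fun x => ?_⟩, M,
    fun x => (hM x).1⟩
  rw [← NNReal.coe_le_coe, coe_nnnorm, ← norm_gradient]
  exact (hM x).2.trans (Real.le_coe_toNNReal M)

end IsTestFunction

section L2Pair

variable {μ : Measure (Rd d)}

/-- The element of `L²(μ) ⊕ L²(μ; ℝ^d)` given by bounded measurable functions. -/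
lemma exists_l2Pair [IsFiniteMeasure μ] {u : Rd d → ℝ} {w : Rd d → Rd d} {M : ℝ}
    (hu : AEStronglyMeasurable u μ) (hw : AEStronglyMeasurable w μ)
    (hM : ∀ᵐ x ∂μ, ‖u x‖ ≤ M ∧ ‖w x‖ ≤ M) : ∃ p : L2Pair μ, p.fst =ᵐ[μ] u ∧ p.snd =ᵐ[μ] w :=
  have hu' : MemLp u 2 μ := MemLp.of_bound hu M (hM.mono fun _ h => h.1)
  have hw' : MemLp w 2 μ := MemLp.of_bound hw M (hM.mono fun _ h => h.2)
  ⟨WithLp.toLp 2 (hu'.toLp u, hw'.toLp w), hu'.coeFn_toLp, hw'.coeFn_toLp⟩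

lemma norm_sq_eq_integral {E : Type*} [NormedAddCommGroup E] [InnerProductSpace ℝ E]
    (f : Lp E 2 μ) : ‖f‖ ^ 2 = ∫ x, ‖f x‖ ^ 2 ∂μ := by
  rw [← real_inner_self_eq_norm_sq, L2.inner_def]
  simp

lemma inner_eq_integral {E : Type*} [NormedAddCommGroup E] [InnerProductSpace ℝ E]
    {f g : Lp E 2 μ} {f' g' : Rd d → E} (hf : f =ᵐ[μ] f') (hg : g =ᵐ[μ] g') :
    inner ℝ f g = ∫ x, inner ℝ (f' x) (g' x) ∂μ := by
  rw [L2.inner_def]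
  refine integral_congr_ae ?_
  filter_upwards [hf, hg] with x h1 h2
  rw [h1, h2]

/-- Bounded almost everywhere convergence implies convergence in `L²` of a finite measure. -/
lemma tendsto_Lp_of_bounded [IsFiniteMeasure μ] {E : Type*} [NormedAddCommGroup E]
    [InnerProductSpace ℝ E] {f : ℕ → Lp E 2 μ} {g : Lp E 2 μ} {M : ℝ}
    (hf : ∀ n, ∀ᵐ x ∂μ, ‖f n x‖ ≤ M) (hg : ∀ᵐ x ∂μ, ‖g x‖ ≤ M)
    (h : ∀ᵐ x ∂μ, Tendsto (fun n => f n x) atTop (𝓝 (g x))) : Tendsto f atTop (𝓝 g) := by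
  rw [tendsto_iff_norm_sub_tendsto_zero]
  have h1 : Tendsto (fun n => ∫ x, ‖f n x - g x‖ ^ 2 ∂μ) atTop (𝓝 (∫ _, (0 : ℝ) ∂μ)) := by
    refine tendsto_integral_of_dominated_convergence (fun _ => (2 * M) ^ 2)
      (fun n => (((Lp.aestronglyMeasurable (f n)).sub (Lp.aestronglyMeasurable g)).norm.pow 2))
      (integrable_const _) (fun n => ?_) ?_
    · filter_upwards [hf n, hg] with x h1 h2
      rw [norm_pow, norm_norm]
      have := norm_sub_le (f n x) (g x)
      gcongr
      linarith
    · filter_upwards [h] with x hx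
      simpa using (tendsto_iff_norm_sub_tendsto_zero.1 hx).pow 2
  have h2 : ∀ n, ‖f n - g‖ = √(∫ x, ‖f n x - g x‖ ^ 2 ∂μ) := by
    intro n
    rw [eq_comm, Real.sqrt_eq_iff_mul_self_eq (integral_nonneg fun _ => sq_nonneg _)
      (norm_nonneg _), ← sq, norm_sq_eq_integral]
    refine integral_congr_ae ?_
    filter_upwards [Lp.coeFn_sub (f n) g] with x hx
    rw [hx, Pi.sub_apply]
  simp_rw [h2]
  simpa using h1.sqrt

end L2Pair

/-! ### Cutoff functions and mollification -/

/-- Dilations of a single bump. The value `1` is reached near `x`, and not only at `x`, so that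
multiplying by `χ n` eventually leaves gradients at `x` unchanged too. -/
lemma exists_smooth_cutoff (d : ℕ) : ∃ C : ℝ, ∃ χ : ℕ → Rd d → ℝ, (∀ n, IsTestFunction (χ n)) ∧
    (∀ n x, 0 ≤ χ n x ∧ χ n x ≤ 1) ∧ (∀ n x, ‖∇ (χ n) x‖ ≤ C / (n + 1)) ∧
    ∀ x, ∀ᶠ n in atTop, ∀ᶠ y in 𝓝 x, χ n y = 1 := by
  let η : ContDiffBump (0 : Rd d) := ⟨1, 2, one_pos, one_lt_two⟩
  have hη : IsTestFunction (η : Rd d → ℝ) := ⟨η.contDiff, η.hasCompactSupport⟩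
  obtain ⟨C, hC⟩ := hη.exists_bound
  have hpos : ∀ n : ℕ, (0 : ℝ) < ((n : ℝ) + 1)⁻¹ := fun n => by positivity
  refine ⟨C, fun n x => η (((n : ℝ) + 1)⁻¹ • x), fun n => ⟨?_, ?_⟩, fun n x => ⟨η.nonneg, η.le_one⟩,
    fun n x => ?_, fun x => ?_⟩
  · exact η.contDiff.comp (contDiff_const_smul _)
  · exact η.hasCompactSupport.comp_smul (hpos n).ne'
  · rw [norm_gradient, fderiv_comp_smul, norm_smul, ← norm_gradient, Real.norm_eq_abs,
      abs_of_pos (hpos n), div_eq_inv_mul]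
    exact mul_le_mul_of_nonneg_left (hC _).2 (hpos n).le
  · obtain ⟨N, hN⟩ := exists_nat_gt ‖x‖
    filter_upwards [eventually_ge_atTop N] with n hn
    have h1 : ‖x‖ < n := hN.trans_le (by exact_mod_cast hn)
    filter_upwards [(continuous_norm.tendsto x).eventually_lt_const h1] with y hy
    refine η.one_of_mem_closedBall ?_
    rw [mem_closedBall_zero_iff, norm_smul, Real.norm_eq_abs, abs_of_pos (hpos n),
      inv_mul_le_iff₀ (by positivity)]
    change ‖y‖ ≤ (n + 1) * 1
    linarith

open ContinuousLinearMap in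
/-- Bounded Lipschitz functions are limits of smooth functions, with bounded almost everywhere
convergence of the gradients. -/
lemma IsBddLip.exists_smooth_approx {u : Rd d → ℝ} (hu : IsBddLip u) :
    ∃ M : ℝ, ∃ v : ℕ → Rd d → ℝ, (∀ n, ContDiff ℝ ∞ (v n)) ∧
      (∀ n x, ‖v n x‖ ≤ M ∧ ‖∇ (v n) x‖ ≤ M) ∧ (∀ x, Tendsto (fun n => v n x) atTop (𝓝 (u x))) ∧
      ∀ᵐ x, Tendsto (fun n => ∇ (v n) x) atTop (𝓝 (∇ u x)) := by
  have hc := hu.continuous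
  obtain ⟨⟨K, hK⟩, M, hM⟩ := id hu
  let φ : ℕ → ContDiffBump (0 : Rd d) := fun n =>
    ⟨1 / ((n : ℝ) + 1), 2 * (1 / ((n : ℝ) + 1)), by positivity, by
      have : (0 : ℝ) < 1 / ((n : ℝ) + 1) := by positivity
      linarith⟩
  have hφ : Tendsto (fun n => (φ n).rOut) atTop (𝓝 0) := by
    simpa [φ] using (tendsto_one_div_add_atTop_nhds_zero_nat (𝕜 := ℝ)).const_mul 2
  let ρ : ℕ → Rd d → ℝ := fun n => (φ n).normed volume
  have hρi : ∀ n, Integrable (ρ n) := fun n => (φ n).integrable_normed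
  have hρ0 : ∀ n x, 0 ≤ ρ n x := fun n x => (φ n).nonneg_normed x
  have hρ1 : ∀ n, ∫ x, ρ n x = 1 := fun n => (φ n).integral_normed
  have hρc : ∀ n, Continuous (ρ n) := fun n => (φ n).continuous_normed
  let v : ℕ → Rd d → ℝ := fun n => convolution (ρ n) u (lsmul ℝ ℝ) volume
  have hbound : ∀ n {E : Type} [NormedAddCommGroup E] [NormedSpace ℝ E] (g : Rd d → E) (C : ℝ),
      (∀ x, ‖g x‖ ≤ C) → ∀ x, ‖∫ t, ρ n t • g (x - t)‖ ≤ C := by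
    intro n E _ _ g C hC x
    refine (norm_integral_le_of_norm_le ((hρi n).mul_const C) (ae_of_all _ fun t => ?_)).trans
      (by rw [integral_mul_const, hρ1, one_mul])
    rw [norm_smul, Real.norm_eq_abs, abs_of_nonneg (hρ0 n t)]
    exact mul_le_mul_of_nonneg_left (hC _) (hρ0 n t)
  -- The derivative is put on `u`, which is differentiable only almost everywhere (Rademacher); a
  -- Lipschitz bound on the integrand replaces the usual bound on its derivative.
  have hder : ∀ n x, fderiv ℝ (v n) x = ∫ t, ρ n t • fderiv ℝ u (x - t) := by
    intro n x
    refine (hasFDerivAt_integral_of_dominated_loc_of_lip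
      (F := fun x t => ρ n t • u (x - t)) (F' := fun t => ρ n t • fderiv ℝ u (x - t))
      (bound := fun t => ρ n t * K) (s := univ) univ_mem
      (Eventually.of_forall fun y => ?_) ?_ ?_ ?_ ?_ ?_).2.fderiv
    · exact ((hρc n).smul (hc.comp (continuous_const.sub continuous_id))).aestronglyMeasurable
    · refine ((hρi n).mul_const M).mono'
        ((hρc n).smul (hc.comp (continuous_const.sub continuous_id))).aestronglyMeasurable
        (ae_of_all _ fun t => ?_)
      rw [norm_smul, Real.norm_eq_abs, abs_of_nonneg (hρ0 n t)]
      exact mul_le_mul_of_nonneg_left (hM _) (hρ0 n t)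
    · exact (hρc n).aestronglyMeasurable.smul
        ((measurable_fderiv ℝ u).comp (measurable_const.sub measurable_id)).aestronglyMeasurable
    · refine ae_of_all _ fun t => lipschitzOnWith_univ.2 (LipschitzWith.of_dist_le_mul fun y z => ?_)
      have := hK.dist_le_mul (y - t) (z - t)
      rw [dist_sub_right] at this
      rw [dist_smul₀, Real.norm_eq_abs, abs_of_nonneg (hρ0 n t), Real.coe_nnabs, abs_of_nonneg
        (mul_nonneg (hρ0 n t) K.coe_nonneg), mul_assoc]
      exact mul_le_mul_of_nonneg_left this (hρ0 n t)
    · exact (hρi n).mul_const _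
    · have h1 : ∀ᵐ t, DifferentiableAt ℝ u (x - t) :=
        (Measure.measurePreserving_sub_left volume x).quasiMeasurePreserving.ae hK.ae_differentiableAt
      filter_upwards [h1] with t ht
      have h2 : HasFDerivAt (fun y => u (y - t)) (fderiv ℝ u (x - t)) x :=
        ht.hasFDerivAt.comp x ((hasFDerivAt_id x).sub_const t)
      exact h2.const_smul (ρ n t)
  have hK' : ∀ x, ‖fderiv ℝ u x‖ ≤ K := fun x => norm_fderiv_le_of_lipschitz ℝ hK
  refine ⟨max M K, v, fun n => ?_, fun n x => ⟨?_, ?_⟩, fun x => ?_, ?_⟩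
  · exact (φ n).hasCompactSupport_normed.contDiff_convolution_left _ (φ n).contDiff_normed
      hc.locallyIntegrable
  · exact (hbound n u M hM x).trans (le_max_left _ _)
  · rw [norm_gradient, hder]
    exact (hbound n (fderiv ℝ u) K hK' x).trans (le_max_right _ _)
  · exact ContDiffBump.convolution_tendsto_right_of_continuous hφ hc x
  · have hloc : LocallyIntegrable (fderiv ℝ u) :=
      (locallyIntegrable_const (K : ℝ)).mono (measurable_fderiv ℝ u).aestronglyMeasurable
        (ae_of_all _ fun x => by simpa using hK' x)
    -- Lebesgue differentiation for the bounded map `fderiv ℝ u`; the factor `2` is the ratio of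
    -- outer to inner radius of the bumps.
    filter_upwards [ContDiffBump.ae_convolution_tendsto_right_of_locallyIntegrable
      (φ := φ) (K := 2) hφ (Eventually.of_forall fun n => le_rfl) hloc] with x hx
    simp only [gradient, hder]
    exact ((InnerProductSpace.toDual ℝ (Rd d)).symm.continuous.tendsto _).comp hx

section SobolevMembership

variable {μ : Measure (Rd d)} [IsFiniteMeasure μ]

lemma IsTestFunction.exists_mem_testGraph {f : Rd d → ℝ} (hf : IsTestFunction f) :
    ∃ p ∈ testGraph μ, p.fst =ᵐ[μ] f ∧ p.snd =ᵐ[μ] ∇ f := by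
  obtain ⟨M, hM⟩ := hf.exists_bound
  obtain ⟨p, h1, h2⟩ := exists_l2Pair (μ := μ) (M := M) hf.1.continuous.aestronglyMeasurable
    hf.continuous_gradient.aestronglyMeasurable (ae_of_all _ hM)
  exact ⟨p, ⟨f, hf, h1, h2⟩, h1, h2⟩

/-- Bounded Lipschitz functions belong to the weighted Sobolev space. -/
lemma IsBddLip.exists_mem_sobolevH1 {u : Rd d → ℝ} (hu : IsBddLip u) (hμ : μ ≪ volume) :
    ∃ p ∈ sobolevH1 μ, p.fst =ᵐ[μ] u ∧ p.snd =ᵐ[μ] ∇ u := by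
  obtain ⟨M, v, hv, hvM, hvu, hvg⟩ := hu.exists_smooth_approx
  obtain ⟨C, χ, hχ, hχ01, hχg, hχ1⟩ := exists_smooth_cutoff d
  have hM0 : 0 ≤ M := (norm_nonneg _).trans (hvM 0 0).1
  have hC0 : 0 ≤ C := by simpa using (norm_nonneg _).trans (hχg 0 0)
  have hCn : ∀ n x, ‖∇ (χ n) x‖ ≤ C := fun n x => (hχg n x).trans (div_le_self hC0 (by simp))
  -- The approximants: mollification supplies smoothness and the cutoff supplies compact support,
  -- with values and gradients bounded uniformly in `n`.
  have htest : ∀ n, IsTestFunction fun x => χ n x * v n x := fun n =>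
    ⟨(hχ n).1.mul (hv n), (hχ n).2.mul_right⟩
  have hgrad : ∀ n x, ∇ (fun x => χ n x * v n x) x = χ n x • ∇ (v n) x + v n x • ∇ (χ n) x :=
    fun n x => gradient_mul ((hχ n).differentiable x) ((hv n).differentiable (by simp) x)
  have hb1 : ∀ n x, ‖χ n x * v n x‖ ≤ M + M * C := fun n x => by
    rw [norm_mul, Real.norm_eq_abs, abs_of_nonneg (hχ01 n x).1]
    have := mul_le_mul (hχ01 n x).2 (hvM n x).1 (norm_nonneg _) zero_le_one
    have := mul_nonneg hM0 hC0
    linarith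
  have hb2 : ∀ n x, ‖∇ (fun x => χ n x * v n x) x‖ ≤ M + M * C := fun n x => by
    rw [hgrad]
    refine (norm_add_le _ _).trans ?_
    rw [norm_smul, norm_smul, Real.norm_eq_abs, abs_of_nonneg (hχ01 n x).1]
    have := mul_le_mul (hχ01 n x).2 (hvM n x).2 (norm_nonneg _) zero_le_one
    have := mul_le_mul (hvM n x).1 (hCn n x) (norm_nonneg _) hM0
    linarith
  have ht1 : ∀ x, Tendsto (fun n => χ n x * v n x) atTop (𝓝 (u x)) := fun x => by
    refine (hvu x).congr' ?_
    filter_upwards [hχ1 x] with n hn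
    rw [hn.self_of_nhds, one_mul]
  have ht2 : ∀ᵐ x ∂μ, Tendsto (fun n => ∇ (fun x => χ n x * v n x) x) atTop (𝓝 (∇ u x)) := by
    filter_upwards [hμ.ae_le hvg] with x hx
    refine hx.congr' ?_
    filter_upwards [hχ1 x] with n hn
    refine Filter.EventuallyEq.gradient_eq ?_
    filter_upwards [hn] with y hy
    rw [hy, one_mul]
  choose q hq hq1 hq2 using fun n => (htest n).exists_mem_testGraph (μ := μ)
  have hub : ∀ᵐ x ∂μ, ‖u x‖ ≤ M + M * C ∧ ‖∇ u x‖ ≤ M + M * C := by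
    filter_upwards [ht2] with x hx
    exact ⟨le_of_tendsto' (ht1 x).norm fun n => hb1 n x, le_of_tendsto' hx.norm fun n => hb2 n x⟩
  obtain ⟨p, hp1, hp2⟩ := exists_l2Pair (μ := μ) (M := M + M * C)
    hu.continuous.aestronglyMeasurable (measurable_gradient u).aestronglyMeasurable hub
  refine ⟨p, ?_, hp1, hp2⟩
  have hall1 : ∀ᵐ x ∂μ, ∀ n, (q n).fst x = χ n x * v n x := ae_all_iff.2 hq1
  have hall2 : ∀ᵐ x ∂μ, ∀ n, (q n).snd x = ∇ (fun x => χ n x * v n x) x := ae_all_iff.2 hq2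
  have hlim1 : Tendsto (fun n => (q n).fst) atTop (𝓝 p.fst) := by
    refine tendsto_Lp_of_bounded (M := M + M * C) (fun n => ?_) ?_ ?_
    · filter_upwards [hq1 n] with x hx
      rw [hx]; exact hb1 n x
    · filter_upwards [hp1, hub] with x hx h
      rw [hx]; exact h.1
    · filter_upwards [hp1, hall1] with x hx h
      simp_rw [hx, h]; exact ht1 x
  have hlim2 : Tendsto (fun n => (q n).snd) atTop (𝓝 p.snd) := by
    refine tendsto_Lp_of_bounded (M := M + M * C) (fun n => ?_) ?_ ?_
    · filter_upwards [hq2 n] with x hx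
      rw [hx]; exact hb2 n x
    · filter_upwards [hp2, hub] with x hx h
      rw [hx]; exact h.2
    · filter_upwards [hp2, hall2, ht2] with x hx h h'
      simp_rw [hx, h]; exact h'
  have hlim : Tendsto q atTop (𝓝 p) :=
    ((WithLp.prod_continuous_toLp 2 _ _).tendsto _).comp (hlim1.prodMk_nhds hlim2)
  exact mem_closure_of_tendsto hlim (Eventually.of_forall hq)

end SobolevMembership

/-! ### Weak gradients -/

namespace IsConfining

variable {V : Rd d → ℝ} {b : ℝ}

/-- The Gibbs density is continuous and positive, so its inverse is continuous and dividing by it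
preserves local integrability. -/
lemma locallyIntegrable_of_lp (hV : IsConfining V) (hb : 0 < b) {E : Type*} [NormedAddCommGroup E]
    [NormedSpace ℝ E] (f : Lp E 2 (gibbsMeasure V b)) : LocallyIntegrable f := by
  have := hV.isProbabilityMeasure hb
  have h1 : Integrable f (gibbsMeasure V b) := (Lp.memLp f).integrable one_le_two
  rw [hV.integrable_gibbs_iff hb] at h1
  have h2 := h1.locallyIntegrable.continuous_smul ((hV.continuous_gibbsDensity b).inv₀
    fun x => (hV.gibbsDensity_pos hb x).ne')
  refine h2.congr (ae_of_all _ fun x => ?_)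
  simp only [Pi.inv_apply]
  rw [smul_smul, inv_mul_cancel₀ (hV.gibbsDensity_pos hb x).ne', one_smul]

lemma integral_gibbs_inv_mul (hV : IsConfining V) (hb : 0 < b) (f : Rd d → ℝ) :
    ∫ x, (gibbsDensity V b x)⁻¹ * f x ∂gibbsMeasure V b = ∫ x, f x := by
  rw [hV.integral_gibbs hb]
  congr 1 with x
  rw [smul_eq_mul, mul_inv_cancel_left₀ (hV.gibbsDensity_pos hb x).ne']

/-- Paired with a fixed vector `e`, the identity says that `p` is orthogonal in `L2Pair` to the
element `q = (π⁻¹ ⟨e, ∇φ⟩, π⁻¹ φ e)`, where `π` is the Gibbs density. Orthogonality is a closed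
condition, and on pairs `(f, ∇f)` of test functions it is integration by parts. -/
lemma hasWeakGradient (hV : IsConfining V) (hb : 0 < b) {p : L2Pair (gibbsMeasure V b)}
    (hp : p ∈ sobolevH1 (gibbsMeasure V b)) : HasWeakGradient p.fst p.snd := by
  have := hV.isProbabilityMeasure hb
  have hl1 := hV.locallyIntegrable_of_lp hb p.fst
  have hl2 := hV.locallyIntegrable_of_lp hb p.snd
  refine ⟨hl1, hl2, fun φ hφ => ?_⟩
  have hi1 : Integrable fun x => p.fst x • ∇ φ x :=
    hl1.integrable_smul_right_of_hasCompactSupport hφ.continuous_gradient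
      hφ.hasCompactSupport_gradient
  have hi2 : Integrable fun x => φ x • p.snd x :=
    hl2.integrable_smul_left_of_hasCompactSupport hφ.1.continuous hφ.2
  refine ext_inner_left ℝ fun e => ?_
  rw [inner_neg_right, ← integral_inner hi1, ← integral_inner hi2]
  have hwc : Continuous fun x => (gibbsDensity V b x)⁻¹ :=
    (hV.continuous_gibbsDensity b).inv₀ fun x => (hV.gibbsDensity_pos hb x).ne'
  have hgc : Continuous fun x => (gibbsDensity V b x)⁻¹ * inner ℝ e (∇ φ x) :=
    hwc.mul (continuous_const.inner hφ.continuous_gradient)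
  have hgs : HasCompactSupport fun x => (gibbsDensity V b x)⁻¹ * inner ℝ e (∇ φ x) := by
    refine HasCompactSupport.mul_left ?_
    exact hφ.hasCompactSupport_gradient.comp_left (g := fun w => inner ℝ e w) (inner_zero_right e)
  have hfc : Continuous fun x => ((gibbsDensity V b x)⁻¹ * φ x) • e :=
    (hwc.mul hφ.1.continuous).smul continuous_const
  have hfs : HasCompactSupport fun x => ((gibbsDensity V b x)⁻¹ * φ x) • e :=
    (hφ.2.mul_left).smul_right
  obtain ⟨M₁, hM₁⟩ := hgs.exists_bound_of_continuous hgc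
  obtain ⟨M₂, hM₂⟩ := hfs.exists_bound_of_continuous hfc
  obtain ⟨q, hq1, hq2⟩ := exists_l2Pair (μ := gibbsMeasure V b) (M := max M₁ M₂)
    hgc.aestronglyMeasurable hfc.aestronglyMeasurable (ae_of_all _ fun x =>
      ⟨(hM₁ x).trans (le_max_left _ _), (hM₂ x).trans (le_max_right _ _)⟩)
  have hinner : ∀ (r : L2Pair (gibbsMeasure V b)) (f : Rd d → ℝ) (v : Rd d → Rd d),
      r.fst =ᵐ[gibbsMeasure V b] f → r.snd =ᵐ[gibbsMeasure V b] v →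
      inner ℝ q r = (∫ x, inner ℝ e (f x • ∇ φ x)) + ∫ x, inner ℝ e (φ x • v x) := by
    intro r f v hr1 hr2
    rw [WithLp.prod_inner_apply]
    refine congrArg₂ (· + ·) ?_ ?_
    · refine (inner_eq_integral hq1 hr1).trans ?_
      rw [← hV.integral_gibbs_inv_mul hb]
      congr 1 with x
      simp [inner_smul_right]
      ring
    · refine (inner_eq_integral hq2 hr2).trans ?_
      rw [← hV.integral_gibbs_inv_mul hb]
      congr 1 with x
      simp [inner_smul_right, inner_smul_left]
      ring
  have hzero : ∀ r ∈ sobolevH1 (gibbsMeasure V b), inner ℝ q r = 0 := by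
    have hcl : IsClosed {r : L2Pair (gibbsMeasure V b) | inner ℝ q r = 0} :=
      isClosed_eq (continuous_const.inner continuous_id) continuous_const
    refine fun r hr => closure_minimal ?_ hcl hr
    rintro r ⟨f, hf, hr1, hr2⟩
    have h1 : Continuous fun x => fderiv ℝ φ x e :=
      (hφ.contDiff_one.continuous_fderiv (by simp)).clm_apply continuous_const
    have h2 : Continuous fun x => fderiv ℝ f x e :=
      (hf.contDiff_one.continuous_fderiv (by simp)).clm_apply continuous_const
    have h3 := integral_mul_fderiv_eq_neg_fderiv_mul_of_integrable (μ := volume) (v := e)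
      (f := f) (g := φ)
      ((h2.mul hφ.1.continuous).integrable_of_hasCompactSupport hφ.2.mul_left)
      ((hf.1.continuous.mul h1).integrable_of_hasCompactSupport hf.2.mul_right)
      ((hf.1.continuous.mul hφ.1.continuous).integrable_of_hasCompactSupport hf.2.mul_right)
      (fun x _ => hf.differentiable x) (fun x _ => hφ.differentiable x)
    change inner ℝ q r = 0
    rw [hinner r f (∇ f) hr1 hr2]
    simp only [inner_smul_right, inner_gradient_right, conj_trivial]
    rw [h3, neg_add_eq_zero]
    congr 1 with x
    ring
  have := hinner p p.fst p.snd EventuallyEq.rfl EventuallyEq.rfl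
  rw [hzero p hp] at this
  linarith

end IsConfining

/-! ### A Poincaré inequality on balls -/

/-- The fundamental theorem of calculus along the segment, then the Cauchy–Schwarz inequality on
`[0, 1]`, obtained by integrating `0 ≤ (m - ‖∇ f‖)²`. -/
lemma sq_sub_le_integral_segment {f : Rd d → ℝ} (hf : ContDiff ℝ 1 f) (x y : Rd d) :
    (f y - f x) ^ 2 ≤ ‖y - x‖ ^ 2 * ∫ s in (0 : ℝ)..1, ‖∇ f (x + s • (y - x))‖ ^ 2 := by
  have hline : Continuous fun s : ℝ => x + s • (y - x) := by fun_prop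
  have hg : Continuous fun s : ℝ => ‖∇ f (x + s • (y - x))‖ :=
    ((continuous_gradient hf).comp hline).norm
  have h1 : ∫ s in (0 : ℝ)..1, fderiv ℝ f (x + s • (y - x)) (y - x) = f y - f x := by
    have := intervalIntegral.integral_eq_sub_of_hasDerivAt (a := 0) (b := 1)
      (f := fun s : ℝ => f (x + s • (y - x)))
      (f' := fun s : ℝ => fderiv ℝ f (x + s • (y - x)) (y - x)) (fun s _ => ?_) ?_
    · simpa using this
    · have h2 : HasDerivAt (fun s : ℝ => x + s • (y - x)) (y - x) s := by
        simpa using ((hasDerivAt_id s).smul_const (y - x)).const_add x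
      exact ((hf.differentiable (by simp)) _).hasFDerivAt.comp_hasDerivAt s h2
    · exact (((hf.continuous_fderiv (by simp)).comp hline).clm_apply
        continuous_const).intervalIntegrable _ _
  set m := ∫ s in (0 : ℝ)..1, ‖∇ f (x + s • (y - x))‖ with hm
  have h2 : |f y - f x| ≤ ‖y - x‖ * m := by
    rw [← h1, ← Real.norm_eq_abs, hm, ← intervalIntegral.integral_const_mul]
    refine intervalIntegral.norm_integral_le_of_norm_le zero_le_one (ae_of_all _ fun s _ => ?_)
      ((continuous_const.mul hg).intervalIntegrable _ _)
    rw [norm_gradient, mul_comm]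
    exact ContinuousLinearMap.le_opNorm _ _
  have h3 : m ^ 2 ≤ ∫ s in (0 : ℝ)..1, ‖∇ f (x + s • (y - x))‖ ^ 2 := by
    have hi : IntervalIntegrable (fun s : ℝ => 2 * m * ‖∇ f (x + s • (y - x))‖) volume 0 1 :=
      (continuous_const.mul hg).intervalIntegrable _ _
    have h4 : ∫ s in (0 : ℝ)..1, (2 * m * ‖∇ f (x + s • (y - x))‖ - m ^ 2) ≤
        ∫ s in (0 : ℝ)..1, ‖∇ f (x + s • (y - x))‖ ^ 2 := by
      refine intervalIntegral.integral_mono_on zero_le_one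
        (hi.sub intervalIntegrable_const)
        ((hg.pow 2).intervalIntegrable _ _) fun s _ => ?_
      nlinarith [sq_nonneg (m - ‖∇ f (x + s • (y - x))‖)]
    rw [intervalIntegral.integral_sub hi intervalIntegrable_const, intervalIntegral.integral_const_mul, ← hm] at h4
    simp at h4
    linarith
  calc (f y - f x) ^ 2 = |f y - f x| ^ 2 := (sq_abs _).symm
    _ ≤ (‖y - x‖ * m) ^ 2 := by gcongr
    _ = ‖y - x‖ ^ 2 * m ^ 2 := mul_pow _ _ _
    _ ≤ _ := by gcongr

/-- The Jacobian factor of the change of variables is `s⁻ᵈ ≤ 2ᵈ`. -/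
lemma lintegral_comp_smul_add_le {k : Rd d → ℝ≥0∞} (hk : Measurable k) (z : Rd d) {s : ℝ}
    (hs : 1 / 2 ≤ s) : ∫⁻ y, k (z + s • y) ≤ ENNReal.ofReal (2 ^ d) * ∫⁻ y, k y := by
  have hs0 : 0 < s := by linarith
  have h1 : ∫⁻ y, k (z + s • y) = ENNReal.ofReal |(s ^ d)⁻¹| * ∫⁻ y, k y := by
    have h2 := lintegral_map (μ := (volume : Measure (Rd d))) (f := fun y => k (z + y))
      (g := fun y => s • y) (by fun_prop) (by fun_prop)
    rw [Measure.map_addHaar_smul _ hs0.ne', lintegral_smul_measure,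
      lintegral_add_left_eq_self] at h2
    rw [← h2]
    simp
  rw [h1]
  gcongr
  rw [abs_of_pos (by positivity), ← inv_pow]
  have : s⁻¹ ≤ 2 := by rw [inv_le_comm₀ hs0 two_pos]; linarith
  gcongr

/-- The point `x + s (y - x)` depends on `y` with factor `s` and on `x` with factor `1 - s`. One of
these is at least `1 / 2`, and integrating first in the corresponding variable keeps the Jacobian
bounded. -/
lemma lintegral_segment_le {k : Rd d → ℝ≥0∞} (hk : Measurable k) (B : Set (Rd d)) :
    ∫⁻ x in B, ∫⁻ y in B, ∫⁻ s in Ioc (0 : ℝ) 1, k (x + s • (y - x)) ≤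
      ENNReal.ofReal (2 ^ d) * (∫⁻ x, k x) * volume B := by
  have hmeas : Measurable fun z : (Rd d × ℝ) × Rd d => k (z.1.1 + z.1.2 • (z.2 - z.1.1)) := by
    fun_prop
  have hconst : ∫⁻ _ in B, ENNReal.ofReal (2 ^ d) * ∫⁻ x, k x =
      ENNReal.ofReal (2 ^ d) * (∫⁻ x, k x) * volume B := setLIntegral_const _ _
  calc ∫⁻ x in B, ∫⁻ y in B, ∫⁻ s in Ioc (0 : ℝ) 1, k (x + s • (y - x))
      = ∫⁻ x in B, ∫⁻ s in Ioc (0 : ℝ) 1, ∫⁻ y in B, k (x + s • (y - x)) := by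
        congr 1 with x
        rw [lintegral_lintegral_swap]
        refine Measurable.aemeasurable ?_
        exact hmeas.comp (by fun_prop : Measurable fun z : Rd d × ℝ => ((x, z.2), z.1))
    _ = ∫⁻ s in Ioc (0 : ℝ) 1, ∫⁻ x in B, ∫⁻ y in B, k (x + s • (y - x)) :=
        lintegral_lintegral_swap (f := fun x s => ∫⁻ y in B, k (x + s • (y - x)))
          (hmeas.lintegral_prod_right').aemeasurable
    _ ≤ ∫⁻ _ in Ioc (0 : ℝ) 1, ENNReal.ofReal (2 ^ d) * (∫⁻ x, k x) * volume B := by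
        gcongr with s
        rw [← hconst]
        rcases le_total (1 / 2) s with hs | hs
        · gcongr with x
          refine (setLIntegral_le_lintegral _ _).trans ?_
          refine le_trans (le_of_eq ?_) (lintegral_comp_smul_add_le hk (x - s • x) hs)
          congr 1 with y
          congr 1
          rw [smul_sub]; abel
        · rw [lintegral_lintegral_swap (f := fun x y => k (x + s • (y - x)))
            (hmeas.comp (by fun_prop : Measurable fun z : Rd d × Rd d =>
              ((z.1, s), z.2))).aemeasurable]
          gcongr with y
          refine (setLIntegral_le_lintegral _ _).trans ?_
          refine le_trans (le_of_eq ?_)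
            (lintegral_comp_smul_add_le hk (s • y) (by linarith : 1 / 2 ≤ 1 - s))
          congr 1 with x
          congr 1
          rw [smul_sub, sub_smul, one_smul]; abel
    _ = ENNReal.ofReal (2 ^ d) * (∫⁻ x, k x) * volume B := by
        rw [setLIntegral_const, Real.volume_Ioc]
        simp

lemma ofReal_sq_sub_le_lintegral_segment {f : Rd d → ℝ} (hf : ContDiff ℝ 1 f) {R : ℝ} {x y : Rd d}
    (hx : x ∈ Metric.closedBall 0 R) (hy : y ∈ Metric.closedBall 0 R) :
    ENNReal.ofReal ((f y - f x) ^ 2) ≤ ENNReal.ofReal ((2 * R) ^ 2) * ∫⁻ s in Ioc (0 : ℝ) 1,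
      (Metric.closedBall 0 R).indicator (fun x => ENNReal.ofReal (‖∇ f x‖ ^ 2))
        (x + s • (y - x)) := by
  have hg : Continuous fun s : ℝ => ‖∇ f (x + s • (y - x))‖ ^ 2 :=
    ((continuous_gradient hf).comp (by fun_prop)).norm.pow 2
  have h1 : ∫⁻ s in Ioc (0 : ℝ) 1, (Metric.closedBall 0 R).indicator
      (fun x => ENNReal.ofReal (‖∇ f x‖ ^ 2)) (x + s • (y - x)) =
      ENNReal.ofReal (∫ s in (0 : ℝ)..1, ‖∇ f (x + s • (y - x))‖ ^ 2) := by
    rw [intervalIntegral.integral_of_le zero_le_one, ofReal_integral_eq_lintegral_ofReal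
      ((intervalIntegrable_iff_integrableOn_Ioc_of_le zero_le_one).1 (hg.intervalIntegrable 0 1))
      (ae_of_all _ fun s => sq_nonneg _)]
    refine setLIntegral_congr_fun measurableSet_Ioc fun s hs => ?_
    refine indicator_of_mem ?_ _
    exact (convex_closedBall (0 : Rd d) R).add_smul_sub_mem hx hy ⟨hs.1.le, hs.2⟩
  have h2 : ‖y - x‖ ≤ 2 * R := by
    rw [mem_closedBall_zero_iff] at hx hy
    linarith [norm_sub_le y x]
  rw [h1, ← ENNReal.ofReal_mul (sq_nonneg _)]
  refine ENNReal.ofReal_le_ofReal ((sq_sub_le_integral_segment hf x y).trans ?_)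
  have : 0 ≤ ∫ s in (0 : ℝ)..1, ‖∇ f (x + s • (y - x))‖ ^ 2 :=
    intervalIntegral.integral_nonneg zero_le_one fun s _ => sq_nonneg _
  gcongr

lemma lintegral_lintegral_sq_sub_le {f : Rd d → ℝ} (hf : ContDiff ℝ 1 f) (R : ℝ) :
    ∫⁻ x in Metric.closedBall 0 R, ∫⁻ y in Metric.closedBall 0 R, ENNReal.ofReal ((f y - f x) ^ 2) ≤
      ENNReal.ofReal ((2 * R) ^ 2) * (ENNReal.ofReal (2 ^ d) * (∫⁻ x in Metric.closedBall 0 R,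
        ENNReal.ofReal (‖∇ f x‖ ^ 2)) * volume (Metric.closedBall (0 : Rd d) R)) := by
  have hBm : MeasurableSet (Metric.closedBall (0 : Rd d) R) := measurableSet_closedBall
  have hkm : Measurable ((Metric.closedBall 0 R).indicator fun x => ENNReal.ofReal (‖∇ f x‖ ^ 2)) :=
    ((continuous_gradient hf).norm.pow 2).measurable.ennreal_ofReal.indicator hBm
  rw [← lintegral_indicator hBm (fun x => ENNReal.ofReal (‖∇ f x‖ ^ 2))]
  refine le_trans (setLIntegral_mono' hBm fun x hx => setLIntegral_mono' hBm fun y hy =>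
    ofReal_sq_sub_le_lintegral_segment hf hx hy) ?_
  simp_rw [lintegral_const_mul' _ _ ENNReal.ofReal_ne_top]
  gcongr
  exact lintegral_segment_le hkm _

/-- Poincaré inequality on a ball, with the mean replaced by a suitable constant. -/
lemma exists_integral_sq_sub_le {f : Rd d → ℝ} (hf : ContDiff ℝ 1 f) {R : ℝ} (hR : 0 < R) :
    ∃ c : ℝ, ∫ x in Metric.closedBall 0 R, (f x - c) ^ 2 ≤
      (2 * R) ^ 2 * 2 ^ d * ∫ x in Metric.closedBall 0 R, ‖∇ f x‖ ^ 2 := by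
  have hfc := hf.continuous
  have hB0 : volume (Metric.closedBall (0 : Rd d) R) ≠ 0 :=
    (Metric.measure_closedBall_pos volume _ hR).ne'
  have hBt : volume (Metric.closedBall (0 : Rd d) R) ≠ ⊤ := measure_closedBall_lt_top.ne
  have hm : Measurable fun x => ∫⁻ y in Metric.closedBall 0 R, ENNReal.ofReal ((f y - f x) ^ 2) := by
    refine Measurable.lintegral_prod_right'
      (f := fun z : Rd d × Rd d => ENNReal.ofReal ((f z.2 - f z.1) ^ 2)) ?_
    exact (by fun_prop : Continuous fun z : Rd d × Rd d => (f z.2 - f z.1) ^ 2).measurable.ennreal_ofReal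
  -- The constant is `f x` at a point where the inner integral is at most its average over the ball;
  -- the average cancels the factor `volume B` of the double integral.
  obtain ⟨x, -, hx⟩ := exists_le_setLAverage hB0 hBt hm.aemeasurable
  refine ⟨f x, ?_⟩
  have h1 : ∫⁻ y in Metric.closedBall 0 R, ENNReal.ofReal ((f y - f x) ^ 2) ≤
      ENNReal.ofReal ((2 * R) ^ 2 * 2 ^ d) * ∫⁻ x in Metric.closedBall 0 R,
        ENNReal.ofReal (‖∇ f x‖ ^ 2) := by
    refine hx.trans ?_
    rw [setLAverage_eq]
    refine ENNReal.div_le_of_le_mul ((lintegral_lintegral_sq_sub_le hf R).trans_eq ?_)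
    rw [ENNReal.ofReal_mul (sq_nonneg _)]
    ring
  have hi1 : IntegrableOn (fun y => (f y - f x) ^ 2) (Metric.closedBall 0 R) :=
    (by fun_prop : Continuous fun y => (f y - f x) ^ 2).continuousOn.integrableOn_compact (isCompact_closedBall _ _)
  have hi2 : IntegrableOn (fun y => ‖∇ f y‖ ^ 2) (Metric.closedBall 0 R) :=
    (show Continuous fun y => ‖∇ f y‖ ^ 2 from
      (continuous_gradient hf).norm.pow 2).continuousOn.integrableOn_compact (isCompact_closedBall _ _)
  rw [← ofReal_integral_eq_lintegral_ofReal hi1 (ae_of_all _ fun _ => sq_nonneg _),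
    ← ofReal_integral_eq_lintegral_ofReal hi2 (ae_of_all _ fun _ => sq_nonneg _),
    ← ENNReal.ofReal_mul (by positivity)] at h1
  exact (ENNReal.ofReal_le_ofReal_iff (mul_nonneg (by positivity)
    (integral_nonneg fun _ => sq_nonneg _))).1 h1

/-! ### The Lyapunov estimate -/

/-- The divergence theorem for the radial vector field `F(x) x`. -/
lemma integral_fderiv_self {F : Rd d → ℝ} (hF : ContDiff ℝ 1 F) (hs : HasCompactSupport F) :
    ∫ x, fderiv ℝ F x x = -d * ∫ x, F x := by
  have hFc := hF.continuous
  have hD := hF.continuous_fderiv (by simp)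
  have hDs : ∀ e, HasCompactSupport fun x => fderiv ℝ F x e := fun e =>
    (hs.fderiv (𝕜 := ℝ)).comp_left (g := fun L : Rd d →L[ℝ] ℝ => L e) (by simp)
  have hx : ∀ x : Rd d, fderiv ℝ F x x =
      ∑ i, x i * fderiv ℝ F x (EuclideanSpace.single i 1) := by
    intro x
    generalize fderiv ℝ F x = L
    conv_lhs => rw [← (EuclideanSpace.basisFun (Fin d) ℝ).sum_repr x]
    simp
  have hint : ∀ i, Integrable fun x : Rd d => x i * fderiv ℝ F x (EuclideanSpace.single i 1) := by
    intro i
    refine Continuous.integrable_of_hasCompactSupport ?_ (hDs _).mul_left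
    exact (by fun_prop : Continuous fun x : Rd d => x i).mul (hD.clm_apply continuous_const)
  simp_rw [hx]
  rw [integral_finsetSum _ fun i _ => hint i]
  have hi : ∀ i, ∫ x : Rd d, x i * fderiv ℝ F x (EuclideanSpace.single i 1) = -∫ x, F x := by
    intro i
    have hL : ∀ x : Rd d, HasFDerivAt (fun x : Rd d => x i)
        (EuclideanSpace.proj i : Rd d →L[ℝ] ℝ) x :=
      fun x => (EuclideanSpace.proj i : Rd d →L[ℝ] ℝ).hasFDerivAt
    have hd : ∀ x : Rd d, fderiv ℝ (fun x : Rd d => x i) x (EuclideanSpace.single i 1) = 1 := by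
      intro x
      rw [(hL x).fderiv]
      simp
    have := integral_mul_fderiv_eq_neg_fderiv_mul_of_integrable (μ := volume)
      (f := fun x : Rd d => x i) (g := F) (v := EuclideanSpace.single i 1)
      (by simpa [hd] using hFc.integrable_of_hasCompactSupport hs) (hint i)
      (((by fun_prop : Continuous fun x : Rd d => x i).mul hFc).integrable_of_hasCompactSupport
        hs.mul_left)
      (fun x _ => (hL x).differentiableAt) (fun x _ => hF.differentiable (by simp) x)
    simpa [hd] using this
  simp [hi]

namespace IsConfining

variable {V : Rd d → ℝ} {b : ℝ}

/-- The radial divergence theorem for `F = g² e^{-bV}`. The factor `b ⟨∇V, x⟩ - d` is large far out,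
which is where the confinement of the gradient enters. -/
lemma integral_sq_mul_lyapunov (hV1 : ContDiff ℝ 1 V) (b : ℝ) {g : Rd d → ℝ}
    (hg : ContDiff ℝ 1 g) (hs : HasCompactSupport g) :
    ∫ x, (b * inner ℝ (∇ V x) x - d) * (g x ^ 2 * Real.exp (-b * V x)) =
      ∫ x, 2 * (g x * inner ℝ (∇ g x) x) * Real.exp (-b * V x) := by
  have hE : ContDiff ℝ 1 fun x => Real.exp (-b * V x) := (contDiff_const.mul hV1).exp
  have hF : ContDiff ℝ 1 fun x => g x ^ 2 * Real.exp (-b * V x) := (hg.pow 2).mul hE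
  have hFs : HasCompactSupport fun x => g x ^ 2 * Real.exp (-b * V x) :=
    (hs.comp_left (g := fun t => t ^ 2) (by simp)).mul_right
  have hgc := hg.continuous
  have hVc := hV1.continuous
  have hgg := continuous_gradient hg
  have hVg := continuous_gradient hV1
  have hFx : ∀ x, fderiv ℝ (fun x => g x ^ 2 * Real.exp (-b * V x)) x x =
      2 * (g x * inner ℝ (∇ g x) x) * Real.exp (-b * V x) -
        b * inner ℝ (∇ V x) x * (g x ^ 2 * Real.exp (-b * V x)) := by
    intro x
    have h1 := (hg.differentiable (by simp) x).hasFDerivAt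
    have h2 := (hV1.differentiable (by simp) x).hasFDerivAt
    have h3 : HasFDerivAt (fun x => g x ^ 2 * Real.exp (-b * V x)) _ x :=
      (h1.pow 2).mul ((h2.const_mul (-b)).exp)
    rw [h3.fderiv]
    simp only [inner_gradient_left, add_apply, smul_apply,
      smul_eq_mul, nsmul_eq_mul]
    norm_num
    ring
  have h := integral_fderiv_self hF hFs
  simp_rw [hFx] at h
  have hi1 : Integrable fun x => 2 * (g x * inner ℝ (∇ g x) x) * Real.exp (-b * V x) := by
    refine Continuous.integrable_of_hasCompactSupport ?_ ?_
    · have : Continuous fun x => inner ℝ (∇ g x) x := hgg.inner continuous_id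
      fun_prop
    · exact (hs.mul_right.mul_left).mul_right
  have hi2 : Integrable fun x => b * inner ℝ (∇ V x) x * (g x ^ 2 * Real.exp (-b * V x)) := by
    refine Continuous.integrable_of_hasCompactSupport ?_ hFs.mul_left
    have : Continuous fun x => inner ℝ (∇ V x) x := hVg.inner continuous_id
    fun_prop
  rw [integral_sub hi1 hi2] at h
  have h4 := integral_sub hi2
    ((hF.continuous.integrable_of_hasCompactSupport hFs).const_mul (d : ℝ))
  rw [integral_const_mul] at h4
  simp_rw [sub_mul]
  linarith

/-- The Lyapunov estimate: the mass of `g²` is controlled by the Dirichlet form and by the mass of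
`g²` on a ball, uniformly for inverse temperatures in `[1, b₁]`. -/
lemma exists_integral_sq_le (hV1 : ContDiff ℝ 1 V)
    (hgrad : ∃ α > 0, ∃ R > 0, ∀ x : Rd d, R < ‖x‖ → α * ‖x‖ ^ 2 ≤ inner ℝ (∇ V x) x) (b₁ : ℝ) :
    ∃ R > 0, ∃ A ≥ 0, ∀ b ∈ Icc 1 b₁, ∀ g : Rd d → ℝ, ContDiff ℝ 1 g → HasCompactSupport g →
      ∫ x, g x ^ 2 * Real.exp (-b * V x) ≤ A * (∫ x, ‖∇ g x‖ ^ 2 * Real.exp (-b * V x)) +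
        A * ∫ x in Metric.closedBall 0 R, g x ^ 2 * Real.exp (-b * V x) := by
  obtain ⟨α, hα, R₀, hR₀, hgr⟩ := hgrad
  -- The growth `α ‖x‖²` is split in two: one half is kept to absorb the cross term, the other beats
  -- `d + 1` outside the ball of radius `R`.
  set η := α / 2 with hη
  have hη0 : 0 < η := by positivity
  set R := R₀ + √((d + 1) / η) with hR
  have hR0 : 0 < R := by positivity
  have hVc := hV1.continuous
  have hVg := continuous_gradient hV1
  have hinner : Continuous fun x => inner ℝ (∇ V x) x := hVg.inner continuous_id
  obtain ⟨m, hm⟩ := (isCompact_closedBall (0 : Rd d) R).exists_bound_of_continuousOn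
    hinner.continuousOn
  have hm0 : 0 ≤ m := (norm_nonneg _).trans (hm 0 (by simp [hR0.le]))
  -- On the ball, `b ⟨∇V, x⟩ - d - η ‖x‖² ≥ -M` for every `b ∈ [1, b₁]`; adding `M + 1` there
  -- restores the lower bound `1`.
  set M := |b₁| * m + d + η * R ^ 2 with hM
  have hM0 : 0 ≤ M := by positivity
  refine ⟨R, hR0, max η⁻¹ (M + 1), by positivity, fun b hb g hg hs => ?_⟩
  have hb0 : 0 ≤ b := zero_le_one.trans hb.1
  have hgc := hg.continuous
  have hgg := continuous_gradient hg
  have hs2 : HasCompactSupport fun x => g x ^ 2 := hs.comp_left (g := fun t => t ^ 2) (by simp)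
  have hgs : HasCompactSupport (∇ g) :=
    (hs.fderiv (𝕜 := ℝ)).comp_left (g := (InnerProductSpace.toDual ℝ (Rd d)).symm) (by simp)
  have hgs2 : HasCompactSupport fun x => ‖∇ g x‖ ^ 2 :=
    hgs.comp_left (g := fun w => ‖w‖ ^ 2) (by simp)
  set w : Rd d → ℝ := fun x => Real.exp (-b * V x) with hw
  have hwc : Continuous w := by fun_prop
  have hw0 : ∀ x, 0 < w x := fun x => Real.exp_pos _
  -- integrability
  have hi1 : Integrable fun x => g x ^ 2 * w x :=
    ((hgc.pow 2).mul hwc).integrable_of_hasCompactSupport hs2.mul_right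
  have hi2 : Integrable fun x => ‖∇ g x‖ ^ 2 * w x :=
    ((hgg.norm.pow 2).mul hwc).integrable_of_hasCompactSupport hgs2.mul_right
  have hi3 : Integrable fun x => (b * inner ℝ (∇ V x) x - d) * (g x ^ 2 * w x) :=
    Continuous.integrable_of_hasCompactSupport (by fun_prop) hs2.mul_right.mul_left
  have hi4 : Integrable fun x => η * ‖x‖ ^ 2 * (g x ^ 2 * w x) :=
    Continuous.integrable_of_hasCompactSupport (by fun_prop) hs2.mul_right.mul_left
  have hi5 : Integrable ((Metric.closedBall 0 R).indicator fun x => g x ^ 2 * w x) :=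
    hi1.indicator measurableSet_closedBall
  have hi6 : Integrable fun x => 2 * (g x * inner ℝ (∇ g x) x) * w x := by
    refine Continuous.integrable_of_hasCompactSupport ?_ (hs.mul_right.mul_left).mul_right
    have : Continuous fun x => inner ℝ (∇ g x) x := hgg.inner continuous_id
    fun_prop
  -- pointwise lower bound for the Lyapunov function
  have hq : ∀ x, g x ^ 2 * w x ≤ (b * inner ℝ (∇ V x) x - d) * (g x ^ 2 * w x) -
      η * ‖x‖ ^ 2 * (g x ^ 2 * w x) +
      (M + 1) * (Metric.closedBall 0 R).indicator (fun x => g x ^ 2 * w x) x := by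
    intro x
    have h0 : 0 ≤ g x ^ 2 * w x := mul_nonneg (sq_nonneg _) (hw0 x).le
    by_cases hx : x ∈ Metric.closedBall 0 R
    · rw [indicator_of_mem hx]
      have h1 := hm x hx
      rw [mem_closedBall_zero_iff] at hx
      rw [Real.norm_eq_abs] at h1
      have h2 : -(|b₁| * m) ≤ b * inner ℝ (∇ V x) x := by
        have h3 : |b * inner ℝ (∇ V x) x| ≤ |b₁| * m := by
          rw [abs_mul]
          exact mul_le_mul (abs_le_abs_of_nonneg hb0 hb.2) h1 (abs_nonneg _) (abs_nonneg _)
        exact (neg_le_neg h3).trans (neg_abs_le _)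
      have h4 : η * ‖x‖ ^ 2 ≤ η * R ^ 2 := by gcongr
      have h5 : 1 ≤ b * inner ℝ (∇ V x) x - d - η * ‖x‖ ^ 2 + (M + 1) := by rw [hM]; linarith
      have := mul_le_mul_of_nonneg_right h5 h0
      linarith
    · rw [indicator_of_notMem hx, mul_zero, add_zero]
      have hx' : R < ‖x‖ := by simpa using hx
      have h1 : R₀ < ‖x‖ := lt_of_le_of_lt (by rw [hR]; linarith [Real.sqrt_nonneg ((d + 1) / η)]) hx'
      have h2 := hgr x h1
      have h3 : √((d + 1) / η) ≤ ‖x‖ := by linarith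
      have h4 : ((d : ℝ) + 1) / η ≤ ‖x‖ ^ 2 := by
        rw [← Real.sqrt_le_left (norm_nonneg x)]; exact h3
      rw [div_le_iff₀ hη0] at h4
      have h6 : 0 ≤ inner ℝ (∇ V x) x := le_trans (by positivity) h2
      have h7 : inner ℝ (∇ V x) x ≤ b * inner ℝ (∇ V x) x := le_mul_of_one_le_left h6 hb.1
      have h5 : 1 ≤ b * inner ℝ (∇ V x) x - d - η * ‖x‖ ^ 2 := by
        have : α = 2 * η := by rw [hη]; ring
        rw [this] at h2
        linarith
      have := mul_le_mul_of_nonneg_right h5 h0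
      linarith
  -- Weighted Young inequality; its first term cancels against the reserve `η ‖x‖² g²` in `hq` once
  -- `integral_sq_mul_lyapunov` is inserted.
  have hp : ∀ x, 2 * (g x * inner ℝ (∇ g x) x) * w x ≤
      η * ‖x‖ ^ 2 * (g x ^ 2 * w x) + η⁻¹ * (‖∇ g x‖ ^ 2 * w x) := by
    intro x
    have h1 : 2 * (g x * inner ℝ (∇ g x) x) ≤ η * ‖x‖ ^ 2 * g x ^ 2 + η⁻¹ * ‖∇ g x‖ ^ 2 := by
      have h2 : g x * inner ℝ (∇ g x) x ≤ |g x| * (‖∇ g x‖ * ‖x‖) := by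
        refine (le_abs_self _).trans ?_
        rw [abs_mul]
        gcongr
        exact abs_real_inner_le_norm _ _
      have h3 : 0 ≤ η * (‖x‖ * |g x| - η⁻¹ * ‖∇ g x‖) ^ 2 := by positivity
      have h4 : η * (‖x‖ * |g x| - η⁻¹ * ‖∇ g x‖) ^ 2 =
          η * ‖x‖ ^ 2 * |g x| ^ 2 - 2 * (|g x| * (‖∇ g x‖ * ‖x‖)) + η⁻¹ * ‖∇ g x‖ ^ 2 := by
        field_simp
        ring
      rw [sq_abs] at h4
      linarith
    have := mul_le_mul_of_nonneg_right h1 (hw0 x).le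
    linarith
  have hi7 : Integrable fun x => (b * inner ℝ (∇ V x) x - d) * (g x ^ 2 * w x) -
      η * ‖x‖ ^ 2 * (g x ^ 2 * w x) := hi3.sub hi4
  have h1 := integral_mono hi1 (hi7.add (hi5.const_mul (M + 1))) hq
  have h2 := integral_mono hi6 (hi4.add (hi2.const_mul η⁻¹)) hp
  have h3 := integral_sq_mul_lyapunov hV1 b hg hs
  simp only [Pi.add_apply] at h1 h2
  rw [integral_add hi7 (hi5.const_mul (M + 1)), integral_sub hi3 hi4,
    integral_const_mul, integral_indicator measurableSet_closedBall] at h1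
  rw [integral_add hi4 (hi2.const_mul η⁻¹), integral_const_mul] at h2
  have h4 : 0 ≤ ∫ x, ‖∇ g x‖ ^ 2 * w x :=
    integral_nonneg fun x => mul_nonneg (sq_nonneg _) (hw0 x).le
  have h5 : 0 ≤ ∫ x in Metric.closedBall 0 R, g x ^ 2 * w x :=
    integral_nonneg fun x => mul_nonneg (sq_nonneg _) (hw0 x).le
  have h6 := mul_le_mul_of_nonneg_right (le_max_left η⁻¹ (M + 1)) h4
  have h7 := mul_le_mul_of_nonneg_right (le_max_right η⁻¹ (M + 1)) h5
  simp only [hw] at *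
  linarith

lemma setIntegral_gibbs_eq_div (hV : IsConfining V) (hb : 0 < b) (f : Rd d → ℝ) {B : Set (Rd d)}
    (hB : MeasurableSet B) : ∫ x in B, f x ∂gibbsMeasure V b =
      (∫ x in B, f x * Real.exp (-b * V x)) / ∫ x, Real.exp (-b * V x) := by
  rw [← integral_indicator hB, hV.integral_gibbs_eq_div hb, ← integral_indicator hB]
  congr 2 with x
  by_cases hx : x ∈ B <;> simp [hx]

lemma norm_sq_eq_integral_of_ae {μ : Measure (Rd d)} {E : Type*} [NormedAddCommGroup E]
    [InnerProductSpace ℝ E] {f : Lp E 2 μ} {f' : Rd d → E} (h : f =ᵐ[μ] f') :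
    ‖f‖ ^ 2 = ∫ x, ‖f' x‖ ^ 2 ∂μ := by
  rw [norm_sq_eq_integral]
  refine integral_congr_ae ?_
  filter_upwards [h] with x hx
  rw [hx]

/-- The Lyapunov estimate on the weighted Sobolev space. -/
lemma exists_norm_sq_le (hV : IsConfining V) (hV1 : ContDiff ℝ 1 V)
    (hgrad : ∃ α > 0, ∃ R > 0, ∀ x : Rd d, R < ‖x‖ → α * ‖x‖ ^ 2 ≤ inner ℝ (∇ V x) x) (b₁ : ℝ) :
    ∃ R > 0, ∃ A ≥ 0, ∀ b ∈ Icc 1 b₁, ∀ p ∈ sobolevH1 (gibbsMeasure V b),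
      ‖p.fst‖ ^ 2 ≤ A * ‖p.snd‖ ^ 2 +
        A * ∫ x in Metric.closedBall 0 R, p.fst x ^ 2 ∂gibbsMeasure V b := by
  obtain ⟨R, hR, A, hA, h⟩ := exists_integral_sq_le hV1 hgrad b₁
  refine ⟨R, hR, A, hA, fun b hb p hp => ?_⟩
  have hb0 : 0 < b := zero_lt_one.trans_le hb.1
  set μ := gibbsMeasure V b with hμ
  have hBm : MeasurableSet (Metric.closedBall (0 : Rd d) R) := measurableSet_closedBall
  -- Written with the continuous restriction operator, the estimate is a closed condition and passes
  -- from test functions to the closure.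
  let L := LpToLpRestrictCLM (Rd d) ℝ ℝ μ 2 (Metric.closedBall 0 R)
  have hL : ∀ f : Lp ℝ 2 μ, ∫ x in Metric.closedBall 0 R, f x ^ 2 ∂μ = ‖L f‖ ^ 2 := by
    intro f
    rw [norm_sq_eq_integral_of_ae (LpToLpRestrictCLM_coeFn ℝ (Metric.closedBall 0 R) f)]
    simp
  rw [hL]
  have hcl : IsClosed {p : L2Pair μ | ‖p.fst‖ ^ 2 ≤ A * ‖p.snd‖ ^ 2 + A * ‖L p.fst‖ ^ 2} := by
    have h1 : Continuous fun p : L2Pair μ => p.fst := by fun_prop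
    have h2 : Continuous fun p : L2Pair μ => p.snd := by fun_prop
    exact isClosed_le (h1.norm.pow 2) ((continuous_const.mul (h2.norm.pow 2)).add
      (continuous_const.mul ((L.continuous.comp h1).norm.pow 2)))
  refine closure_minimal ?_ hcl hp
  rintro p ⟨f, hf, h1, h2⟩
  change ‖p.fst‖ ^ 2 ≤ A * ‖p.snd‖ ^ 2 + A * ‖L p.fst‖ ^ 2
  have h3 : ∫ x in Metric.closedBall 0 R, p.fst x ^ 2 ∂μ =
      ∫ x in Metric.closedBall 0 R, f x ^ 2 ∂μ := by
    refine integral_congr_ae (ae_restrict_of_ae ?_)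
    filter_upwards [h1] with x hx
    rw [hx]
  rw [← hL, h3, norm_sq_eq_integral_of_ae h1, norm_sq_eq_integral_of_ae h2]
  simp only [Real.norm_eq_abs, sq_abs]
  rw [hμ, hV.setIntegral_gibbs_eq_div hb0 _ hBm, hV.integral_gibbs_eq_div hb0,
    hV.integral_gibbs_eq_div hb0, ← mul_div_assoc, ← mul_div_assoc, ← add_div]
  exact div_le_div_of_nonneg_right (h b hb f hf.contDiff_one hf.2) (hV.partition_pos hb0).le

/-- The Poincaré inequality for the Gibbs measures, uniformly for inverse temperatures in
`[1, b₁]`. -/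
theorem poincare (hV : IsConfining V) (hV1 : ContDiff ℝ 1 V)
    (hgrad : ∃ α > 0, ∃ R > 0, ∀ x : Rd d, R < ‖x‖ → α * ‖x‖ ^ 2 ≤ inner ℝ (∇ V x) x) (b₁ : ℝ) :
    ∃ C ≥ 0, ∀ b ∈ Icc 1 b₁, ∀ p ∈ sobolevH1 (gibbsMeasure V b),
      ‖p.fst‖ ^ 2 - (∫ x, p.fst x ∂gibbsMeasure V b) ^ 2 ≤ C * ‖p.snd‖ ^ 2 := by
  obtain ⟨R, hR, A, hA, h⟩ := hV.exists_norm_sq_le hV1 hgrad b₁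
  obtain ⟨m, hm⟩ := (isCompact_closedBall (0 : Rd d) R).exists_bound_of_continuousOn
    hV.1.continuousOn
  -- The Lebesgue constant on the ball times the largest distortion by the weight, since `e^{-b₁ m}
  -- ≤ e^{-bV} ≤ 1` there.
  set D := (2 * R) ^ 2 * 2 ^ d * Real.exp (b₁ * m) with hD
  have hD0 : 0 ≤ D := by positivity
  refine ⟨A + A * D, by positivity, fun b hb p hp => ?_⟩
  have hb0 : 0 < b := zero_lt_one.trans_le hb.1
  set μ := gibbsMeasure V b with hμ
  have hprob : IsProbabilityMeasure μ := hV.isProbabilityMeasure hb0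
  -- Pairing with the constant `1` displays the mean as a continuous functional, so that the
  -- inequality is again a closed condition.
  obtain ⟨e, -, he, -⟩ := (IsBddLip.const (d := d) 1).exists_mem_sobolevH1
    (gibbs_absolutelyContinuous V b)
  have hmean : ∀ q : L2Pair μ, ∫ x, q.fst x ∂μ = inner ℝ e.fst q.fst := by
    intro q
    rw [inner_eq_integral he EventuallyEq.rfl]
    simp [hμ]
  rw [hmean]
  have hcl : IsClosed {p : L2Pair μ | ‖p.fst‖ ^ 2 - (inner ℝ e.fst p.fst) ^ 2 ≤
      (A + A * D) * ‖p.snd‖ ^ 2} := by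
    have h1 : Continuous fun p : L2Pair μ => p.fst := by fun_prop
    have h2 : Continuous fun p : L2Pair μ => p.snd := by fun_prop
    exact isClosed_le ((h1.norm.pow 2).sub ((continuous_const.inner h1).pow 2))
      (continuous_const.mul (h2.norm.pow 2))
  refine closure_minimal ?_ hcl hp
  rintro p ⟨f, hf, hp1, hp2⟩
  change ‖p.fst‖ ^ 2 - (inner ℝ e.fst p.fst) ^ 2 ≤ (A + A * D) * ‖p.snd‖ ^ 2
  rw [← hmean]
  obtain ⟨c, hc⟩ := exists_integral_sq_sub_le hf.contDiff_one hR
  have hfc := hf.1.continuous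
  have hVc := hV.1
  have hgc := hf.continuous_gradient
  -- The Lyapunov estimate is applied to `f - c`. It need not have compact support, but it lies in
  -- `H¹` as a bounded Lipschitz function; its second moment dominates the variance of `f`.
  have hu : IsBddLip fun x => f x + -c := hf.isBddLip.add (IsBddLip.const (-c))
  obtain ⟨q, hq, hq1, hq2⟩ := hu.exists_mem_sobolevH1 (gibbs_absolutelyContinuous V b)
  have hgq : ∀ x, ∇ (fun x => f x + -c) x = ∇ f x := fun x => by simp [gradient]
  have hqn : ‖q.snd‖ ^ 2 = ∫ x, ‖∇ f x‖ ^ 2 ∂μ := by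
    rw [norm_sq_eq_integral_of_ae hq2]
    simp [hgq, hμ]
  have hpn : ‖p.snd‖ ^ 2 = ∫ x, ‖∇ f x‖ ^ 2 ∂μ := norm_sq_eq_integral_of_ae hp2
  have hvar : ‖p.fst‖ ^ 2 - (∫ x, p.fst x ∂μ) ^ 2 ≤ ‖q.fst‖ ^ 2 := by
    rw [norm_sq_eq_integral_of_ae hp1, norm_sq_eq_integral_of_ae hq1, integral_congr_ae hp1]
    have hi1 : Integrable f μ := hf.isBddLip.integrable μ
    have hi2 : Integrable (fun x => f x ^ 2) μ := by
      refine (memLp_two_iff_integrable_sq hfc.aestronglyMeasurable).1 ?_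
      obtain ⟨M, hM⟩ := hf.exists_bound
      exact MemLp.of_bound hfc.aestronglyMeasurable M (ae_of_all _ fun x => (hM x).1)
    have h1 : ∫ x, ‖f x + -c‖ ^ 2 ∂μ = ∫ x, f x ^ 2 ∂μ - 2 * c * (∫ x, f x ∂μ) + c ^ 2 := by
      rw [← integral_const_mul, ← integral_sub hi2 (hi1.const_mul (2 * c))]
      have h2 : Integrable (fun x => f x ^ 2 - 2 * c * f x) μ := hi2.sub (hi1.const_mul (2 * c))
      have h3 := integral_add h2 (integrable_const (c ^ 2))
      simp only [integral_const, probReal_univ, one_smul] at h3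
      rw [← h3]
      congr 1 with x
      rw [Real.norm_eq_abs, sq_abs]
      ring
    rw [h1]
    simp only [Real.norm_eq_abs, sq_abs]
    nlinarith [sq_nonneg ((∫ x, f x ∂μ) - c)]
  have hloc : ∫ x in Metric.closedBall 0 R, q.fst x ^ 2 ∂μ ≤ D * ∫ x, ‖∇ f x‖ ^ 2 ∂μ := by
    have h1 : ∫ x in Metric.closedBall 0 R, q.fst x ^ 2 ∂μ =
        ∫ x in Metric.closedBall 0 R, (f x - c) ^ 2 ∂μ := by
      refine integral_congr_ae (ae_restrict_of_ae ?_)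
      filter_upwards [hq1] with x hx
      rw [hx, sub_eq_add_neg]
    rw [h1, hμ, hV.setIntegral_gibbs_eq_div hb0 _ measurableSet_closedBall,
      hV.integral_gibbs_eq_div hb0, ← mul_div_assoc]
    refine div_le_div_of_nonneg_right ?_ (hV.partition_pos hb0).le
    have hB := isCompact_closedBall (0 : Rd d) R
    have hi : Integrable fun x => ‖∇ f x‖ ^ 2 * Real.exp (-b * V x) := by
      refine Continuous.integrable_of_hasCompactSupport (by fun_prop) ?_
      exact (hf.hasCompactSupport_gradient.comp_left (g := fun w => ‖w‖ ^ 2) (by simp)).mul_right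
    calc ∫ x in Metric.closedBall 0 R, (f x - c) ^ 2 * Real.exp (-b * V x)
        ≤ ∫ x in Metric.closedBall 0 R, (f x - c) ^ 2 := by
          refine integral_mono_of_nonneg (ae_of_all _ fun x => by positivity)
            ((by fun_prop : Continuous fun x => (f x - c) ^ 2).continuousOn.integrableOn_compact hB)
            (ae_of_all _ fun x => ?_)
          refine mul_le_of_le_one_right (sq_nonneg _) (Real.exp_le_one_iff.2 ?_)
          have := mul_nonneg hb0.le (hV.nonneg x)
          linarith
      _ ≤ (2 * R) ^ 2 * 2 ^ d * ∫ x in Metric.closedBall 0 R, ‖∇ f x‖ ^ 2 := hc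
      _ ≤ (2 * R) ^ 2 * 2 ^ d * (Real.exp (b₁ * m) *
            ∫ x in Metric.closedBall 0 R, ‖∇ f x‖ ^ 2 * Real.exp (-b * V x)) := by
          refine mul_le_mul_of_nonneg_left ?_ (by positivity)
          rw [← integral_const_mul]
          refine setIntegral_mono_on
            ((by fun_prop : Continuous fun x => ‖∇ f x‖ ^ 2).continuousOn.integrableOn_compact hB)
            (hi.const_mul _).integrableOn measurableSet_closedBall fun x hx => ?_
          rw [mul_left_comm, ← Real.exp_add]
          refine le_mul_of_one_le_right (sq_nonneg _) (Real.one_le_exp ?_)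
          have h2 := (le_abs_self _).trans (hm x hx)
          have h3 : b * V x ≤ b₁ * m :=
            mul_le_mul hb.2 h2 (hV.nonneg x) (hb0.le.trans hb.2)
          linarith
      _ = D * ∫ x in Metric.closedBall 0 R, ‖∇ f x‖ ^ 2 * Real.exp (-b * V x) := by
          rw [hD]; ring
      _ ≤ D * ∫ x, ‖∇ f x‖ ^ 2 * Real.exp (-b * V x) := by
          refine mul_le_mul_of_nonneg_left ?_ hD0
          exact setIntegral_le_integral hi (ae_of_all _ fun x => by positivity)
  have h1 := h b hb q hq
  rw [hqn] at h1
  rw [hpn]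
  have h2 := mul_le_mul_of_nonneg_left hloc hA
  linarith

end IsConfining

/-! ### The velocity potential -/

lemma WithLp.norm_snd_le_of_L2 {E F : Type*} [NormedAddCommGroup E] [NormedAddCommGroup F]
    (x : WithLp 2 (E × F)) : ‖x.snd‖ ≤ ‖x‖ := by
  have h := WithLp.prod_norm_sq_eq_of_L2 x
  nlinarith [norm_nonneg x, norm_nonneg x.snd, sq_nonneg ‖x.fst‖]

/-- The Lax–Milgram theorem for the form `⟪p.snd, q.snd⟫` on a closed subspace of a direct sum on
which the first component is controlled by the second. -/
lemma exists_mem_forall_inner_snd_eq {E F : Type*} [NormedAddCommGroup E] [InnerProductSpace ℝ E]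
    [CompleteSpace E] [NormedAddCommGroup F] [InnerProductSpace ℝ F] [CompleteSpace F]
    {S : Submodule ℝ (WithLp 2 (E × F))} (hS : IsClosed (S : Set (WithLp 2 (E × F)))) {C : ℝ}
    (hC0 : 0 ≤ C) (hC : ∀ p ∈ S, ‖p.fst‖ ^ 2 ≤ C * ‖p.snd‖ ^ 2) (a : E) :
    ∃ p ∈ S, ∀ q ∈ S, inner ℝ p.snd q.snd = inner ℝ a q.fst := by
  have : CompleteSpace S := hS.completeSpace_coe
  let B : S →L[ℝ] S →L[ℝ] ℝ := LinearMap.mkContinuous₂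
    (LinearMap.mk₂ ℝ (fun p q : S => inner ℝ (p : WithLp 2 (E × F)).snd (q : WithLp 2 (E × F)).snd)
      (fun p p' q => by simp [inner_add_left]) (fun c p q => by simp [inner_smul_left])
      (fun p q q' => by simp [inner_add_right]) (fun c p q => by simp [inner_smul_right])) 1
    (fun p q => by
      rw [one_mul]
      exact (norm_inner_le_norm _ _).trans (mul_le_mul (WithLp.norm_snd_le_of_L2 _) (WithLp.norm_snd_le_of_L2 _)
        (norm_nonneg _) (norm_nonneg _)))
  have hB : ∀ p q : S, B p q = inner ℝ (p : WithLp 2 (E × F)).snd (q : WithLp 2 (E × F)).snd :=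
    fun p q => rfl
  have hco : IsCoercive B := by
    -- The control of the first component gives `‖p‖² = ‖p.fst‖² + ‖p.snd‖² ≤ (C + 1) ‖p.snd‖²`.
    refine ⟨(C + 1)⁻¹, by positivity, fun p => ?_⟩
    rw [hB, real_inner_self_eq_norm_sq, mul_assoc, ← sq, inv_mul_le_iff₀ (by positivity)]
    have h1 := hC p p.2
    have h2 := WithLp.prod_norm_sq_eq_of_L2 (p : WithLp 2 (E × F))
    rw [Submodule.coe_norm, h2]
    linarith
  let l : S →L[ℝ] ℝ := (innerSL ℝ a) ∘L (WithLp.fstL 2 ℝ E F) ∘L S.subtypeL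
  have hl : ∀ q : S, l q = inner ℝ a (q : WithLp 2 (E × F)).fst := fun q => rfl
  let f : S := (InnerProductSpace.toDual ℝ S).symm l
  refine ⟨hco.continuousLinearEquivOfBilin.symm f, Subtype.prop _, fun q hq => ?_⟩
  have h1 := hco.continuousLinearEquivOfBilin_apply (hco.continuousLinearEquivOfBilin.symm f) ⟨q, hq⟩
  rw [ContinuousLinearEquiv.apply_symm_apply, InnerProductSpace.toDual_symm_apply, hl, hB] at h1
  exact h1.symm

/-- `p` is a zero-mean element of the Sobolev space that solves the weak Poisson equation with the
centered potential as the right-hand side. -/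
def IsGibbsPotential (V : Rd d → ℝ) (b : ℝ) (p : L2Pair (gibbsMeasure V b)) : Prop :=
  p ∈ sobolevH1ZeroMean (gibbsMeasure V b) ∧ ∀ q ∈ sobolevH1 (gibbsMeasure V b),
    inner ℝ p.snd q.snd = -∫ x, q.fst x * (V x - gibbsMean V b) ∂gibbsMeasure V b

namespace IsConfining

variable {V : Rd d → ℝ} {b : ℝ}

lemma memLp_sub_mean (hV : IsConfining V) (hb : 0 < b) :
    MemLp (fun x => V x - gibbsMean V b) 2 (gibbsMeasure V b) := by
  have := hV.isProbabilityMeasure hb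
  exact (hV.memLp_gibbs hb).sub (memLp_const _)

/-- The centered potential as an element of `L²`. -/
def centered (hV : IsConfining V) (hb : 0 < b) : Lp ℝ 2 (gibbsMeasure V b) :=
  (hV.memLp_sub_mean hb).toLp _

lemma coeFn_centered (hV : IsConfining V) (hb : 0 < b) :
    hV.centered hb =ᵐ[gibbsMeasure V b] fun x => V x - gibbsMean V b :=
  MemLp.coeFn_toLp _

lemma inner_centered (hV : IsConfining V) (hb : 0 < b) {f : Lp ℝ 2 (gibbsMeasure V b)}
    {f' : Rd d → ℝ} (hf : f =ᵐ[gibbsMeasure V b] f') : inner ℝ (hV.centered hb) f =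
      ∫ x, f' x * (V x - gibbsMean V b) ∂gibbsMeasure V b := by
  rw [inner_eq_integral (hV.coeFn_centered hb) hf]
  simp

lemma exists_one (hV : IsConfining V) (hb : 0 < b) :
    ∃ e ∈ sobolevH1 (gibbsMeasure V b), e.fst =ᵐ[gibbsMeasure V b] (fun _ => 1) ∧ e.snd = 0 := by
  have := hV.isProbabilityMeasure hb
  obtain ⟨e, he, h1, h2⟩ := (IsBddLip.const (d := d) 1).exists_mem_sobolevH1
    (gibbs_absolutelyContinuous V b)
  refine ⟨e, he, h1, Lp.ext ?_⟩
  filter_upwards [h2, Lp.coeFn_zero (Rd d) 2 (gibbsMeasure V b)] with x h3 h4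
  rw [h3, h4]
  simp [gradient_fun_const]

lemma inner_one {e : L2Pair (gibbsMeasure V b)}
    (he : e.fst =ᵐ[gibbsMeasure V b] (fun _ => 1)) (q : L2Pair (gibbsMeasure V b)) :
    inner ℝ e.fst q.fst = ∫ x, q.fst x ∂gibbsMeasure V b := by
  rw [inner_eq_integral he EventuallyEq.rfl]
  simp

lemma inner_centered_one (hV : IsConfining V) (hb : 0 < b) {e : L2Pair (gibbsMeasure V b)}
    (he : e.fst =ᵐ[gibbsMeasure V b] (fun _ => 1)) : inner ℝ (hV.centered hb) e.fst = 0 := by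
  have := hV.isProbabilityMeasure hb
  rw [hV.inner_centered hb he]
  simp only [one_mul]
  rw [integral_sub ((hV.memLp_gibbs hb).integrable one_le_two) (integrable_const _)]
  simp [gibbsMean]

/-- Lax–Milgram on the zero-mean subspace, where the Poincaré inequality `hP` gives coercivity. The
equation then extends to all of `H¹`, because constants have zero gradient and are orthogonal to the
centered potential. -/
lemma exists_isGibbsPotential (hV : IsConfining V) (hb : 0 < b)
    (hP : ∃ C ≥ 0, ∀ p ∈ sobolevH1 (gibbsMeasure V b),
      ‖p.fst‖ ^ 2 - (∫ x, p.fst x ∂gibbsMeasure V b) ^ 2 ≤ C * ‖p.snd‖ ^ 2) :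
    ∃ p, IsGibbsPotential V b p := by
  have := hV.isProbabilityMeasure hb
  obtain ⟨C, hC0, hC⟩ := hP
  obtain ⟨e, he, he1, he2⟩ := hV.exists_one hb
  let L : L2Pair (gibbsMeasure V b) →L[ℝ] ℝ := (innerSL ℝ e.fst) ∘L (WithLp.fstL 2 ℝ _ _)
  have hL : ∀ q, L q = ∫ x, q.fst x ∂gibbsMeasure V b := fun q => inner_one he1 q
  let S : Submodule ℝ (L2Pair (gibbsMeasure V b)) :=
    sobolevH1 (gibbsMeasure V b) ⊓ LinearMap.ker (L : L2Pair (gibbsMeasure V b) →ₗ[ℝ] ℝ)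
  have hS : IsClosed (S : Set (L2Pair (gibbsMeasure V b))) :=
    (Submodule.isClosed_topologicalClosure _).inter
      (isClosed_eq L.continuous continuous_const : IsClosed {q | L q = 0})
  have hmem : ∀ q, q ∈ S ↔ q ∈ sobolevH1 (gibbsMeasure V b) ∧ L q = 0 := fun q => by simp [S]
  obtain ⟨p, hp, h⟩ := exists_mem_forall_inner_snd_eq hS hC0 (fun p hp => by
    rw [hmem, hL] at hp
    have := hC p hp.1
    rw [hp.2] at this
    linarith) (-hV.centered hb)
  rw [hmem, hL] at hp
  refine ⟨p, hp, fun q hq => ?_⟩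
  have hLe : L e = 1 := by
    rw [hL, integral_congr_ae he1]
    simp
  have hq' : q - L q • e ∈ S := by
    rw [hmem]
    exact ⟨Submodule.sub_mem _ hq (Submodule.smul_mem _ _ he), by simp [hLe]⟩
  have h1 := h _ hq'
  have h2 := hV.inner_centered_one hb he1
  simp only [WithLp.sub_snd, WithLp.smul_snd, he2, smul_zero, sub_zero, WithLp.sub_fst,
    WithLp.smul_fst, inner_neg_left, inner_sub_right, inner_smul_right, h2, mul_zero, neg_zero] at h1
  rw [h1, hV.inner_centered hb EventuallyEq.rfl]

end IsConfining

/-- The velocity potential of the Gibbs curve, for unit speed in the inverse temperature. -/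
def gibbsPotential (V : Rd d → ℝ) (b : ℝ) : L2Pair (gibbsMeasure V b) :=
  open Classical in if h : ∃ p, IsGibbsPotential V b p then h.choose else 0

namespace IsConfining

variable {V : Rd d → ℝ} {b : ℝ}

section

variable (hV : IsConfining V) (hV1 : ContDiff ℝ 1 V)
  (hgrad : ∃ α > 0, ∃ R > 0, ∀ x : Rd d, R < ‖x‖ → α * ‖x‖ ^ 2 ≤ inner ℝ (∇ V x) x)

include hV hV1 hgrad

lemma isGibbsPotential (hb : 1 ≤ b) : IsGibbsPotential V b (gibbsPotential V b) := by
  obtain ⟨C, hC0, hC⟩ := hV.poincare hV1 hgrad b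
  have h := hV.exists_isGibbsPotential (zero_lt_one.trans_le hb)
    ⟨C, hC0, fun p hp => hC b ⟨hb, le_rfl⟩ p hp⟩
  rw [gibbsPotential, dif_pos h]
  exact h.choose_spec

/-- Testing the Poisson equation with its own solution gives `‖∇p‖² ≤ ‖V - mean‖ ‖p‖`, and the
Poincaré inequality bounds `‖p‖` by `√C ‖∇p‖`. -/
lemma exists_norm_potential_le (b₁ : ℝ) :
    ∃ K ≥ 0, ∀ b ∈ Icc 1 b₁, ‖(gibbsPotential V b).snd‖ ≤ K := by
  -- `S` bounds the variance of `V` for all `b ∈ [1, b₁]`: since `V ≥ 0`, the weight decreases in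
  -- `b`, so the numerator is largest at `1` and the denominator smallest at `b₁`.
  obtain ⟨C, hC0, hC⟩ := hV.poincare hV1 hgrad b₁
  set S := (∫ x, V x ^ 2 * Real.exp (-1 * V x)) / ∫ x, Real.exp (-b₁ * V x) with hS
  refine ⟨√C * √S, by positivity, fun b hb => ?_⟩
  have hb0 : 0 < b := zero_lt_one.trans_le hb.1
  have := hV.isProbabilityMeasure hb0
  have hp := hV.isGibbsPotential hV1 hgrad hb.1
  set p := gibbsPotential V b
  have h1 : ‖p.fst‖ ≤ √C * ‖p.snd‖ := by
    have h2 := hC b hb p hp.1.1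
    rw [hp.1.2] at h2
    rw [← Real.sqrt_sq (norm_nonneg p.snd), ← Real.sqrt_mul hC0]
    exact Real.le_sqrt_of_sq_le (by linarith)
  have h3 : ‖hV.centered hb0‖ ≤ √S := by
    refine Real.le_sqrt_of_sq_le ?_
    rw [norm_sq_eq_integral_of_ae (hV.coeFn_centered hb0)]
    have hi1 : Integrable V (gibbsMeasure V b) := (hV.memLp_gibbs hb0).integrable one_le_two
    have hi2 : Integrable (fun x => V x ^ 2) (gibbsMeasure V b) := hV.integrable_pow_gibbs hb0 2
    have h4 : ∫ x, ‖V x - gibbsMean V b‖ ^ 2 ∂gibbsMeasure V b =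
        ∫ x, V x ^ 2 ∂gibbsMeasure V b - gibbsMean V b ^ 2 := by
      have h5 : Integrable (fun x => V x ^ 2 - 2 * gibbsMean V b * V x) (gibbsMeasure V b) :=
        hi2.sub (hi1.const_mul (2 * gibbsMean V b))
      have h6 := integral_add h5 (integrable_const (gibbsMean V b ^ 2))
      rw [integral_sub hi2 (hi1.const_mul (2 * gibbsMean V b)), integral_const_mul] at h6
      simp only [integral_const, probReal_univ, one_smul] at h6
      rw [show ∫ x, V x ∂gibbsMeasure V b = gibbsMean V b from rfl] at h6
      have h7 : ∫ x, ‖V x - gibbsMean V b‖ ^ 2 ∂gibbsMeasure V b =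
          ∫ x, (V x ^ 2 - 2 * gibbsMean V b * V x + gibbsMean V b ^ 2) ∂gibbsMeasure V b := by
        congr 1 with x
        rw [Real.norm_eq_abs, sq_abs]
        ring
      rw [h7, h6]
      ring
    rw [h4, hV.integral_gibbs_eq_div hb0, hS]
    refine (sub_le_self _ (sq_nonneg _)).trans (div_le_div₀ ?_ ?_ ?_ ?_)
    · exact integral_nonneg fun x => by positivity
    · refine integral_mono (hV.integrable_pow_mul_exp hb0 2)
        (hV.integrable_pow_mul_exp zero_lt_one 2) fun x => ?_
      exact mul_le_mul_of_nonneg_left (hV.exp_le_exp_of_le hb.1 x) (sq_nonneg _)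
    · exact hV.partition_pos (hb0.trans_le hb.2)
    · exact integral_mono (hV.integrable_exp (hb0.trans_le hb.2)) (hV.integrable_exp hb0)
        (hV.exp_le_exp_of_le hb.2)
  have h4 : ‖p.snd‖ ^ 2 ≤ √C * √S * ‖p.snd‖ := by
    have h5 := hp.2 p hp.1.1
    rw [real_inner_self_eq_norm_sq, ← hV.inner_centered hb0 EventuallyEq.rfl] at h5
    rw [h5]
    calc -inner ℝ (hV.centered hb0) p.fst ≤ |inner ℝ (hV.centered hb0) p.fst| := neg_le_abs _
      _ ≤ ‖hV.centered hb0‖ * ‖p.fst‖ := abs_real_inner_le_norm _ _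
      _ ≤ √S * (√C * ‖p.snd‖) := by gcongr
      _ = _ := by ring
  rcases (norm_nonneg p.snd).eq_or_lt with h0 | h0
  · rw [← h0]; positivity
  · rw [sq] at h4
    exact le_of_mul_le_mul_right h4 h0

/-- The speed of the Gibbs curve in duality with bounded Lipschitz functions. -/
lemma abs_integral_mul_centered_le (hb : 1 ≤ b) {u : Rd d → ℝ} (hu : IsBddLip u) :
    |∫ x, u x * (V x - gibbsMean V b) ∂gibbsMeasure V b| ≤
      ‖(gibbsPotential V b).snd‖ * √(∫ x, ‖∇ u x‖ ^ 2 ∂gibbsMeasure V b) := by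
  have hb0 : 0 < b := zero_lt_one.trans_le hb
  have := hV.isProbabilityMeasure hb0
  have hp := hV.isGibbsPotential hV1 hgrad hb
  obtain ⟨q, hq, hq1, hq2⟩ := hu.exists_mem_sobolevH1 (gibbs_absolutelyContinuous V b)
  have h1 := hp.2 q hq
  rw [← hV.inner_centered hb0 EventuallyEq.rfl, hV.inner_centered hb0 hq1] at h1
  rw [← abs_neg, ← h1, ← norm_sq_eq_integral_of_ae hq2, Real.sqrt_sq (norm_nonneg _)]
  exact abs_real_inner_le_norm _ _

end

end IsConfining

/-! ### The continuity equation -/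

namespace IsConfining

variable {V : Rd d → ℝ} {b : ℝ}

section

variable {β : ℝ → ℝ} {T t : ℝ}

lemma hasDerivWithinAt_gibbsDensity (hV : IsConfining V) (hβ : 1 ≤ β t)
    (hd : DifferentiableOn ℝ β (Ico 0 T)) (ht : t ∈ Ico 0 T) (x : Rd d) :
    HasDerivWithinAt (fun s => gibbsDensity V (β s) x)
      (-(V x - gibbsMean V (β t)) * gibbsDensity V (β t) x * derivWithin β (Ico 0 T) t)
      (Ico 0 T) t :=
  (hV.hasDerivAt_gibbsDensity (zero_lt_one.trans_le hβ) x).comp_hasDerivWithinAt t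
    (hd t ht).hasDerivWithinAt

lemma gibbsDensityDeriv_eq (hV : IsConfining V) (hβ : 1 ≤ β t)
    (hd : DifferentiableOn ℝ β (Ico 0 T)) (ht : t ∈ Ico 0 T) (x : Rd d) :
    gibbsDensityDeriv V β T t x =
      -(V x - gibbsMean V (β t)) * gibbsDensity V (β t) x * derivWithin β (Ico 0 T) t :=
  (hV.hasDerivWithinAt_gibbsDensity hβ hd ht x).derivWithin (uniqueDiffOn_Ico 0 T t ht)

/-- Both sides are continuous in the graph norm, so testing with `C_c^∞` functions is the same as
testing with all of `H¹`. In this form the potential itself becomes an admissible test function. -/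
lemma solvesContinuityEq_iff (hV : IsConfining V) (hβ : 1 ≤ β t)
    (hd : DifferentiableOn ℝ β (Ico 0 T)) (ht : t ∈ Ico 0 T)
    (w : Lp (Rd d) 2 (gibbsMeasure V (β t))) : SolvesContinuityEq V β T t w ↔
      ∀ q ∈ sobolevH1 (gibbsMeasure V (β t)), inner ℝ w q.snd =
        derivWithin β (Ico 0 T) t * -∫ x, q.fst x * (V x - gibbsMean V (β t))
          ∂gibbsMeasure V (β t) := by
  have hb : 0 < β t := zero_lt_one.trans_le hβ
  have := hV.isProbabilityMeasure hb
  have hrhs : ∀ f : Rd d → ℝ, ∫ x, f x * gibbsDensityDeriv V β T t x =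
      derivWithin β (Ico 0 T) t * -∫ x, f x * (V x - gibbsMean V (β t))
          ∂gibbsMeasure V (β t) := by
    intro f
    rw [hV.integral_gibbs hb, ← integral_neg, ← integral_const_mul]
    congr 1 with x
    rw [hV.gibbsDensityDeriv_eq hβ hd ht, smul_eq_mul]
    ring
  have hlhs : ∀ (f : Rd d → ℝ) (q : L2Pair (gibbsMeasure V (β t))),
      q.snd =ᵐ[gibbsMeasure V (β t)] ∇ f →
      ∫ x, inner ℝ (w x) (∇ f x) * gibbsDensity V (β t) x = inner ℝ w q.snd := by
    intro f q hq
    rw [inner_eq_integral EventuallyEq.rfl hq, hV.integral_gibbs hb]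
    congr 1 with x
    rw [smul_eq_mul, mul_comm]
  constructor
  · intro h
    have hcl : IsClosed {q : L2Pair (gibbsMeasure V (β t)) | inner ℝ w q.snd =
        derivWithin β (Ico 0 T) t * -inner ℝ (hV.centered hb) q.fst} := by
      refine isClosed_eq ?_ ?_
      · exact (innerSL ℝ w ∘L WithLp.sndL 2 ℝ _ _).continuous
      · exact continuous_const.mul (innerSL ℝ (hV.centered hb) ∘L WithLp.fstL 2 ℝ _ _).continuous.neg
    intro q hq
    rw [← hV.inner_centered hb EventuallyEq.rfl]
    refine closure_minimal ?_ hcl hq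
    rintro q ⟨f, hf, hq1, hq2⟩
    change _ = _
    rw [hV.inner_centered hb hq1, ← hlhs f q hq2, h f hf, hrhs]
  · intro h f hf
    obtain ⟨q, hq, hq1, hq2⟩ := hf.exists_mem_testGraph (μ := gibbsMeasure V (β t))
    rw [hrhs, hlhs f q hq2, h q (subset_closure hq), ← hV.inner_centered hb EventuallyEq.rfl,
      hV.inner_centered hb hq1]

section

variable (hV : IsConfining V) (hV1 : ContDiff ℝ 1 V)
  (hgrad : ∃ α > 0, ∃ R > 0, ∀ x : Rd d, R < ‖x‖ → α * ‖x‖ ^ 2 ≤ inner ℝ (∇ V x) x)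

include hV hV1 hgrad

/-- The scaled velocity potential is the unique zero-mean solution of the continuity equation, and
its gradient is the unique solution of minimal norm. -/
lemma smul_gibbsPotential_spec (hβ : 1 ≤ β t)
    (hd : DifferentiableOn ℝ β (Ico 0 T)) (ht : t ∈ Ico 0 T)
    {h : L2Pair (gibbsMeasure V (β t))}
    (hh : h = derivWithin β (Ico 0 T) t • gibbsPotential V (β t)) :
    h ∈ sobolevH1ZeroMean (gibbsMeasure V (β t)) ∧
    HasWeakGradient h.fst h.snd ∧
    SolvesContinuityEq V β T t h.snd ∧
    (∀ p ∈ sobolevH1ZeroMean (gibbsMeasure V (β t)),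
      SolvesContinuityEq V β T t p.snd → p = h) ∧
    (∀ w : Lp (Rd d) 2 (gibbsMeasure V (β t)), SolvesContinuityEq V β T t w →
      ‖h.snd‖ ≤ ‖w‖ ∧ (‖w‖ = ‖h.snd‖ → w = h.snd)) := by
  have hb : 0 < β t := zero_lt_one.trans_le hβ
  have := hV.isProbabilityMeasure hb
  have hp := hV.isGibbsPotential hV1 hgrad hβ
  obtain ⟨e, he, he1, -⟩ := hV.exists_one hb
  have hmem : h ∈ sobolevH1 (gibbsMeasure V (β t)) := hh ▸ Submodule.smul_mem _ _ hp.1.1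
  have hz : ∫ x, h.fst x ∂gibbsMeasure V (β t) = 0 := by
    rw [← inner_one he1, hh, WithLp.smul_fst, inner_smul_right, inner_one he1, hp.1.2, mul_zero]
  have hsolve : SolvesContinuityEq V β T t h.snd := by
    rw [hV.solvesContinuityEq_iff hβ hd ht]
    intro q hq
    rw [hh, WithLp.smul_snd, real_inner_smul_left, hp.2 q hq]
  -- Orthogonality to all gradients yields both uniqueness (test with the difference of two
  -- potentials) and minimality (Pythagoras).
  have horth : ∀ w : Lp (Rd d) 2 (gibbsMeasure V (β t)), SolvesContinuityEq V β T t w →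
      ∀ q ∈ sobolevH1 (gibbsMeasure V (β t)), inner ℝ (w - h.snd) q.snd = 0 := by
    intro w hw q hq
    rw [hV.solvesContinuityEq_iff hβ hd ht] at hw hsolve
    rw [inner_sub_left, hw q hq, hsolve q hq, sub_self]
  refine ⟨⟨hmem, hz⟩, hV.hasWeakGradient hb hmem, hsolve, ?_, ?_⟩
  · intro p hp1 hp2
    have h1 : p - h ∈ sobolevH1 (gibbsMeasure V (β t)) := Submodule.sub_mem _ hp1.1 hmem
    have h2 : (p - h).snd = 0 := by
      have h3 := horth _ hp2 _ h1
      rw [WithLp.sub_snd, inner_self_eq_zero] at h3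
      exact h3
    obtain ⟨C, hC0, hC⟩ := hV.poincare hV1 hgrad (β t)
    have h3 := hC _ ⟨hβ, le_rfl⟩ _ h1
    have h4 : ∫ x, (p - h).fst x ∂gibbsMeasure V (β t) = 0 := by
      rw [← inner_one he1, WithLp.sub_fst, inner_sub_right, inner_one he1, inner_one he1, hz,
        hp1.2, sub_zero]
    rw [h4, h2] at h3
    have h5 : (p - h).fst = 0 := by
      rw [← norm_eq_zero]
      have : ‖(p - h).fst‖ ^ 2 ≤ 0 := by simpa using h3
      exact pow_eq_zero_iff two_ne_zero |>.1 (le_antisymm this (sq_nonneg _))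
    refine sub_eq_zero.1 (norm_eq_zero.1 ?_)
    have h6 := WithLp.prod_norm_sq_eq_of_L2 (p - h)
    rw [h5, h2] at h6
    simpa using h6
  · intro w hw
    have h1 := horth w hw h hmem
    have h2 : ‖w‖ ^ 2 = ‖w - h.snd‖ ^ 2 + ‖h.snd‖ ^ 2 := by
      have := norm_add_sq_real (w - h.snd) h.snd
      rw [h1, sub_add_cancel] at this
      linarith
    constructor
    · refine le_of_sq_le_sq ?_ (norm_nonneg _)
      nlinarith [sq_nonneg ‖w - h.snd‖]
    · intro h3
      rw [h3] at h2
      refine sub_eq_zero.1 (norm_eq_zero.1 (pow_eq_zero_iff two_ne_zero |>.1 ?_))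
      linarith

end

end

end IsConfining

/-! ### Measurability and integrability of the speed -/

namespace IsConfining

variable {V : Rd d → ℝ} {b : ℝ}

lemma continuousAt_integral_mul_pow_gibbs (hV : IsConfining V) (hb : 0 < b) (k : ℕ)
    {f : Rd d → ℝ} {M : ℝ} (hf : AEStronglyMeasurable f) (hM : ∀ x, |f x| ≤ M) :
    ContinuousAt (fun b => ∫ x, f x * V x ^ k ∂gibbsMeasure V b) b := by
  have h1 := (hV.hasDerivAt_integral_mul_pow_mul_exp hb k hf hM).continuousAt
  have h2 := (hV.hasDerivAt_integral_mul_pow_mul_exp hb 0 (f := fun _ => 1) (M := 1)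
    aestronglyMeasurable_const (by simp)).continuousAt
  simp only [pow_zero, one_mul] at h2
  refine (h1.div h2 (hV.partition_pos hb).ne').congr ?_
  filter_upwards [Ioi_mem_nhds hb] with c hc
  rw [hV.integral_gibbs_eq_div hc]
  simp only [mul_assoc, Pi.div_apply]

lemma integral_mul_centered (hV : IsConfining V) (hb : 0 < b) {f : Rd d → ℝ} {M : ℝ}
    (hf : AEStronglyMeasurable f) (hM : ∀ x, |f x| ≤ M) :
    ∫ x, f x * (V x - gibbsMean V b) ∂gibbsMeasure V b =
      ∫ x, f x * V x ^ 1 ∂gibbsMeasure V b -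
        (∫ x, 1 * V x ^ 1 ∂gibbsMeasure V b) * ∫ x, f x * V x ^ 0 ∂gibbsMeasure V b := by
  have := hV.isProbabilityMeasure hb
  have hf' := hf.mono_ac (gibbs_absolutelyContinuous V b)
  have h1 : Integrable (fun x => f x * V x) (gibbsMeasure V b) :=
    ((hV.memLp_gibbs hb).integrable one_le_two).bdd_mul hf' (ae_of_all _ hM)
  have h2 : Integrable f (gibbsMeasure V b) := Integrable.of_bound hf' M (ae_of_all _ hM)
  simp only [pow_one, pow_zero, mul_one, one_mul]
  change _ = _ - gibbsMean V b * _
  rw [← integral_const_mul, ← integral_sub h1 (h2.const_mul _)]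
  congr 1 with x
  ring

lemma continuousAt_integral_mul_centered (hV : IsConfining V) (hb : 0 < b) {f : Rd d → ℝ} {M : ℝ}
    (hf : AEStronglyMeasurable f) (hM : ∀ x, |f x| ≤ M) :
    ContinuousAt (fun b => ∫ x, f x * (V x - gibbsMean V b) ∂gibbsMeasure V b) b := by
  refine ((hV.continuousAt_integral_mul_pow_gibbs hb 1 hf hM).sub
    ((hV.continuousAt_integral_mul_pow_gibbs hb 1 (f := fun _ => 1) (M := 1)
      aestronglyMeasurable_const (by simp)).mul
      (hV.continuousAt_integral_mul_pow_gibbs hb 0 hf hM))).congr ?_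
  filter_upwards [Ioi_mem_nhds hb] with c hc
  exact (hV.integral_mul_centered hc hf hM).symm

section

variable (hV : IsConfining V) (hV1 : ContDiff ℝ 1 V)
  (hgrad : ∃ α > 0, ∃ R > 0, ∀ x : Rd d, R < ‖x‖ → α * ‖x‖ ^ 2 ≤ inner ℝ (∇ V x) x)

include hV hV1 hgrad

/-- The norm is written as `‖∇p‖² = sup (2 ⟨∇p, ∇f⟩ - ‖∇f‖²)` over test functions, with the Poisson
equation inserted. Each competitor involves only integrals of functions against the Gibbs measure,
which makes different `b` comparable although the spaces `L2Pair` vary. -/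
lemma lt_norm_sq_gibbsPotential_iff (hb : 1 ≤ b) (c : ℝ) :
    c < ‖(gibbsPotential V b).snd‖ ^ 2 ↔ ∃ f : Rd d → ℝ, IsTestFunction f ∧
      c < 2 * -(∫ x, f x * (V x - gibbsMean V b) ∂gibbsMeasure V b) -
        ∫ x, ‖∇ f x‖ ^ 2 ∂gibbsMeasure V b := by
  have hb0 : 0 < b := zero_lt_one.trans_le hb
  have := hV.isProbabilityMeasure hb0
  have hp := hV.isGibbsPotential hV1 hgrad hb
  set p := gibbsPotential V b
  have key : ∀ (f : Rd d → ℝ) (q : L2Pair (gibbsMeasure V b)), q ∈ testGraph (gibbsMeasure V b) →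
      q.fst =ᵐ[gibbsMeasure V b] f → q.snd =ᵐ[gibbsMeasure V b] ∇ f →
      2 * -(∫ x, f x * (V x - gibbsMean V b) ∂gibbsMeasure V b) -
        ∫ x, ‖∇ f x‖ ^ 2 ∂gibbsMeasure V b = 2 * inner ℝ p.snd q.snd - ‖q.snd‖ ^ 2 := by
    intro f q hq hq1 hq2
    rw [hp.2 q (subset_closure hq), norm_sq_eq_integral_of_ae hq2,
      ← hV.inner_centered hb0 EventuallyEq.rfl, hV.inner_centered hb0 hq1]
  constructor
  · intro hc
    have hcont : Continuous fun q : L2Pair (gibbsMeasure V b) =>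
        2 * inner ℝ p.snd q.snd - ‖q.snd‖ ^ 2 := by
      have h1 : Continuous fun q : L2Pair (gibbsMeasure V b) => q.snd :=
        (WithLp.sndL 2 ℝ (Lp ℝ 2 (gibbsMeasure V b)) (Lp (Rd d) 2 (gibbsMeasure V b))).continuous
      exact (continuous_const.mul (continuous_const.inner h1)).sub (h1.norm.pow 2)
    have hmem : {q : L2Pair (gibbsMeasure V b) | c < 2 * inner ℝ p.snd q.snd - ‖q.snd‖ ^ 2} ∈
        𝓝 p := by
      refine (isOpen_lt continuous_const hcont).mem_nhds ?_
      change c < _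
      rw [real_inner_self_eq_norm_sq]
      linarith
    obtain ⟨q, hq, f, hf, hq1, hq2⟩ := mem_closure_iff_nhds.1 hp.1.1 _ hmem
    refine ⟨f, hf, ?_⟩
    rw [key f q ⟨f, hf, hq1, hq2⟩ hq1 hq2]
    exact hq
  · rintro ⟨f, hf, hc⟩
    obtain ⟨q, hq, hq1, hq2⟩ := hf.exists_mem_testGraph (μ := gibbsMeasure V b)
    rw [key f q hq hq1 hq2] at hc
    have := norm_sub_sq_real p.snd q.snd
    nlinarith [sq_nonneg ‖p.snd - q.snd‖]

/-- A supremum of functions continuous in `b` is lower semicontinuous, so its superlevel sets are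
open. The indicator restricts to the `b` for which the potential is known to solve the equation. -/
lemma measurable_norm_gibbsPotential :
    Measurable ((Ici (1 : ℝ)).indicator fun b => ‖(gibbsPotential V b).snd‖) := by
  have h : Measurable ((Ici (1 : ℝ)).indicator fun b => ‖(gibbsPotential V b).snd‖ ^ 2) := by
    refine measurable_of_Ioi fun c => ?_
    let A : Set ℝ := {b | 0 < b ∧ ∃ f : Rd d → ℝ, IsTestFunction f ∧ c <
      2 * -(∫ x, f x * (V x - gibbsMean V b) ∂gibbsMeasure V b) -
        ∫ x, ‖∇ f x‖ ^ 2 ∂gibbsMeasure V b}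
    have hA : IsOpen A := by
      rw [isOpen_iff_mem_nhds]
      rintro b ⟨hb, f, hf, h⟩
      obtain ⟨M, hM⟩ := hf.exists_bound
      have h1 := hV.continuousAt_integral_mul_centered hb hf.1.continuous.aestronglyMeasurable
        fun x => (hM x).1
      have h2 := (hV.hasDerivAt_integral_gibbs hb (M := M ^ 2)
        (hf.continuous_gradient.norm.pow 2).aestronglyMeasurable fun x => by
          rw [abs_of_nonneg (sq_nonneg _)]
          exact pow_le_pow_left₀ (norm_nonneg _) (hM x).2 2).continuousAt
      have h3 := (continuousAt_const (y := (2 : ℝ))).mul h1.neg |>.sub h2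
      filter_upwards [h3.eventually (lt_mem_nhds h), Ioi_mem_nhds hb] with x hx1 hx2
      exact ⟨hx2, f, hf, hx1⟩
    have hset : (Ici (1 : ℝ)).indicator (fun b => ‖(gibbsPotential V b).snd‖ ^ 2) ⁻¹' Ioi c =
        (Ici 1 ∩ A) ∪ ((Ici 1)ᶜ ∩ {_b | c < 0}) := by
      ext b
      by_cases hb : b ∈ Ici (1 : ℝ)
      · have hb' : (1 : ℝ) ≤ b := hb
        simp only [mem_preimage, indicator_of_mem hb, mem_Ioi, mem_union, mem_inter_iff, hb,
          true_and, mem_compl_iff, not_true_eq_false, false_and, or_false]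
        rw [hV.lt_norm_sq_gibbsPotential_iff hV1 hgrad hb]
        exact (and_iff_right (zero_lt_one.trans_le hb')).symm
      · rw [mem_preimage, indicator_of_notMem hb]
        have hb' : b < 1 := not_le.1 hb
        simp [hb']
    rw [hset]
    exact (measurableSet_Ici.inter hA.measurableSet).union
      (measurableSet_Ici.compl.inter (MeasurableSet.const _))
  convert h.sqrt using 2 with b
  by_cases hb : b ∈ Ici (1 : ℝ)
  · rw [indicator_of_mem hb, indicator_of_mem hb, Real.sqrt_sq (norm_nonneg _)]
  · rw [indicator_of_notMem hb, indicator_of_notMem hb, Real.sqrt_zero]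

lemma integrableOn_norm_smul_gibbsPotential {β : ℝ → ℝ} {T b₁ : ℝ}
    (hβ : ∀ t ∈ Ico 0 T, β t ∈ Icc 1 b₁) (hd : DifferentiableOn ℝ β (Ico 0 T))
    (hi : IntegrableOn (derivWithin β (Ico 0 T)) (Ico 0 T)) :
    IntegrableOn (fun t => ‖(derivWithin β (Ico 0 T) t • gibbsPotential V (β t)).snd‖)
      (Ico 0 T) := by
  obtain ⟨K, hK0, hK⟩ := hV.exists_norm_potential_le hV1 hgrad b₁
  have h1 : AEMeasurable β (volume.restrict (Ico 0 T)) :=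
    hd.continuousOn.aemeasurable measurableSet_Ico
  have h2 := ((hV.measurable_norm_gibbsPotential hV1 hgrad).comp_aemeasurable
    h1).aestronglyMeasurable
  have h3 : IntegrableOn (fun t => ((Ici (1 : ℝ)).indicator fun b => ‖(gibbsPotential V b).snd‖)
      (β t) * ‖derivWithin β (Ico 0 T) t‖) (Ico 0 T) := by
    refine hi.norm.bdd_mul (c := K) h2 ?_
    filter_upwards [ae_restrict_mem measurableSet_Ico] with t ht
    rw [indicator_of_mem (mem_Ici.2 (hβ t ht).1), norm_norm]
    exact hK _ (hβ t ht)
  refine h3.congr_fun (fun t ht => ?_) measurableSet_Ico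
  simp only [WithLp.smul_snd, norm_smul, indicator_of_mem (mem_Ici.2 (hβ t ht).1), mul_comm]

end

end IsConfining

lemma sub_eq_integral_derivWithin {β : ℝ → ℝ} {T s t : ℝ} (hd : DifferentiableOn ℝ β (Ico 0 T))
    (hi : IntegrableOn (derivWithin β (Ico 0 T)) (Ico 0 T)) (hs : s ∈ Ico 0 T) (ht : t ∈ Ico 0 T)
    (hst : s ≤ t) : β t - β s = ∫ r in s..t, derivWithin β (Ico 0 T) r := by
  have hsub : Icc s t ⊆ Ico 0 T := fun r hr => ⟨hs.1.trans hr.1, hr.2.trans_lt ht.2⟩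
  refine (intervalIntegral.integral_eq_sub_of_hasDerivAt_of_le hst (hd.continuousOn.mono hsub)
    (fun r hr => ?_) ?_).symm
  · exact (hd r (hsub ⟨hr.1.le, hr.2.le⟩)).hasDerivWithinAt.hasDerivAt
      (Ico_mem_nhds (hs.1.trans_lt hr.1) (hr.2.trans ht.2))
  · rw [intervalIntegrable_iff_integrableOn_Icc_of_le hst]
    exact hi.mono_set hsub

/-- The total variation of `β` bounds its range, so the estimates uniform on `[1, b₁]` apply along
the whole curve. -/
lemma exists_forall_mem_Icc_of_integrableOn_derivWithin {β : ℝ → ℝ} {T : ℝ}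
    (hβ : ∀ t ∈ Ico 0 T, 1 ≤ β t) (hd : DifferentiableOn ℝ β (Ico 0 T))
    (hi : IntegrableOn (derivWithin β (Ico 0 T)) (Ico 0 T)) :
    ∃ b₁, ∀ t ∈ Ico 0 T, β t ∈ Icc 1 b₁ := by
  refine ⟨β 0 + ∫ r in Ico 0 T, ‖derivWithin β (Ico 0 T) r‖, fun t ht => ⟨hβ t ht, ?_⟩⟩
  have h0 : (0 : ℝ) ∈ Ico 0 T := ⟨le_rfl, ht.1.trans_lt ht.2⟩
  have h1 := sub_eq_integral_derivWithin hd hi h0 ht ht.1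
  have h2 := intervalIntegral.norm_integral_le_integral_norm (f := derivWithin β (Ico 0 T))
    (μ := volume) ht.1
  have h3 : ∫ r in (0 : ℝ)..t, ‖derivWithin β (Ico 0 T) r‖ ≤
      ∫ r in Ico 0 T, ‖derivWithin β (Ico 0 T) r‖ := by
    rw [intervalIntegral.integral_of_le ht.1, integral_Ioc_eq_integral_Ioo]
    exact setIntegral_mono_set hi.norm (ae_of_all _ fun _ => norm_nonneg _)
      (Ioo_subset_Ico_self.trans (Ico_subset_Ico_right ht.2.le)).eventuallyLE
  have h4 := le_abs_self (β t - β 0)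
  rw [h1, ← Real.norm_eq_abs] at h4
  linarith

/-! ### The Hopf–Lax semigroup -/

/-- The Hopf–Lax semigroup for the cost `‖x - y‖²`. -/
def hopfLax (g : Rd d → ℝ) (s : ℝ) (z : Rd d) : ℝ :=
  if 0 < s then ⨅ y, (g y + ‖z - y‖ ^ 2 / s) else g z

/-- Joint convexity of `(a, s) ↦ ‖a‖² / s`: after clearing denominators the gap is the square of
`‖a‖ τ - ‖b‖ s`. -/
lemma norm_add_sq_div_le {E : Type*} [SeminormedAddCommGroup E] (a b : E) {s τ : ℝ} (hs : 0 < s)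
    (hτ : 0 < τ) : ‖a + b‖ ^ 2 / (s + τ) ≤ ‖a‖ ^ 2 / s + ‖b‖ ^ 2 / τ := by
  have h1 : ‖a + b‖ ^ 2 ≤ (‖a‖ + ‖b‖) ^ 2 := pow_le_pow_left₀ (norm_nonneg _) (norm_add_le a b) 2
  refine (div_le_div_of_nonneg_right h1 (by positivity)).trans ?_
  rw [div_add_div _ _ hs.ne' hτ.ne', div_le_div_iff₀ (by positivity) (by positivity)]
  nlinarith [sq_nonneg (‖a‖ * τ - ‖b‖ * s), mul_pos hs hτ]

section

variable {g : Rd d → ℝ} {s τ : ℝ}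

lemma hopfLax_zero (g : Rd d → ℝ) : hopfLax g 0 = g := by
  ext z
  simp [hopfLax]

lemma bddBelow_hopfLax {M : ℝ} (hM : ∀ x, |g x| ≤ M) (hs : 0 < s) (z : Rd d) :
    BddBelow (range fun y => g y + ‖z - y‖ ^ 2 / s) := by
  refine ⟨-M, ?_⟩
  rintro _ ⟨y, rfl⟩
  have := neg_le_of_abs_le (hM y)
  have : 0 ≤ ‖z - y‖ ^ 2 / s := by positivity
  dsimp only
  linarith

lemma hopfLax_le {M : ℝ} (hM : ∀ x, |g x| ≤ M) (hs : 0 < s) (y z : Rd d) :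
    hopfLax g s z ≤ g y + ‖z - y‖ ^ 2 / s := by
  rw [hopfLax, if_pos hs]
  exact ciInf_le (bddBelow_hopfLax hM hs z) y

lemma le_hopfLax (hs : 0 < s) {a : ℝ} {z : Rd d} (h : ∀ y, a ≤ g y + ‖z - y‖ ^ 2 / s) :
    a ≤ hopfLax g s z := by
  rw [hopfLax, if_pos hs]
  exact le_ciInf h

lemma abs_hopfLax_le {M : ℝ} (hM : ∀ x, |g x| ≤ M) (s : ℝ) (z : Rd d) : |hopfLax g s z| ≤ M := by
  by_cases hs : 0 < s
  · refine abs_le.2 ⟨le_hopfLax hs fun y => ?_, (hopfLax_le hM hs z z).trans ?_⟩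
    · have := neg_le_of_abs_le (hM y)
      have : 0 ≤ ‖z - y‖ ^ 2 / s := by positivity
      linarith
    · simpa using le_of_abs_le (hM z)
  · rw [hopfLax, if_neg hs]
    exact hM z

/-- The half `Q_{s+τ} ≤ Q_τ Q_s` of the semigroup law, where `Q_s g` is `hopfLax g s`. -/
lemma hopfLax_add_le {M : ℝ} (hM : ∀ x, |g x| ≤ M) (hs : 0 ≤ s) (hτ : 0 < τ) (y z : Rd d) :
    hopfLax g (s + τ) z ≤ hopfLax g s y + ‖z - y‖ ^ 2 / τ := by
  rcases hs.eq_or_lt with rfl | hs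
  · rw [zero_add, hopfLax_zero]
    exact hopfLax_le hM hτ y z
  · rw [← sub_le_iff_le_add]
    refine le_hopfLax hs fun w => ?_
    have h1 := hopfLax_le hM (add_pos hs hτ) w z
    have h2 := norm_add_sq_div_le (y - w) (z - y) hs hτ
    rw [show y - w + (z - y) = z - w by abel] at h2
    linarith

lemma lipschitzWith_hopfLax {M : ℝ} (hM : ∀ x, |g x| ≤ M) {L : NNReal} (hL : LipschitzWith L g)
    (s : ℝ) : LipschitzWith L (hopfLax g s) := by
  by_cases hs : 0 < s
  · refine LipschitzWith.of_le_add_mul L fun z z' => ?_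
    rw [← sub_le_iff_le_add]
    refine le_hopfLax hs fun y => ?_
    have h1 := hopfLax_le hM hs (y + (z - z')) z
    rw [show z - (y + (z - z')) = z' - y by abel] at h1
    have h2 := hL.le_add_mul (y + (z - z')) y
    rw [dist_eq_norm, show y + (z - z') - y = z - z' by abel] at h2
    rw [dist_eq_norm]
    linarith
  · have : hopfLax g s = g := by
      ext z
      rw [hopfLax, if_neg hs]
    rwa [this]

lemma isBddLip_hopfLax (hg : IsBddLip g) (s : ℝ) : IsBddLip (hopfLax g s) := by
  obtain ⟨⟨L, hL⟩, M, hM⟩ := hg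
  exact ⟨⟨L, lipschitzWith_hopfLax hM hL s⟩, M, abs_hopfLax_le hM s⟩

lemma le_hopfLax_add {M : ℝ} (hM : ∀ x, |g x| ≤ M) {L : NNReal} (hL : LipschitzWith L g)
    (hs : 0 ≤ s) (hτ : 0 < τ) (z : Rd d) :
    hopfLax g s z - L ^ 2 * τ ≤ hopfLax g (s + τ) z := by
  have key : ∀ w, hopfLax g s z - L ^ 2 * τ ≤ hopfLax g s w + ‖z - w‖ ^ 2 / τ := by
    intro w
    have h1 := (lipschitzWith_hopfLax hM hL s).le_add_mul z w
    rw [dist_eq_norm] at h1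
    have h2 : (L : ℝ) * ‖z - w‖ ≤ L ^ 2 * τ + ‖z - w‖ ^ 2 / τ := by
      rw [← sub_le_iff_le_add', le_div_iff₀ hτ]
      nlinarith [sq_nonneg (L * τ - ‖z - w‖), sq_nonneg (L * τ), sq_nonneg ‖z - w‖]
    linarith
  refine le_hopfLax (by positivity) fun y => ?_
  rcases hs.eq_or_lt with rfl | hs
  · have := key y
    rwa [hopfLax_zero, zero_add] at *
  -- The point dividing the segment from `y` to `z` in the ratio `s : τ` makes the two costs add up
  -- exactly to the cost over time `s + τ`.
  · have h1 := key (y + (s / (s + τ)) • (z - y))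
    have h2 := hopfLax_le hM hs y (y + (s / (s + τ)) • (z - y))
    have hst : 0 < s + τ := add_pos hs hτ
    rw [add_sub_cancel_left, norm_smul, Real.norm_of_nonneg (by positivity)] at h2
    have h3 : z - (y + (s / (s + τ)) • (z - y)) = (τ / (s + τ)) • (z - y) := by
      have : τ / (s + τ) = 1 - s / (s + τ) := by field_simp; ring
      rw [this, sub_smul, one_smul]
      abel
    rw [h3, norm_smul, Real.norm_of_nonneg (by positivity)] at h1
    have h4 : (s / (s + τ) * ‖z - y‖) ^ 2 / s + (τ / (s + τ) * ‖z - y‖) ^ 2 / τ =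
        ‖z - y‖ ^ 2 / (s + τ) := by
      field_simp
    linarith

end

/-! ### The Gibbs curve is Lipschitz in the inverse temperature -/

/-- Dominated convergence with both integrand and measure moving: for inverse temperatures in `[1,
b₁]` the densities are at most `e^{-V} / ∫ e^{-b₁ V}`. -/
lemma IsConfining.tendsto_integral_gibbs {V : Rd d → ℝ} (hV : IsConfining V) {ι : Type*}
    {l : Filter ι} [l.IsCountablyGenerated] {c : ι → ℝ} {b b₁ M : ℝ} (hb : 0 < b)
    (hc : ∀ᶠ i in l, c i ∈ Icc 1 b₁) (hcb : Tendsto c l (𝓝 b)) {F : ι → Rd d → ℝ}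
    {F₀ : Rd d → ℝ} (hm : ∀ i, AEStronglyMeasurable (F i)) (hM : ∀ᶠ i in l, ∀ᵐ x, |F i x| ≤ M)
    (hF : ∀ᵐ x, Tendsto (fun i => F i x) l (𝓝 (F₀ x))) :
    Tendsto (fun i => ∫ x, F i x ∂gibbsMeasure V (c i)) l (𝓝 (∫ x, F₀ x ∂gibbsMeasure V b)) := by
  have h1 : Tendsto (fun i => ∫ x, gibbsDensity V (c i) x • F i x) l
      (𝓝 (∫ x, gibbsDensity V b x • F₀ x)) := by
    refine tendsto_integral_filter_of_dominated_convergence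
      (fun x => Real.exp (-1 * V x) / (∫ y, Real.exp (-b₁ * V y)) * M)
      (Eventually.of_forall fun i => (hV.continuous_gibbsDensity _).aestronglyMeasurable.smul (hm i))
      ?_ (((hV.integrable_exp zero_lt_one).div_const _).mul_const M) ?_
    · filter_upwards [hc, hM] with i hi hMi
      filter_upwards [hMi] with x hx
      have hi0 : 0 < c i := zero_lt_one.trans_le hi.1
      rw [norm_smul, Real.norm_of_nonneg (hV.gibbsDensity_pos hi0 x).le]
      have hb1 := hV.partition_pos (hi0.trans_le hi.2)
      refine mul_le_mul ?_ hx (norm_nonneg _) (by positivity)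
      exact div_le_div₀ (Real.exp_pos _).le (hV.exp_le_exp_of_le hi.1 x) hb1
        (integral_mono (hV.integrable_exp (hi0.trans_le hi.2)) (hV.integrable_exp hi0)
          (hV.exp_le_exp_of_le hi.2))
    · filter_upwards [hF] with x hx
      exact ((hV.hasDerivAt_gibbsDensity hb x).continuousAt.tendsto.comp hcb).smul hx
  rw [hV.integral_gibbs hb]
  refine h1.congr' ?_
  filter_upwards [hc] with i hi
  rw [hV.integral_gibbs (zero_lt_one.trans_le hi.1)]

lemma abs_hopfLax_sub_le {g : Rd d → ℝ} {M : ℝ} (hM : ∀ x, |g x| ≤ M) {L : NNReal}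
    (hL : LipschitzWith L g) {s t : ℝ} (hs : 0 ≤ s) (ht : 0 ≤ t) (z : Rd d) :
    |hopfLax g t z - hopfLax g s z| ≤ L ^ 2 * |t - s| := by
  wlog hst : s ≤ t generalizing s t
  · rw [abs_sub_comm, abs_sub_comm t]
    exact this ht hs (not_le.1 hst).le
  rcases hst.eq_or_lt with rfl | hst
  · simp
  · have h1 := hopfLax_add_le hM hs (sub_pos.2 hst) z z
    have h2 := le_hopfLax_add hM hL hs (sub_pos.2 hst) z
    rw [add_sub_cancel] at h1 h2
    rw [sub_self, norm_zero, zero_pow two_ne_zero, zero_div, add_zero] at h1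
    have h3 : 0 ≤ (L : ℝ) ^ 2 * (t - s) := mul_nonneg (sq_nonneg _) (sub_pos.2 hst).le
    rw [abs_of_pos (sub_pos.2 hst), abs_le]
    exact ⟨by linarith, by linarith⟩

lemma norm_gradient_le_of_lipschitzWith {u : Rd d → ℝ} {L : NNReal} (hL : LipschitzWith L u)
    (z : Rd d) : ‖∇ u z‖ ≤ L := by
  rw [norm_gradient]
  exact norm_fderiv_le_of_lipschitz ℝ hL

/-- The upper bound for the time difference quotients of the Hopf–Lax semigroup, which is obtained
by moving with the velocity `-∇u / 2`. -/
def hopfLaxSlope (u : Rd d → ℝ) (τ : ℝ) (z : Rd d) : ℝ :=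
  τ⁻¹ * (u (z + τ • (-(1 / 2 : ℝ) • ∇ u z)) - u z) + ‖-(1 / 2 : ℝ) • ∇ u z‖ ^ 2

lemma hopfLax_sub_div_le {g : Rd d → ℝ} {M : ℝ} (hM : ∀ x, |g x| ≤ M) {s τ : ℝ} (hs : 0 ≤ s)
    (hτ : 0 < τ) (z : Rd d) :
    hopfLax g (s + τ) z ≤ hopfLax g s z + τ * hopfLaxSlope (hopfLax g s) τ z := by
  refine (hopfLax_add_le hM hs hτ (z + τ • (-(1 / 2 : ℝ) • ∇ (hopfLax g s) z)) z).trans_eq ?_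
  rw [hopfLaxSlope, sub_add_cancel_left, norm_neg, norm_smul τ, Real.norm_of_nonneg hτ.le]
  field_simp
  ring

lemma measurable_hopfLaxSlope {u : Rd d → ℝ} (hu : Continuous u) (τ : ℝ) :
    Measurable (hopfLaxSlope u τ) := by
  have := measurable_gradient u
  unfold hopfLaxSlope
  have h1 : Measurable fun z => z + τ • (-(1 / 2 : ℝ) • ∇ u z) := by fun_prop
  exact (((hu.measurable.comp h1).sub hu.measurable).const_mul _).add (by fun_prop)

lemma abs_hopfLaxSlope_le {u : Rd d → ℝ} {L : NNReal} (hL : LipschitzWith L u) {τ : ℝ}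
    (hτ : 0 < τ) (z : Rd d) : |hopfLaxSlope u τ z| ≤ L ^ 2 := by
  have h0 : ‖-(1 / 2 : ℝ) • ∇ u z‖ ≤ L / 2 := by
    rw [norm_smul, norm_neg, Real.norm_of_nonneg (by norm_num)]
    linarith [norm_gradient_le_of_lipschitzWith hL z]
  have h1 := hL.dist_le_mul (z + τ • (-(1 / 2 : ℝ) • ∇ u z)) z
  rw [dist_eq_norm, dist_eq_norm, add_sub_cancel_left, norm_smul τ, Real.norm_of_nonneg hτ.le,
    Real.norm_eq_abs] at h1
  have h2 : |τ⁻¹ * (u (z + τ • (-(1 / 2 : ℝ) • ∇ u z)) - u z)| ≤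
      L * ‖-(1 / 2 : ℝ) • ∇ u z‖ := by
    rw [abs_mul, abs_of_pos (inv_pos.2 hτ), inv_mul_le_iff₀ hτ]
    linarith
  refine (abs_add_le _ _).trans ?_
  rw [abs_of_nonneg (sq_nonneg ‖_‖)]
  nlinarith [norm_nonneg (-(1 / 2 : ℝ) • ∇ u z), L.2]

/-- The velocity `w = -∇u / 2` minimizes `⟨∇u, w⟩ + ‖w‖²`, with minimum `-½ ‖∇u‖² + ¼ ‖∇u‖²`. This
is the Hamilton–Jacobi equation of the cost, of which only the upper inequality is needed. -/
lemma tendsto_hopfLaxSlope {u : Rd d → ℝ} {z : Rd d} (hz : DifferentiableAt ℝ u z) :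
    Tendsto (fun τ => hopfLaxSlope u τ z) (𝓝[>] 0) (𝓝 (-(1 / 4) * ‖∇ u z‖ ^ 2)) := by
  have h1 := (hz.hasFDerivAt.hasLineDerivAt (-(1 / 2 : ℝ) • ∇ u z)).tendsto_slope_zero_right
  refine (h1.add_const (‖-(1 / 2 : ℝ) • ∇ u z‖ ^ 2)).trans_eq ?_
  congr 1
  have h2 : fderiv ℝ u z (∇ u z) = ‖∇ u z‖ ^ 2 := by
    rw [← real_inner_self_eq_norm_sq]
    exact (InnerProductSpace.toDual_symm_apply).symm
  rw [map_smul, h2, norm_smul, norm_neg, Real.norm_of_nonneg (by norm_num), smul_eq_mul]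
  ring

lemma W2_le_ofReal {μ ν : Measure (Rd d)} [IsProbabilityMeasure μ] [IsProbabilityMeasure ν] {K : ℝ}
    (hK : 0 ≤ K) (h : ∀ φ ψ : Rd d → ℝ, IsBddLip φ → IsBddLip ψ →
      (∀ x y, φ x + ψ y ≤ ‖x - y‖ ^ 2) → ∫ x, φ x ∂μ + ∫ y, ψ y ∂ν ≤ K ^ 2) :
    W2 μ ν ≤ ENNReal.ofReal K := by
  obtain ⟨γ, hγ, hle⟩ := exists_coupling_of_dual_le h
  have h1 : (⨅ γ ∈ couplings μ ν, ∫⁻ z, edist z.1 z.2 ^ 2 ∂γ) ≤ ENNReal.ofReal K ^ 2 := by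
    rw [← ENNReal.ofReal_pow hK]
    exact (iInf₂_le γ hγ).trans hle
  refine (ENNReal.rpow_le_rpow h1 (by norm_num)).trans_eq ?_
  rw [← ENNReal.rpow_natCast, ← ENNReal.rpow_mul]
  norm_num

namespace IsConfining

variable {V : Rd d → ℝ}

variable (hV : IsConfining V) (hV1 : ContDiff ℝ 1 V)
  (hgrad : ∃ α > 0, ∃ R > 0, ∀ x : Rd d, R < ‖x‖ → α * ‖x‖ ^ 2 ≤ inner ℝ (∇ V x) x)

include hV hV1 hgrad

/-- The integral of `hopfLax g s` is followed while the inverse temperature moves linearly from `b`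
to `b'`. The semigroup loses `¼ ∫ ‖∇u‖²`, the moving measure gains at most `K |b' - b| (∫
‖∇u‖²)^(1/2)`, and completing the square leaves `K² (b' - b)²`. -/
lemma integral_hopfLax_le {b b' b₁ K : ℝ} (hb : b ∈ Icc 1 b₁) (hb' : b' ∈ Icc 1 b₁)
    (hK : ∀ c ∈ Icc 1 b₁, ‖(gibbsPotential V c).snd‖ ≤ K) {g : Rd d → ℝ} (hg : IsBddLip g) :
    ∫ x, hopfLax g 1 x ∂gibbsMeasure V b' ≤
      ∫ x, g x ∂gibbsMeasure V b + K ^ 2 * (b' - b) ^ 2 := by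
  obtain ⟨⟨L, hL⟩, M, hM⟩ := id hg
  let c : ℝ → ℝ := fun s => b + s * (b' - b)
  have hc : ∀ s ∈ Icc (0 : ℝ) 1, c s ∈ Icc 1 b₁ := fun s hs => by
    have : c s = (1 - s) • b + s • b' := by simp only [c, smul_eq_mul]; ring
    rw [this]
    exact (convex_Icc 1 b₁) hb hb' (by linarith [hs.2]) hs.1 (by ring)
  have hc' : ∀ s, HasDerivAt c (b' - b) s := fun s =>
    (((hasDerivAt_id s).mul_const (b' - b)).const_add b).congr_deriv (one_mul _)
  let Φ : ℝ → ℝ := fun s => ∫ x, hopfLax g s x ∂gibbsMeasure V (c s)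
  have hΦc : ContinuousOn Φ (Icc 0 1) := by
    intro s hs
    refine hV.tendsto_integral_gibbs (M := M) (zero_lt_one.trans_le (hc s hs).1)
      (eventually_nhdsWithin_of_forall hc) (hc' s).continuousAt.continuousWithinAt
      (fun t => (isBddLip_hopfLax hg t).continuous.aestronglyMeasurable)
      (Eventually.of_forall fun t => ae_of_all _ (abs_hopfLax_le hM t)) (ae_of_all _ fun x => ?_)
    rw [tendsto_iff_dist_tendsto_zero]
    have h1 : Tendsto (fun t => (L : ℝ) ^ 2 * |t - s|) (𝓝[Icc 0 1] s) (𝓝 0) := by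
      have : Continuous fun t => (L : ℝ) ^ 2 * |t - s| := by fun_prop
      simpa using (this.tendsto s).mono_left nhdsWithin_le_nhds
    refine squeeze_zero' (Eventually.of_forall fun _ => dist_nonneg) ?_ h1
    filter_upwards [self_mem_nhdsWithin] with t ht
    exact abs_hopfLax_sub_le hM hL hs.1 ht.1 x
  -- An upper bound on right slopes suffices, so the Hopf–Lax function need not be differentiable in
  -- time. With `u` frozen at time `s`, the slope splits into the semigroup part `h1` and the
  -- measure part `h2`.
  have hbound : ∀ s ∈ Ico (0 : ℝ) 1, ∀ r, K ^ 2 * (b' - b) ^ 2 < r →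
      ∃ᶠ z in 𝓝[>] s, slope Φ s z < r := by
    intro s hs r hr
    have hcs := hc s ⟨hs.1, hs.2.le⟩
    have hcs0 : 0 < c s := zero_lt_one.trans_le hcs.1
    set u := hopfLax g s
    have hu : IsBddLip u := isBddLip_hopfLax hg s
    have huL : LipschitzWith L u := lipschitzWith_hopfLax hM hL s
    have hev : ∀ᶠ z in 𝓝[>] s, z ∈ Ioo s 1 := Ioo_mem_nhdsGT hs.2
    have hshift : Tendsto (fun z => z - s) (𝓝[>] s) (𝓝[>] 0) := by
      refine tendsto_nhdsWithin_iff.2 ⟨?_, eventually_nhdsWithin_of_forall fun z hz =>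
        mem_Ioi.2 (sub_pos.2 hz)⟩
      have : Continuous fun z => z - s := by fun_prop
      simpa using (this.tendsto s).mono_left nhdsWithin_le_nhds
    have h1 : Tendsto (fun z => ∫ x, hopfLaxSlope u (z - s) x ∂gibbsMeasure V (c z)) (𝓝[>] s)
        (𝓝 (∫ x, -(1 / 4) * ‖∇ u x‖ ^ 2 ∂gibbsMeasure V (c s))) := by
      refine hV.tendsto_integral_gibbs (M := L ^ 2) hcs0
        (hev.mono fun z hz => hc z ⟨hs.1.trans hz.1.le, hz.2.le⟩)
        ((hc' s).continuousAt.tendsto.mono_left nhdsWithin_le_nhds)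
        (fun z => (measurable_hopfLaxSlope hu.continuous _).aestronglyMeasurable)
        (hev.mono fun z hz => ae_of_all _ (abs_hopfLaxSlope_le huL (sub_pos.2 hz.1))) ?_
      filter_upwards [huL.ae_differentiableAt] with x hx
      exact (tendsto_hopfLaxSlope hx).comp hshift
    obtain ⟨Mu, hMu⟩ := hu.2
    have h2 := ((hV.hasDerivAt_integral_gibbs hcs0 hu.continuous.aestronglyMeasurable hMu).comp s
      (hc' s)).hasDerivWithinAt (s := Ioi s)
    rw [hasDerivWithinAt_iff_tendsto_slope' self_notMem_Ioi] at h2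
    have h3 := hV.abs_integral_mul_centered_le hV1 hgrad hcs.1 hu
    set I := ∫ x, ‖∇ u x‖ ^ 2 ∂gibbsMeasure V (c s)
    set J := ∫ x, u x * (V x - gibbsMean V (c s)) ∂gibbsMeasure V (c s)
    have hI : 0 ≤ I := integral_nonneg fun x => sq_nonneg _
    have h4 : -(1 / 4) * I + -J * (b' - b) < r := by
      have h5 : |J| ≤ K * √I := h3.trans (mul_le_mul_of_nonneg_right (hK _ hcs) (Real.sqrt_nonneg _))
      have h6 : -J * (b' - b) ≤ K * √I * |b' - b| := by
        refine (le_abs_self _).trans ?_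
        rw [abs_mul, abs_neg]
        exact mul_le_mul_of_nonneg_right h5 (abs_nonneg _)
      have h7 := sq_nonneg (1 / 2 * √I - K * |b' - b|)
      have h8 := Real.sq_sqrt hI
      have h9 := sq_abs (b' - b)
      nlinarith
    rw [integral_const_mul] at h1
    have h5 := (h1.add h2).eventually (gt_mem_nhds h4)
    refine Eventually.frequently ?_
    filter_upwards [h5, hev] with z hz hzs
    refine lt_of_le_of_lt ?_ hz
    have hcz := hc z ⟨hs.1.trans hzs.1.le, hzs.2.le⟩
    have := hV.isProbabilityMeasure (zero_lt_one.trans_le hcz.1)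
    have hzs' : 0 < z - s := sub_pos.2 hzs.1
    have hint : Integrable (hopfLaxSlope u (z - s)) (gibbsMeasure V (c z)) :=
      Integrable.of_bound (measurable_hopfLaxSlope hu.continuous _).aestronglyMeasurable (L ^ 2)
        (ae_of_all _ (abs_hopfLaxSlope_le huL hzs'))
    have h6 : Φ z ≤ ∫ x, u x ∂gibbsMeasure V (c z) +
        (z - s) * ∫ x, hopfLaxSlope u (z - s) x ∂gibbsMeasure V (c z) := by
      rw [← integral_const_mul, ← integral_add (hu.integrable _) (hint.const_mul _)]
      refine integral_mono ((isBddLip_hopfLax hg z).integrable _)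
        ((hu.integrable _).add (hint.const_mul _)) fun x => ?_
      have := hopfLax_sub_div_le hM hs.1 hzs' x
      rwa [add_sub_cancel] at this
    rw [slope_def_field, slope_def_field, div_le_iff₀ hzs', add_mul, div_mul_cancel₀ _ hzs'.ne']
    simp only [Function.comp_apply]
    change Φ z - ∫ x, u x ∂gibbsMeasure V (c s) ≤ _
    linarith
  have h := image_le_of_liminf_slope_right_le_deriv_boundary hΦc
    (B := fun s => Φ 0 + K ^ 2 * (b' - b) ^ 2 * s) (B' := fun _ => K ^ 2 * (b' - b) ^ 2)
    (by simp) (by fun_prop)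
    (fun x _ => by
      simpa using (((hasDerivAt_id x).const_mul (K ^ 2 * (b' - b) ^ 2)).const_add
        (Φ 0)).hasDerivWithinAt) hbound (right_mem_Icc.2 zero_le_one)
  simpa [Φ, c, hopfLax_zero] using h

/-- For an admissible pair, `ψ` lies below `hopfLax (-φ) 1`, so the dual problem reduces to
`integral_hopfLax_le` with `g = -φ`. -/
lemma W2_gibbsMeasure_le {b b' b₁ K : ℝ} (hb : b ∈ Icc 1 b₁) (hb' : b' ∈ Icc 1 b₁)
    (hK : ∀ c ∈ Icc 1 b₁, ‖(gibbsPotential V c).snd‖ ≤ K) :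
    W2 (gibbsMeasure V b) (gibbsMeasure V b') ≤ ENNReal.ofReal (K * |b' - b|) := by
  have := hV.isProbabilityMeasure (zero_lt_one.trans_le hb.1)
  have := hV.isProbabilityMeasure (zero_lt_one.trans_le hb'.1)
  have hK0 : 0 ≤ K := (norm_nonneg _).trans (hK b hb)
  refine W2_le_ofReal (by positivity) fun φ ψ hφ hψ hle => ?_
  rw [mul_pow, sq_abs]
  have h1 := hV.integral_hopfLax_le hV1 hgrad hb hb' hK hφ.neg
  have h2 : ∫ y, ψ y ∂gibbsMeasure V b' ≤
      ∫ y, hopfLax (fun x => -φ x) 1 y ∂gibbsMeasure V b' := by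
    refine integral_mono (hψ.integrable _) ((isBddLip_hopfLax hφ.neg 1).integrable _) fun y => ?_
    refine le_hopfLax zero_lt_one fun x => ?_
    rw [div_one, norm_sub_rev]
    linarith [hle x y]
  rw [integral_neg] at h1
  linarith

end IsConfining

/-! ### The metric derivative -/

lemma AbsolutelyContinuousOnInterval.of_dist_le {f g : ℝ → ℝ} {a b : ℝ}
    (hg : AbsolutelyContinuousOnInterval g a b)
    (h : ∀ x ∈ uIcc a b, ∀ y ∈ uIcc a b, dist (f x) (f y) ≤ dist (g x) (g y)) :
    AbsolutelyContinuousOnInterval f a b := by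
  rw [absolutelyContinuousOnInterval_iff] at hg ⊢
  intro ε hε
  obtain ⟨δ, hδ, H⟩ := hg ε hε
  refine ⟨δ, hδ, fun E hE hlt => lt_of_le_of_lt ?_ (H E hE hlt)⟩
  exact Finset.sum_le_sum fun i hi => h _ (hE.1 i hi).1 _ (hE.1 i hi).2

lemma HasDerivAt.tendsto_abs_slope_zero {g : ℝ → ℝ} {g' t : ℝ} (h : HasDerivAt g g' t) :
    Tendsto (fun x => |g (t + x) - g t| / |x|) (𝓝[≠] 0) (𝓝 |g'|) := by
  refine (hasDerivAt_iff_tendsto_slope_zero.1 h).abs.congr fun x => ?_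
  rw [smul_eq_mul, abs_mul, abs_inv, div_eq_inv_mul]

section

variable {D : ℝ → ℝ → ℝ} {T : ℝ} {k : ℝ → ℝ}

/-- A curve in a metric space whose distances `D s t` are bounded by integrals has a metric
derivative almost everywhere. -/
lemma exists_metricDeriv (hT : 0 < T) (hk : Integrable k)
    (hsymm : ∀ s t, D s t = D t s)
    (htri : ∀ r ∈ Ico 0 T, ∀ s ∈ Ico 0 T, ∀ t ∈ Ico 0 T, D r t ≤ D r s + D s t)
    (hD : ∀ s ∈ Ico 0 T, ∀ t ∈ Ico 0 T, s ≤ t → D s t ≤ ∫ r in s..t, k r) :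
    ∃ m : ℝ → ℝ, IntegrableOn m (Ico 0 T) ∧
      (∀ᵐ t ∂volume.restrict (Ico 0 T),
        Tendsto (fun h => D t (t + h) / |h|) (𝓝[≠] 0) (𝓝 (m t))) ∧
      ∀ s ∈ Ico 0 T, ∀ t ∈ Ico 0 T, s ≤ t → D s t ≤ ∫ r in s..t, m r := by
  let F : ℝ → ℝ := fun t => ∫ r in (0 : ℝ)..t, k r
  have hFsub : ∀ s t, F t - F s = ∫ r in s..t, k r := fun s t =>
    intervalIntegral.integral_interval_sub_left hk.intervalIntegrable hk.intervalIntegrable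
  have hFc : Continuous F := intervalIntegral.continuous_primitive
    (fun _ _ => hk.intervalIntegrable) 0
  have hDF : ∀ s ∈ Ico 0 T, ∀ t ∈ Ico 0 T, D s t ≤ |F t - F s| := by
    intro s hs t ht
    rcases le_total s t with hst | hst
    · exact (hD s hs t ht hst).trans ((hFsub s t).symm.trans_le (le_abs_self _))
    · rw [hsymm, abs_sub_comm]
      exact (hD t ht s hs hst).trans ((hFsub t s).symm.trans_le (le_abs_self _))
  let ι := {q : ℚ // (q : ℝ) ∈ Ico 0 T}
  have hι : ∀ s ∈ Ico 0 T, ∀ ε > 0, ∃ q : ι, D (q.1 : ℝ) s < ε := by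
    intro s hs ε hε
    have h1 : ∀ᶠ x in 𝓝[>] s, |F s - F x| < ε := by
      have : Continuous fun x => |F s - F x| := by fun_prop
      refine ((this.tendsto s).mono_left nhdsWithin_le_nhds).eventually (gt_mem_nhds ?_)
      simpa using hε
    obtain ⟨u, hu, hsub⟩ := (mem_nhdsGT_iff_exists_Ioo_subset' hs.2).1
      (h1.and (Ioo_mem_nhdsGT hs.2))
    obtain ⟨q, hq1, hq2⟩ := exists_rat_btwn (show s < u from hu)
    have hq := hsub ⟨hq1, hq2⟩
    have hqI : (q : ℝ) ∈ Ico 0 T := ⟨hs.1.trans hq.2.1.le, hq.2.2⟩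
    exact ⟨⟨q, hqI⟩, (hDF _ hqI s hs).trans_lt hq.1⟩
  -- Distances to a countable family of points, dense along the curve, turn the metric problem into
  -- one about absolutely continuous real functions.
  let f : ι → ℝ → ℝ := fun q t => D q.1 t
  have hfD : ∀ q, ∀ s ∈ Ico 0 T, ∀ t ∈ Ico 0 T, |f q t - f q s| ≤ D s t := by
    intro q s hs t ht
    have h1 := htri q.1 q.2 s hs t ht
    have h2 := htri q.1 q.2 t ht s hs
    rw [hsymm t s] at h2
    exact abs_le.2 ⟨by simp only [f]; linarith, by simp only [f]; linarith⟩
  have hfAC : ∀ q, ∀ s ∈ Ico 0 T, ∀ t ∈ Ico 0 T, AbsolutelyContinuousOnInterval (f q) s t := by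
    intro q s hs t ht
    have hsub : uIcc s t ⊆ Ico 0 T := ordConnected_Ico.uIcc_subset hs ht
    have h1 := (hk.intervalIntegrable (a := s) (b := t)).absolutelyContinuousOnInterval_intervalIntegral
      (c := s) left_mem_uIcc
    refine h1.of_dist_le fun x hx y hy => ?_
    rw [Real.dist_eq, Real.dist_eq, intervalIntegral.integral_interval_sub_left
      hk.intervalIntegrable hk.intervalIntegrable, ← hFsub]
    exact (hfD q y (hsub hy) x (hsub hx)).trans (hDF y (hsub hy) x (hsub hx))
  have h0 : (0 : ℝ) ∈ Ico 0 T := ⟨le_rfl, hT⟩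
  have hdiff : ∀ᵐ t : ℝ, t ∈ Ioo 0 T → ∀ q, DifferentiableAt ℝ (f q) t := by
    have h1 : ∀ᵐ t : ℝ, ∀ q q' : ι, t ∈ uIcc (0 : ℝ) q'.1 → DifferentiableAt ℝ (f q) t :=
      ae_all_iff.2 fun q => ae_all_iff.2 fun q' => (hfAC q 0 h0 q'.1 q'.2).ae_differentiableAt
    filter_upwards [h1] with t ht htI q
    obtain ⟨q', hq1, hq2⟩ := exists_rat_btwn htI.2
    refine ht q ⟨q', htI.1.le.trans hq1.le, hq2⟩ ?_
    rw [uIcc_of_le (htI.1.le.trans hq1.le)]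
    exact ⟨htI.1.le, hq1.le⟩
  have hmem : ∀ t ∈ Ioo 0 T, ∀ᶠ h : ℝ in 𝓝[≠] 0, t + h ∈ Ico 0 T := by
    intro t ht
    have : Continuous fun h : ℝ => t + h := by fun_prop
    refine ((this.tendsto 0).mono_left nhdsWithin_le_nhds).eventually ?_
    rw [add_zero]
    exact Ico_mem_nhds ht.1 ht.2
  have hder : ∀ᵐ t : ℝ, t ∈ Ioo 0 T → ∀ q, |deriv (f q) t| ≤ |k t| := by
    filter_upwards [hdiff, LocallyIntegrable.ae_hasDerivAt_integral hk.locallyIntegrable]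
      with t ht1 ht2 htI q
    refine le_of_tendsto_of_tendsto (ht1 htI q).hasDerivAt.tendsto_abs_slope_zero
      (ht2 0).tendsto_abs_slope_zero ?_
    filter_upwards [hmem t htI] with h hh
    exact div_le_div_of_nonneg_right ((hfD q t ⟨htI.1.le, htI.2⟩ _ hh).trans
      (hDF t ⟨htI.1.le, htI.2⟩ _ hh)) (abs_nonneg _)
  -- The metric derivative is the supremum of the speeds `|deriv (f q)|`; countability makes it
  -- measurable, and `|k|` dominates it almost everywhere on the interval.
  let m : ℝ → ℝ := (Ioo 0 T).indicator fun t => ⨆ q, |deriv (f q) t|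
  have hm0 : ∀ t, 0 ≤ m t := fun t =>
    indicator_nonneg (fun t _ => Real.iSup_nonneg fun q => abs_nonneg _) t
  have hmeas : Measurable m :=
    (Measurable.iSup fun q => (measurable_deriv (f q)).abs).indicator measurableSet_Ioo
  obtain ⟨q₀, -⟩ := hι 0 h0 1 one_pos
  have : Nonempty ι := ⟨q₀⟩
  have hm : Integrable m := by
    refine hk.abs.mono' hmeas.aestronglyMeasurable ?_
    filter_upwards [hder] with t ht
    rw [Real.norm_of_nonneg (hm0 t)]
    by_cases htI : t ∈ Ioo 0 T
    · simp only [m, indicator_of_mem htI]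
      exact ciSup_le (ht htI)
    · simp only [m, indicator_of_notMem htI]
      exact abs_nonneg _
  have hle : ∀ᵐ t : ℝ, t ∈ Ioo 0 T → ∀ q, |deriv (f q) t| ≤ m t := by
    filter_upwards [hder] with t ht htI q
    simp only [m, indicator_of_mem htI]
    exact le_ciSup (f := fun q => |deriv (f q) t|) ⟨|k t|, by
      rintro _ ⟨q, rfl⟩
      exact ht htI q⟩ q
  have hDm : ∀ s ∈ Ico 0 T, ∀ t ∈ Ico 0 T, s ≤ t → D s t ≤ ∫ r in s..t, m r := by
    intro s hs t ht hst
    refine le_of_forall_pos_le_add fun ε hε => ?_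
    -- With `D q s < ε / 2`, the triangle inequality through `q` costs `ε / 2` twice: `D s t ≤ D s q
    -- + D q t`, and `D q t ≤ D q s + ∫ m`.
    obtain ⟨q, hq⟩ := hι s hs (ε / 2) (half_pos hε)
    have h1 : f q t - f q s ≤ ∫ r in s..t, m r := by
      rw [← (hfAC q s hs t ht).integral_deriv_eq_sub]
      refine intervalIntegral.integral_mono_ae_restrict hst
        (hfAC q s hs t ht).intervalIntegrable_deriv hm.intervalIntegrable ?_
      rw [← restrict_Ioo_eq_restrict_Icc]
      filter_upwards [ae_restrict_of_ae hle, ae_restrict_mem measurableSet_Ioo] with r hr hrI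
      exact (le_abs_self _).trans (hr ⟨hs.1.trans_lt hrI.1, hrI.2.trans ht.2⟩ q)
    have h2 := htri s hs q.1 q.2 t ht
    rw [hsymm s q.1] at h2
    simp only [f] at h1
    linarith
  refine ⟨m, hm.integrableOn, ?_, hDm⟩
  rw [← restrict_Ioo_eq_restrict_Ico, ae_restrict_iff' measurableSet_Ioo]
  filter_upwards [hdiff, hder, LocallyIntegrable.ae_hasDerivAt_integral hm.locallyIntegrable]
    with t ht1 ht2 ht3 htI
  have htI' : t ∈ Ico 0 T := ⟨htI.1.le, htI.2⟩
  -- From below, a single `f q` already has speed above `c`. From above, `D ≤ ∫ m` and Lebesgue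
  -- differentiation of the integral apply.
  refine tendsto_order.2 ⟨fun c hc => ?_, fun c hc => ?_⟩
  · simp only [m, indicator_of_mem htI] at hc
    obtain ⟨q, hq⟩ := exists_lt_of_lt_ciSup hc
    filter_upwards [(ht1 htI q).hasDerivAt.tendsto_abs_slope_zero.eventually (lt_mem_nhds hq),
      hmem t htI] with h h1 h2
    exact h1.trans_le (div_le_div_of_nonneg_right (hfD q t htI' _ h2) (abs_nonneg _))
  · have h1 := (ht3 0).tendsto_abs_slope_zero
    rw [abs_of_nonneg (hm0 t)] at h1
    filter_upwards [h1.eventually (gt_mem_nhds hc), hmem t htI] with h h1 h2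
    refine lt_of_le_of_lt (div_le_div_of_nonneg_right ?_ (abs_nonneg _)) h1
    rw [intervalIntegral.integral_interval_sub_left hm.intervalIntegrable hm.intervalIntegrable]
    rcases le_total t (t + h) with hth | hth
    · exact (hDm t htI' _ h2 hth).trans (le_abs_self _)
    · rw [hsymm, intervalIntegral.integral_symm, abs_neg]
      exact (hDm _ h2 t htI' hth).trans (le_abs_self _)

end

/-! ### Symmetry and the triangle inequality for the Wasserstein distance -/

lemma W2_comm (μ ν : Measure (Rd d)) : W2 μ ν = W2 ν μ := by
  have key : ∀ μ ν : Measure (Rd d), (⨅ γ ∈ couplings μ ν, ∫⁻ z, edist z.1 z.2 ^ 2 ∂γ) ≤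
      ⨅ γ ∈ couplings ν μ, ∫⁻ z, edist z.1 z.2 ^ 2 ∂γ := by
    refine fun μ ν => le_iInf₂ fun γ hγ => ?_
    refine (iInf₂_le (γ.map Prod.swap) ⟨?_, ?_⟩).trans_eq ?_
    · rw [lintegral_map (by fun_prop) measurable_swap]
      simp only [Prod.fst_swap, Prod.snd_swap, edist_comm]
    · rw [Measure.fst_map_swap]; exact hγ.2
    · rw [Measure.snd_map_swap]; exact hγ.1
  rw [W2, W2, le_antisymm (key μ ν) (key ν μ)]

lemma exists_coupling_of_W2_lt {μ ν : Measure (Rd d)} {a : ℝ} (h : W2 μ ν < ENNReal.ofReal a) :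
    ∃ γ ∈ couplings μ ν, ∫⁻ z, edist z.1 z.2 ^ 2 ∂γ < ENNReal.ofReal (a ^ 2) := by
  have ha : 0 ≤ a := by
    by_contra! h'
    rw [ENNReal.ofReal_of_nonpos h'.le] at h
    exact not_lt_zero h
  have h1 : (⨅ γ ∈ couplings μ ν, ∫⁻ z, edist z.1 z.2 ^ 2 ∂γ) < ENNReal.ofReal (a ^ 2) := by
    have h2 := ENNReal.rpow_lt_rpow h (z := 2) (by norm_num)
    rw [W2, ← ENNReal.rpow_mul] at h2
    rw [ENNReal.ofReal_pow ha]
    norm_num at h2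
    exact h2
  simpa only [iInf_lt_iff, exists_prop] using h1

/-- Weak duality for the cost `‖x - y‖² / r`. -/
lemma integral_sub_le_of_W2_lt {μ ν : Measure (Rd d)} [IsProbabilityMeasure μ]
    [IsProbabilityMeasure ν] {a r : ℝ} (hr : 0 < r) (h : W2 μ ν < ENNReal.ofReal a)
    {φ ψ : Rd d → ℝ} (hφ : IsBddLip φ) (hψ : IsBddLip ψ)
    (hle : ∀ x y, ψ y ≤ φ x + ‖x - y‖ ^ 2 / r) :
    ∫ y, ψ y ∂ν ≤ ∫ x, φ x ∂μ + a ^ 2 / r := by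
  obtain ⟨γ, ⟨h1, h2⟩, hγ⟩ := exists_coupling_of_W2_lt h
  have hint : ∫⁻ z, ENNReal.ofReal (‖z.1 - z.2‖ ^ 2) ∂γ < ENNReal.ofReal (a ^ 2) := by
    simpa only [edist_dist, dist_eq_norm, ENNReal.ofReal_pow (norm_nonneg _)] using hγ
  have hm : AEStronglyMeasurable (fun z : Rd d × Rd d => ‖z.1 - z.2‖ ^ 2) γ := by fun_prop
  have hI : Integrable (fun z : Rd d × Rd d => ‖z.1 - z.2‖ ^ 2) γ := by
    refine ⟨hm, ?_⟩
    rw [hasFiniteIntegral_iff_ofReal (ae_of_all _ fun z => sq_nonneg _)]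
    exact hint.trans ENNReal.ofReal_lt_top
  have hle2 : ∫ z, ‖z.1 - z.2‖ ^ 2 ∂γ ≤ a ^ 2 := by
    rw [integral_eq_lintegral_of_nonneg_ae (ae_of_all _ fun z => sq_nonneg _) hm]
    exact ENNReal.toReal_le_of_le_ofReal (sq_nonneg a) hint.le
  have hφi : Integrable (fun z : Rd d × Rd d => φ z.1) γ :=
    (h1 ▸ hφ.integrable μ : Integrable φ γ.fst).comp_measurable measurable_fst
  have hψi : Integrable (fun z : Rd d × Rd d => ψ z.2) γ :=
    (h2 ▸ hψ.integrable ν : Integrable ψ γ.snd).comp_measurable measurable_snd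
  have hφe : ∫ z, φ z.1 ∂γ = ∫ x, φ x ∂μ := by
    rw [← h1, Measure.fst, integral_map measurable_fst.aemeasurable
      hφ.continuous.aestronglyMeasurable]
  have hψe : ∫ z, ψ z.2 ∂γ = ∫ x, ψ x ∂ν := by
    rw [← h2, Measure.snd, integral_map measurable_snd.aemeasurable
      hψ.continuous.aestronglyMeasurable]
  rw [← hφe, ← hψe]
  calc ∫ z, ψ z.2 ∂γ ≤ ∫ z, (φ z.1 + ‖z.1 - z.2‖ ^ 2 / r) ∂γ :=
        integral_mono hψi (hφi.add (hI.div_const r)) fun z => hle z.1 z.2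
    _ = ∫ z, φ z.1 ∂γ + (∫ z, ‖z.1 - z.2‖ ^ 2 ∂γ) / r := by
        rw [integral_add hφi (hI.div_const r), integral_div]
    _ ≤ _ := by gcongr

/-- The intermediate potential is `hopfLax (-φ) r`: weak duality is used on `μ, ρ` for the cost over
time `r` and on `ρ, ν` over time `1 - r`, and strong duality turns the sum into a coupling of `μ`
and `ν`. -/
lemma W2_triangle (μ ρ ν : Measure (Rd d)) [IsProbabilityMeasure μ] [IsProbabilityMeasure ρ]
    [IsProbabilityMeasure ν] : W2 μ ν ≤ W2 μ ρ + W2 ρ ν := by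
  by_cases hfin : W2 μ ρ = ⊤ ∨ W2 ρ ν = ⊤
  · rcases hfin with h | h <;> simp [h]
  push Not at hfin
  refine ENNReal.le_of_forall_pos_le_add fun ε hε _ => ?_
  set a : ℝ := (W2 μ ρ).toReal + ε / 2
  set b : ℝ := (W2 ρ ν).toReal + ε / 2
  have hε' : (0 : ℝ) < ε / 2 := half_pos (NNReal.coe_pos.2 hε)
  have ha : 0 < a := add_pos_of_nonneg_of_pos ENNReal.toReal_nonneg hε'
  have hb : 0 < b := add_pos_of_nonneg_of_pos ENNReal.toReal_nonneg hε'
  have h1 : W2 μ ρ < ENNReal.ofReal a := by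
    rw [ENNReal.lt_ofReal_iff_toReal_lt hfin.1]
    exact lt_add_of_pos_right _ hε'
  have h2 : W2 ρ ν < ENNReal.ofReal b := by
    rw [ENNReal.lt_ofReal_iff_toReal_lt hfin.2]
    exact lt_add_of_pos_right _ hε'
  have hab : W2 μ ρ + W2 ρ ν + ε = ENNReal.ofReal (a + b) := by
    have : a + b = (W2 μ ρ).toReal + (W2 ρ ν).toReal + ε := by simp only [a, b]; ring
    rw [this, ENNReal.ofReal_add (by positivity) (by positivity), ENNReal.ofReal_add (by positivity)
      (by positivity), ENNReal.ofReal_toReal hfin.1, ENNReal.ofReal_toReal hfin.2,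
      ENNReal.ofReal_coe_nnreal]
  rw [hab]
  refine W2_le_ofReal (by positivity) fun φ ψ hφ hψ hle => ?_
  obtain ⟨M, hM⟩ := hφ.neg.2
  -- Splitting unit time in proportion to the distances gives `a² / r + b² / (1 - r) = (a + b)²`.
  have hr : 0 < a / (a + b) := by positivity
  have hr' : 0 < b / (a + b) := by positivity
  have hsum : a / (a + b) + b / (a + b) = 1 := by field_simp
  have h3 := integral_sub_le_of_W2_lt hr h1 hφ.neg (isBddLip_hopfLax hφ.neg (a / (a + b)))
    fun x y => by rw [norm_sub_rev]; exact hopfLax_le hM hr x y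
  have h4 := integral_sub_le_of_W2_lt hr' h2 (isBddLip_hopfLax hφ.neg (a / (a + b))) hψ
    fun y z => by
      have h5 := hopfLax_add_le hM hr.le hr' y z
      rw [hsum, norm_sub_rev] at h5
      refine le_trans ?_ h5
      refine le_hopfLax zero_lt_one fun x => ?_
      rw [div_one, norm_sub_rev]
      linarith [hle x z]
  rw [integral_neg] at h3
  have h5 : a ^ 2 / (a / (a + b)) = a * (a + b) := by field_simp
  have h6 : b ^ 2 / (b / (a + b)) = b * (a + b) := by field_simp
  rw [h5] at h3
  rw [h6] at h4
  nlinarith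

/-! ### The main theorem -/

lemma IsConfining.isACCurveW2_gibbsMeasure {V : Rd d → ℝ} (hV : IsConfining V)
    (hV1 : ContDiff ℝ 1 V)
    (hgrad : ∃ α > 0, ∃ R > 0, ∀ x : Rd d, R < ‖x‖ → α * ‖x‖ ^ 2 ≤ inner ℝ (∇ V x) x)
    {β : ℝ → ℝ} {T b₁ : ℝ} (hT : 0 < T) (hβ : ∀ t ∈ Ico 0 T, β t ∈ Icc 1 b₁)
    (hd : DifferentiableOn ℝ β (Ico 0 T))
    (hi : IntegrableOn (derivWithin β (Ico 0 T)) (Ico 0 T)) :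
    IsACCurveW2 (Ico 0 T) (fun t => gibbsMeasure V (β t)) := by
  obtain ⟨K, hK0, hK⟩ := hV.exists_norm_potential_le hV1 hgrad b₁
  have hb0 : ∀ t ∈ Ico 0 T, 0 < β t := fun t ht => zero_lt_one.trans_le (hβ t ht).1
  have hW : ∀ s ∈ Ico 0 T, ∀ t ∈ Ico 0 T,
      W2 (gibbsMeasure V (β s)) (gibbsMeasure V (β t)) ≤ ENNReal.ofReal (K * |β t - β s|) :=
    fun s hs t ht => hV.W2_gibbsMeasure_le hV1 hgrad (hβ s hs) (hβ t ht) hK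
  have hfin : ∀ s ∈ Ico 0 T, ∀ t ∈ Ico 0 T,
      W2 (gibbsMeasure V (β s)) (gibbsMeasure V (β t)) ≠ ⊤ :=
    fun s hs t ht => ((hW s hs t ht).trans_lt ENNReal.ofReal_lt_top).ne
  refine ⟨fun t ht => hV.isP2_gibbs (hb0 t ht), ?_⟩
  obtain ⟨m, hm1, hm2, hm3⟩ : ∃ m : ℝ → ℝ, IntegrableOn m (Ico 0 T) ∧
      (∀ᵐ t ∂volume.restrict (Ico 0 T), Tendsto (fun h => (W2 (gibbsMeasure V (β t))
        (gibbsMeasure V (β (t + h)))).toReal / |h|) (𝓝[≠] 0) (𝓝 (m t))) ∧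
      ∀ s ∈ Ico 0 T, ∀ t ∈ Ico 0 T, s ≤ t →
        (W2 (gibbsMeasure V (β s)) (gibbsMeasure V (β t))).toReal ≤ ∫ r in s..t, m r := by
    refine exists_metricDeriv
      (D := fun s t => (W2 (gibbsMeasure V (β s)) (gibbsMeasure V (β t))).toReal)
      (k := (Ico 0 T).indicator fun t => K * |derivWithin β (Ico 0 T) t|) hT
      (IntegrableOn.integrable_indicator (hi.abs.const_mul K) measurableSet_Ico)
      (fun s t => by rw [W2_comm]) ?_ ?_
    · intro r hr s hs t ht
      have := hV.isProbabilityMeasure (hb0 r hr)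
      have := hV.isProbabilityMeasure (hb0 s hs)
      have := hV.isProbabilityMeasure (hb0 t ht)
      rw [← ENNReal.toReal_add (hfin r hr s hs) (hfin s hs t ht)]
      exact ENNReal.toReal_mono (ENNReal.add_ne_top.2 ⟨hfin r hr s hs, hfin s hs t ht⟩)
        (W2_triangle _ _ _)
    · intro s hs t ht hst
      refine (ENNReal.toReal_le_of_le_ofReal (by positivity) (hW s hs t ht)).trans ?_
      have h1 : ∫ r in s..t, (Ico 0 T).indicator (fun t => K * |derivWithin β (Ico 0 T) t|) r =
          K * ∫ r in s..t, ‖derivWithin β (Ico 0 T) r‖ := by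
        rw [← intervalIntegral.integral_const_mul]
        refine intervalIntegral.integral_congr fun r hr => ?_
        exact indicator_of_mem (ordConnected_Ico.uIcc_subset hs ht hr) _
      rw [h1, sub_eq_integral_derivWithin hd hi hs ht hst, ← Real.norm_eq_abs]
      exact mul_le_mul_of_nonneg_left (intervalIntegral.norm_integral_le_integral_norm hst) hK0
  refine ⟨m, hm1, hm2, fun s hs t ht hst => ?_⟩
  rw [← ENNReal.ofReal_toReal (hfin s hs t ht)]
  exact ENNReal.ofReal_le_ofReal (hm3 s hs t ht hst)

/-- A continuous function is bounded on the ball where the growth condition says nothing; a constant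
lifts it above `α ‖x‖²` there and preserves the bound outside. -/
lemma exists_isConfining_add_const {U : Rd d → ℝ} (hU : Continuous U)
    (htail : ∃ α > 0, ∃ R > 0, ∀ x : Rd d, R < ‖x‖ → α * ‖x‖ ^ 2 ≤ U x) :
    ∃ c, IsConfining fun x => U x + c := by
  obtain ⟨α, hα, R, hR, h⟩ := htail
  obtain ⟨M, hM⟩ := (isCompact_closedBall (0 : Rd d) R).exists_bound_of_continuousOn hU.continuousOn
  refine ⟨|M| + α * R ^ 2, by fun_prop, α, hα, fun x => ?_⟩
  rcases lt_or_ge R ‖x‖ with hx | hx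
  · have := h x hx
    have : 0 ≤ |M| + α * R ^ 2 := by positivity
    linarith
  · have h1 := hM x (mem_closedBall_zero_iff.2 hx)
    have h2 := neg_le_of_abs_le h1
    have h3 : α * ‖x‖ ^ 2 ≤ α * R ^ 2 := by gcongr
    have h4 := le_abs_self M
    linarith

lemma gibbsDensity_add_const (U : Rd d → ℝ) (c : ℝ) :
    gibbsDensity (fun x => U x + c) = gibbsDensity U := by
  ext b x
  have h : ∀ x, Real.exp (-b * (U x + c)) = Real.exp (-b * c) * Real.exp (-b * U x) := fun x => by
    rw [← Real.exp_add]
    ring_nf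
  simp only [gibbsDensity, h, integral_const_mul]
  exact mul_div_mul_left _ _ (Real.exp_pos _).ne'

end

theorem mainTheorem1 {d : ℕ} (U : Rd d → ℝ) (hU : ContDiff ℝ 1 U)
    (hmin_nonempty : {x : Rd d | ∀ y, U x ≤ U y}.Nonempty)
    (hmin_compact : IsCompact {x : Rd d | ∀ y, U x ≤ U y})
    (htail : ∃ α > 0, ∃ R > 0, ∀ x : Rd d, R < ‖x‖ → α * ‖x‖ ^ 2 ≤ U x)
    (hgrad : ∃ α > 0, ∃ R > 0, ∀ x : Rd d, R < ‖x‖ → α * ‖x‖ ^ 2 ≤ inner ℝ (∇ U x) x)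
    (T : ℝ) (hT : 0 < T) (β : ℝ → ℝ) (hβ_ge : ∀ t ∈ Ico 0 T, 1 ≤ β t)
    (hβ_diff : DifferentiableOn ℝ β (Ico 0 T)) :
    -- the density of the Gibbs curve is differentiable in time
    (∀ t ∈ Ico 0 T, ∀ x : Rd d,
      DifferentiableWithinAt ℝ (fun s => gibbsDensity U (β s) x) (Ico 0 T) t) ∧
    -- `h t` is a pair, the function `(h t).fst` together with its gradient `(h t).snd`
    ∃ h : (t : ℝ) → L2Pair (gibbsMeasure U (β t)),
      (∀ t ∈ Ico 0 T,
        -- existence of a zero-mean `H¹` function whose gradient solves the continuity equation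
        h t ∈ sobolevH1ZeroMean (gibbsMeasure U (β t)) ∧
        HasWeakGradient (h t).fst (h t).snd ∧
        SolvesContinuityEq U β T t (h t).snd ∧
        -- uniqueness
        (∀ p ∈ sobolevH1ZeroMean (gibbsMeasure U (β t)),
          SolvesContinuityEq U β T t p.snd → p = h t) ∧
        -- the gradient is the solution of minimal norm, and the only one of this norm
        (∀ w : Lp (Rd d) 2 (gibbsMeasure U (β t)), SolvesContinuityEq U β T t w →
          ‖(h t).snd‖ ≤ ‖w‖ ∧ (‖w‖ = ‖(h t).snd‖ → w = (h t).snd))) ∧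
      -- finite length and absolute continuity
      (IntegrableOn (derivWithin β (Ico 0 T)) (Ico 0 T) →
        IntegrableOn (fun t => ‖(h t).snd‖) (Ico 0 T) ∧
        IsACCurveW2 (Ico 0 T) (fun t => gibbsMeasure U (β t))) := by
  obtain ⟨c, hV⟩ := exists_isConfining_add_const hU.continuous htail
  have heq := gibbsDensity_add_const U c
  have hV1 : ContDiff ℝ 1 fun x => U x + c := hU.add contDiff_const
  have hgrad' : ∃ α > 0, ∃ R > 0, ∀ x : Rd d, R < ‖x‖ →
      α * ‖x‖ ^ 2 ≤ inner ℝ (∇ (fun x => U x + c) x) x := by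
    simpa only [gradient, fderiv_add_const] using hgrad
  -- The types of the potentials depend on the measure, so `U` is exchanged for `U + c` in the whole
  -- goal at once, at the level of the density through which every occurrence factors.
  unfold SolvesContinuityEq gibbsDensityDeriv gibbsMeasure
  rw [← heq]
  refine ⟨fun t ht x => (hV.hasDerivWithinAt_gibbsDensity (hβ_ge t ht) hβ_diff ht
    x).differentiableWithinAt, fun t => derivWithin β (Ico 0 T) t • gibbsPotential _ (β t),
    fun t ht => ?_, fun hi => ?_⟩
  · exact hV.smul_gibbsPotential_spec hV1 hgrad' (hβ_ge t ht) hβ_diff ht rfl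
  · obtain ⟨b₁, hb⟩ := exists_forall_mem_Icc_of_integrableOn_derivWithin hβ_ge hβ_diff hi
    exact ⟨hV.integrableOn_norm_smul_gibbsPotential hV1 hgrad' hb hβ_diff hi,
      hV.isACCurveW2_gibbsMeasure hV1 hgrad' hT hb hβ_diff hi⟩
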